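/- **Theorem 1 (CLT for batch active inference).** Setting. Let $(X_i,Y_i)_{i\ge 1}$ be i.i.d. from a law $\mathbb P$ on $\mathcal X\times\mathcal Y$, let $f:\mathcal X\to\mathcal Y$ be a fixed measurable predictive model, and let $\ell_\theta(x,y)$ be a loss that is convex in $\theta\in\Theta\subseteq\mathbb R^d$, with $\ell_\theta(X,Y)$ integrable for $\theta\in\Theta$. Write $L(\theta)=\mathbb E[\ell_\theta(X,Y)]$ and $L^f(\theta)=\mathbb E[\ell_\theta(X,f(X))]$, and let $\theta^*=\arg\min_{\theta\in\Theta}L(\theta)$ lie in the interior of $\Theta$ (for instance $\Theta=\mathbb R^d$). Let $u:\mathcal X\to[0,\infty)$ be a measurable uncertainty measure and $\mathcal H\subseteq[0,\infty)$ a set of scalings such that $\pi_\eta(x):=\eta\,u(x)\in[0,1]$ for all $\eta\in\mathcal H$ and $x\in\mathcal X$. Given budgets $n_b=n_b(n)$, let $$\hat\eta=\max\Big\{\eta\in\mathcal H:\ \eta\sum_{i=1}^n u(X_i)\le n_b\Big\}$$ (an arbitrary measurable $\mathcal H$-valued function of $X_1,\dots,X_n$ on samples where this maximum does not exist). For a sampling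 rule $\pi$ and label decisions $\xi_i$ that, given $(X_j,Y_j)_{j\le n}$, are independent with $\xi_i\sim\mathrm{Bern}(\pi(X_i))$, put $$L^\pi(\theta)=\frac1n\sum_{i=1}^n\Big(\ell_\theta(X_i,f(X_i))+\big(\ell_\theta(X_i,Y_i)-\ell_\theta(X_i,f(X_i))\big)\frac{\xi_i}{\pi(X_i)}\Big),\qquad \hat\theta^\pi=\arg\min_{\theta\in\Theta}L^\pi(\theta).$$ Here the minimizer is chosen by one measurable selection, as a function of $\eta$ and of the sample $(X_i,Y_i,\xi_i)_{i\le n}$; it is the same for all $\pi=\pi_\eta$. Write $\hat\theta^\eta=\hat\theta^{\pi_\eta}$; in particular $\hat\theta^{\hat\eta}$ uses $\xi_i\sim\mathrm{Bern}(\pi_{\hat\eta}(X_i))$. Smoothness. Assume that (i) $\theta\mapsto\ell_\theta(x,y)$ is differentiable at $\theta^*$ for all $(x,y)$; (ii) on some neighborhood of $\theta^*$, $\ell_\theta(x,y)$ is $C(x,y)$-Lipschitz and $\ell_\theta(x,f(x))$ is $C_f(x)$-Lipschitz in $\theta$, with $\mathbb E[C(X,Y)^2]<\infty$ and $\mathbb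 E[C_f(X)^2]<\infty$; (iii) $L$ and $L^f$ are twice differentiable at $\theta^*$ ($L^f$ being finite near $\theta^*$), and $H_{\theta^*}=\nabla^2L(\theta^*)$ is positive definite. Claim. Suppose that there is $\eta^*\in\mathcal H$ with $\mathbb P(\hat\eta\ne\eta^*)\to0$; that near $\theta^*$ the difference $\ell_\theta(x,y)-\ell_\theta(x,f(x))$ is $D(x,y)$-Lipschitz in $\theta$ with $\mathbb E[D(X,Y)^2/\pi_{\eta^*}(X)]<\infty$ (where $0/0=0$; this follows from (ii) if $\pi_{\eta^*}$ is bounded away from $0$); that $L^{\pi_{\eta^*}}$ has a minimizer over $\Theta$ with probability tending to one; and that $\hat\theta^{\eta^*}\stackrel{p}{\to}\theta^*$. Then $$\sqrt n\,(\hat\theta^{\hat\eta}-\theta^*)\stackrel{d}{\to}\mathcal N(0,\Sigma_*),\qquad \Sigma_*=H_{\theta^*}^{-1}\,\mathrm{Var}\Big(\nabla\ell_{\theta^*}(X,f(X))+\big(\nabla\ell_{\theta^*}(X,Y)-\nabla\ell_{\theta^*}(X,f(X))\big)\frac{\xi^{\eta^*}}{\pi_{\eta^*}(X)}\Big)H_{\theta^*}^{-1},$$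 where $\xi^{\eta^*}\sim\mathrm{Bern}(\pi_{\eta^*}(X))$ given $(X,Y)\sim\mathbb P$. Consequently, for any $\hat\Sigma\stackrel{p}{\to}\Sigma_*$, any coordinate $j$ with $\Sigma_{*,jj}>0$ and any $\alpha\in(0,1)$, the interval $\mathcal C_\alpha=\big[\hat\theta^{\hat\eta}_j\pm z_{1-\alpha/2}\sqrt{\hat\Sigma_{jj}/n}\big]$ satisfies $$\lim_{n\to\infty}\mathbb P(\theta^*_j\in\mathcal C_\alpha)=1-\alpha,$$ with $z_q$ the $q$-quantile of the standard normal distribution. -/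

import Mathlib

open MeasureTheory ProbabilityTheory Filter Topology

namespace ActiveInference

noncomputable section

/-- Sampling rule `π_η(x) = η u(x)`. -/
def samplingRule {𝒳 : Type*} (u : 𝒳 → ℝ) (η : ℝ) (x : 𝒳) : ℝ := η * u x

/-- The scalings in `𝓗` that meet the budget `nb` on the features `x`. -/
def feasibleScalings {𝒳 : Type*} (u : 𝒳 → ℝ) (𝓗 : Set ℝ) (nb : ℝ) {n : ℕ}
    (x : Fin n → 𝒳) : Set ℝ :=
  {η | η ∈ 𝓗 ∧ η * ∑ i, u (x i) ≤ nb}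

/-- The label decision as a number: `1` if the label is collected, `0` if not. -/
def labelInd (b : Bool) : ℝ := if b then 1 else 0

/-- Conditionally on the data `Z = (X_i, Y_i)_i`, the decisions `ξ_i` are independent and
`ξ_i ∼ Bern(p_i)`. Here `p` is a function of `Z` wherever this is used. -/
def IsBernoulliLabeling {Ω 𝒵 : Type*} [MeasurableSpace Ω] [MeasurableSpace 𝒵]
    (P : Measure Ω) {n : ℕ} (Z : Ω → Fin n → 𝒵) (p : Ω → Fin n → ℝ)
    (ξ : Ω → Fin n → Bool) : Prop :=
  Measurable ξ ∧
    ∀ A : Set (Fin n → 𝒵), MeasurableSet A → ∀ b : Fin n → Bool,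
      P (Z ⁻¹' A ∩ ξ ⁻¹' {b}) =
        ∫⁻ ω in Z ⁻¹' A, ∏ i, ENNReal.ofReal (if b i then p ω i else 1 - p ω i) ∂P

/-- The law of `((X, Y), ξ)` when `(X, Y) ∼ Q` and `ξ ∼ Bern(π(X))` given `(X, Y)`. -/
def labeledLaw {𝒳 𝒴 : Type*} [MeasurableSpace 𝒳] [MeasurableSpace 𝒴]
    (Q : Measure (𝒳 × 𝒴)) (π : 𝒳 → ℝ) : Measure ((𝒳 × 𝒴) × Bool) :=
  (Q.withDensity fun z => ENNReal.ofReal (π z.1)).map (fun z => (z, true)) +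
    (Q.withDensity fun z => ENNReal.ofReal (1 - π z.1)).map (fun z => (z, false))

section Loss

variable {𝒳 𝒴 : Type*} {d : ℕ} (ℓ : EuclideanSpace ℝ (Fin d) → 𝒳 → 𝒴 → ℝ) (f : 𝒳 → 𝒴)

/-- Population loss `L(θ) = E[ℓ_θ(X, Y)]`. -/
def popLoss [MeasurableSpace 𝒳] [MeasurableSpace 𝒴] (Q : Measure (𝒳 × 𝒴))
    (θ : EuclideanSpace ℝ (Fin d)) : ℝ :=
  ∫ z, ℓ θ z.1 z.2 ∂Q

/-- Population loss on predicted labels, `L^f(θ) = E[ℓ_θ(X, f(X))]`. -/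
def popLossPred [MeasurableSpace 𝒳] [MeasurableSpace 𝒴] (Q : Measure (𝒳 × 𝒴))
    (θ : EuclideanSpace ℝ (Fin d)) : ℝ :=
  ∫ z, ℓ θ z.1 (f z.1) ∂Q

/-- Increment `ℓ_θ(x, f(x)) + (ℓ_θ(x, y) - ℓ_θ(x, f(x))) ξ / π(x)`. -/
def ipwLoss (π : 𝒳 → ℝ) (θ : EuclideanSpace ℝ (Fin d)) (w : (𝒳 × 𝒴) × Bool) : ℝ :=
  ℓ θ w.1.1 (f w.1.1) +
    (ℓ θ w.1.1 w.1.2 - ℓ θ w.1.1 (f w.1.1)) * (labelInd w.2 / π w.1.1)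

/-- Empirical loss `L^π(θ)` on `n` data points with label decisions. -/
def activeLoss (π : 𝒳 → ℝ) {n : ℕ} (w : Fin n → (𝒳 × 𝒴) × Bool)
    (θ : EuclideanSpace ℝ (Fin d)) : ℝ :=
  (1 / (n : ℝ)) * ∑ i, ipwLoss ℓ f π θ (w i)

/-- `∇ℓ_θ(x, f(x)) + (∇ℓ_θ(x, y) - ∇ℓ_θ(x, f(x))) ξ / π(x)`. -/
def ipwGrad (π : 𝒳 → ℝ) (θ : EuclideanSpace ℝ (Fin d)) (w : (𝒳 × 𝒴) × Bool) :
    EuclideanSpace ℝ (Fin d) :=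
  gradient (fun t => ℓ t w.1.1 (f w.1.1)) θ +
    (labelInd w.2 / π w.1.1) •
      (gradient (fun t => ℓ t w.1.1 w.1.2) θ - gradient (fun t => ℓ t w.1.1 (f w.1.1)) θ)

/-- Covariance matrix of the gradient increment at `θ` under the sampling rule `π`. -/
def gradCov [MeasurableSpace 𝒳] [MeasurableSpace 𝒴] (Q : Measure (𝒳 × 𝒴)) (π : 𝒳 → ℝ)
    (θ : EuclideanSpace ℝ (Fin d)) : Matrix (Fin d) (Fin d) ℝ :=
  Matrix.of fun i j =>
    cov[fun w => ipwGrad ℓ f π θ w i, fun w => ipwGrad ℓ f π θ w j; labeledLaw Q π]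

/-- The sandwich covariance `H⁻¹ Var(gradient increment) H⁻¹`. -/
def sandwichCov [MeasurableSpace 𝒳] [MeasurableSpace 𝒴] (Q : Measure (𝒳 × 𝒴)) (π : 𝒳 → ℝ)
    (θ : EuclideanSpace ℝ (Fin d)) (H : Matrix (Fin d) (Fin d) ℝ) :
    Matrix (Fin d) (Fin d) ℝ :=
  H⁻¹ * gradCov ℓ f Q π θ * H⁻¹

end Loss

/-- `θ` minimizes `g` over the parameter set `Θ`. -/
def IsArgmin {E : Type*} (g : E → ℝ) (Θ : Set E) (θ : E) : Prop :=
  θ ∈ Θ ∧ IsMinOn g Θ θ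

/-- `g` is twice differentiable at `θ` with Hessian matrix `H`. -/
def HasHessianAt {d : ℕ} (g : EuclideanSpace ℝ (Fin d) → ℝ) (H : Matrix (Fin d) (Fin d) ℝ)
    (θ : EuclideanSpace ℝ (Fin d)) : Prop :=
  (∀ᶠ t in 𝓝 θ, DifferentiableAt ℝ g t) ∧
    HasFDerivAt (fun t => gradient g t) (Matrix.toEuclideanCLM (n := Fin d) (𝕜 := ℝ) H) θ

/-- The smoothness assumption on the loss, with `H` the Hessian of the population loss. -/
structure SmoothLoss {𝒳 𝒴 : Type*} [MeasurableSpace 𝒳] [MeasurableSpace 𝒴] {d : ℕ}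
    (ℓ : EuclideanSpace ℝ (Fin d) → 𝒳 → 𝒴 → ℝ) (f : 𝒳 → 𝒴) (Q : Measure (𝒳 × 𝒴))
    (θs : EuclideanSpace ℝ (Fin d)) (H : Matrix (Fin d) (Fin d) ℝ) : Prop where
  differentiable : ∀ x y, DifferentiableAt ℝ (fun θ => ℓ θ x y) θs
  lipschitz : ∃ U ∈ 𝓝 θs, ∃ C : 𝒳 → 𝒴 → ℝ, ∃ Cf : 𝒳 → ℝ,
    (∀ x y, ∀ θ ∈ U, ∀ θ' ∈ U, |ℓ θ x y - ℓ θ' x y| ≤ C x y * ‖θ - θ'‖) ∧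
    (∀ x, ∀ θ ∈ U, ∀ θ' ∈ U, |ℓ θ x (f x) - ℓ θ' x (f x)| ≤ Cf x * ‖θ - θ'‖) ∧
    MemLp (fun z : 𝒳 × 𝒴 => C z.1 z.2) 2 Q ∧ MemLp (fun z : 𝒳 × 𝒴 => Cf z.1) 2 Q
  /-- `L^f` is finite near `θs`, so that its Hessian is meaningful. -/
  integrable_pred : ∀ᶠ θ in 𝓝 θs, Integrable (fun z : 𝒳 × 𝒴 => ℓ θ z.1 (f z.1)) Q
  hessian_pred : ∃ Hf, HasHessianAt (popLossPred ℓ f Q) Hf θs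
  hessian : HasHessianAt (popLoss ℓ Q) H θs
  posDef : H.PosDef

/-- Finite second moments for inverse-propensity weighting: near `θs` the difference
`ℓ_θ(x, y) - ℓ_θ(x, f(x))` is `D(x, y)`-Lipschitz in `θ` with `E[D(X, Y)² / π(X)] < ∞`.
The quotient is taken in `[0, ∞]`, so `π` may vanish only where `D` does. -/
def IPWSquareIntegrable {𝒳 𝒴 : Type*} [MeasurableSpace 𝒳] [MeasurableSpace 𝒴] {d : ℕ}
    (ℓ : EuclideanSpace ℝ (Fin d) → 𝒳 → 𝒴 → ℝ) (f : 𝒳 → 𝒴) (Q : Measure (𝒳 × 𝒴))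
    (π : 𝒳 → ℝ) (θs : EuclideanSpace ℝ (Fin d)) : Prop :=
  ∃ U ∈ 𝓝 θs, ∃ D : 𝒳 → 𝒴 → ℝ,
    (∀ x y, ∀ θ ∈ U, ∀ θ' ∈ U,
      |(ℓ θ x y - ℓ θ x (f x)) - (ℓ θ' x y - ℓ θ' x (f x))| ≤ D x y * ‖θ - θ'‖) ∧
    AEMeasurable (fun z : 𝒳 × 𝒴 => D z.1 z.2) Q ∧
    ∫⁻ z, ENNReal.ofReal (D z.1 z.2 ^ 2) / ENNReal.ofReal (π z.1) ∂Q < ⊤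

/-- The `q`-th quantile of the standard normal distribution. -/
def stdNormalQuantile (q : ℝ) : ℝ := sInf {x : ℝ | q ≤ cdf (gaussianReal 0 1) x}

/-- The sample `((X_i, Y_i), ξ_i)_{i < n}`. -/
def sample {Ω 𝒳 𝒴 : Type*} (X : ℕ → Ω → 𝒳) (Y : ℕ → Ω → 𝒴) {n : ℕ} (ξ : Ω → Fin n → Bool)
    (ω : Ω) (i : Fin n) : (𝒳 × 𝒴) × Bool :=
  ((X i ω, Y i ω), ξ ω i)

end

end ActiveInference

/-!
Write `ν` for the law of `((X, Y), ξ)` under the limiting rule `π = π_{η*}` and `m θ` for the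
inverse-propensity weighted loss `ipwLoss`. Since its label weights `1 - ξ / π` may be negative,
`m θ` is not convex in `θ`, and convexity of `ℓ` gives no control of the empirical minimizer. What
is left is that `m` is Lipschitz in `θ` near `θs` with a square integrable constant (the label
indicator turns `E[(D ξ / π)²]` into `E[D² / π]`), that it is differentiable at `θs`, and that it is
unbiased, so that its mean inherits the quadratic expansion of `popLoss` at the minimizer `θs`.

These properties suffice for asymptotic linearity. Let `q h = m (θs + h) - m θs - ⟪g, h⟫` be the
remainder of the linearization. It is Lipschitz in `h`, and `E[(q h)²] = o(‖h‖²)` by dominated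
convergence. Truncating where the Lipschitz constant exceeds `√n` makes the increments of the
empirical process subexponential, and dyadic chaining bounds its supremum over a ball
(`exists_finset_chaining`, `exists_maximal_bound`). Peeling over dyadic shells shows that, with high
probability, the empirical process of `q h` is at most `ε (1 + n ‖h‖²) / √n` near zero
(`exists_measure_empProc_gt_le`). Hence the empirical criterion is a quadratic in `h` up to an error
`o(1 + n ‖h‖²)`; comparing its value at the consistent minimizer with that at the minimizer
`-H⁻¹ Gₙ` of the quadratic, `Gₙ = n^{-1/2} ∑ g`, gives `√n (θ̂ - θs) = -H⁻¹ Gₙ + o(1)` in probability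
(`tendstoInMeasure_argmin_linearization`).

The central limit theorem for `Gₙ` comes from characteristic functions. The label decisions under
`η̂` and under `η*` have the same conditional law on the event `η̂ = η*`, so the laws of the two
estimators differ by at most `P(η̂ ≠ η*) → 0` in total variation
(`tendstoInDistribution_of_fixedRule`). Coverage of the intervals follows from the portmanteau
theorem for intervals with a fixed endpoint, between which the random threshold is sandwiched
(`tendsto_measureReal_mem_interval`).
-/

namespace ActiveInference

open scoped ENNReal RealInnerProductSpace

/-! ### Chaining on a cube -/

/-- The point of the dyadic grid of mesh `2⁻ᵏ` with integer coordinates `z`. -/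
noncomputable def dyadicPoint {d : ℕ} (k : ℕ) (z : Fin d → ℤ) : Fin d → ℝ :=
  fun i => (z i : ℝ) / 2 ^ k

/-- Integer coordinates of the dyadic grid points of mesh `2⁻ᵏ` in the cube `[-1, 1]ᵈ`. -/
noncomputable def dyadicIndex (d k : ℕ) : Finset (Fin d → ℤ) :=
  Fintype.piFinset fun _ => Finset.Icc (-2 ^ k) (2 ^ k)

/-- Integer coordinates of the dyadic grid point of mesh `2⁻ᵏ` just below `v`. -/
noncomputable def dyadicFloor {d : ℕ} (k : ℕ) (v : Fin d → ℝ) : Fin d → ℤ :=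
  fun i => ⌊2 ^ k * v i⌋

/-- The cube `[-1, 1]ᵈ`. -/
def cube (d : ℕ) : Set (Fin d → ℝ) := {v | ∀ i, |v i| ≤ 1}

lemma dyadicPoint_mem_cube {d k : ℕ} {z : Fin d → ℤ} (hz : z ∈ dyadicIndex d k) :
    dyadicPoint k z ∈ cube d := by
  intro i
  have h := Finset.mem_Icc.1 (Fintype.mem_piFinset.1 hz i)
  have h1 : (-2 ^ k : ℝ) ≤ z i := by exact_mod_cast h.1
  have h2 : (z i : ℝ) ≤ 2 ^ k := by exact_mod_cast h.2
  rw [dyadicPoint, abs_div, abs_of_pos (by positivity : (0 : ℝ) < 2 ^ k), div_le_one (by positivity)]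
  exact abs_le.2 ⟨h1, h2⟩

lemma dyadicFloor_mem_index {d k : ℕ} {v : Fin d → ℝ} (hv : v ∈ cube d) :
    dyadicFloor k v ∈ dyadicIndex d k := by
  refine Fintype.mem_piFinset.2 fun i => Finset.mem_Icc.2 ?_
  have h := abs_le.1 (hv i)
  have hk : (0 : ℝ) < 2 ^ k := by positivity
  constructor
  · refine Int.le_floor.2 ?_
    push_cast
    nlinarith
  · have : (dyadicFloor k v i : ℝ) ≤ 2 ^ k * v i := Int.floor_le _
    have h3 : (dyadicFloor k v i : ℝ) ≤ 2 ^ k := by nlinarith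
    exact_mod_cast h3

lemma dist_dyadicPoint_floor_le {d : ℕ} (k : ℕ) (v : Fin d → ℝ) :
    dist (dyadicPoint k (dyadicFloor k v)) v ≤ 1 / 2 ^ k := by
  refine (dist_pi_le_iff (by positivity)).2 fun i => ?_
  have hk : (0 : ℝ) < 2 ^ k := by positivity
  have h1 : (⌊2 ^ k * v i⌋ : ℝ) ≤ 2 ^ k * v i := Int.floor_le _
  have h2 : 2 ^ k * v i < ⌊2 ^ k * v i⌋ + 1 := Int.lt_floor_add_one _
  rw [Real.dist_eq, dyadicPoint, dyadicFloor,
    show (⌊2 ^ k * v i⌋ : ℝ) / 2 ^ k - v i = (⌊2 ^ k * v i⌋ - 2 ^ k * v i) / 2 ^ k by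
      field_simp, abs_div, abs_of_pos hk]
  gcongr
  rw [abs_le]
  constructor <;> linarith

lemma dyadicFloor_succ_div_two {d : ℕ} (k : ℕ) (v : Fin d → ℝ) :
    (fun i => dyadicFloor (k + 1) v i / 2) = dyadicFloor k v := by
  funext i
  have := Int.floor_div_natCast (2 ^ (k + 1) * v i) 2
  rw [dyadicFloor, dyadicFloor, show (2 : ℝ) ^ k * v i = 2 ^ (k + 1) * v i / (2 : ℕ) by
    rw [pow_succ]; push_cast; ring, this]
  rfl

lemma half_mem_dyadicIndex {d k : ℕ} {z : Fin d → ℤ} (hz : z ∈ dyadicIndex d (k + 1)) :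
    (fun i => z i / 2) ∈ dyadicIndex d k := by
  refine Fintype.mem_piFinset.2 fun i => Finset.mem_Icc.2 ?_
  have h := Finset.mem_Icc.1 (Fintype.mem_piFinset.1 hz i)
  rw [pow_succ] at h
  omega

lemma norm_dyadicPoint_sub_half_le {d : ℕ} (k : ℕ) (z : Fin d → ℤ) :
    ‖dyadicPoint (k + 1) z - dyadicPoint k (fun i => z i / 2)‖ ≤ 1 / 2 ^ k := by
  refine (pi_norm_le_iff_of_nonneg (by positivity)).2 fun i => ?_
  have hk : (0 : ℝ) < 2 ^ k := by positivity
  have h : z i = 2 * (z i / 2) + z i % 2 := by omega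
  have h' : (z i : ℝ) = 2 * ((z i / 2 : ℤ) : ℝ) + ((z i % 2 : ℤ) : ℝ) := by exact_mod_cast h
  have h0 : (0 : ℝ) ≤ ((z i % 2 : ℤ) : ℝ) := by exact_mod_cast Int.emod_nonneg _ two_ne_zero
  have h1 : ((z i % 2 : ℤ) : ℝ) ≤ 1 := by exact_mod_cast (by omega : z i % 2 ≤ 1)
  rw [Pi.sub_apply, dyadicPoint, dyadicPoint,
    show (z i : ℝ) / 2 ^ (k + 1) - ((z i / 2 : ℤ) : ℝ) / 2 ^ k = ((z i % 2 : ℤ) : ℝ) / 2 / 2 ^ k by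
      rw [h', pow_succ]; field_simp; ring,
    Real.norm_eq_abs, abs_of_nonneg (by positivity)]
  gcongr
  linarith

lemma card_dyadicIndex_le (d k : ℕ) : ((dyadicIndex d k).card : ℝ) ≤ Real.exp ((k + 2) * d) := by
  have h : (dyadicIndex d k).card = (2 ^ (k + 1) + 1) ^ d := by
    rw [dyadicIndex, Fintype.card_piFinset_const, Int.card_Icc]
    congr 1
    have : ((2 : ℤ) ^ k + 1 - -2 ^ k) = ((2 ^ (k + 1) + 1 : ℕ) : ℤ) := by push_cast; ring
    rw [this, Int.toNat_natCast]
  rw [h]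
  push_cast
  have h2 : (2 : ℝ) ^ (k + 1) + 1 ≤ Real.exp (k + 2) := by
    calc (2 : ℝ) ^ (k + 1) + 1 ≤ 2 ^ (k + 2) := by
          have : (1 : ℝ) ≤ 2 ^ (k + 1) := one_le_pow₀ (by norm_num)
          rw [pow_succ 2 (k + 1)]; linarith
      _ ≤ Real.exp 1 ^ (k + 2) := by
          gcongr
          have := Real.add_one_le_exp (1 : ℝ)
          linarith
      _ = Real.exp (k + 2) := by rw [← Real.exp_nat_mul]; push_cast; ring_nf
  calc ((2 : ℝ) ^ (k + 1) + 1) ^ d ≤ Real.exp (k + 2) ^ d := by gcongr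
    _ = Real.exp ((k + 2) * d) := by rw [← Real.exp_nat_mul]; ring_nf

/-- The largest increment of `y` along the edges from the grid of mesh `2⁻⁽ᵏ⁺¹⁾` to the grid of
mesh `2⁻ᵏ`. -/
noncomputable def dyadicOsc {d : ℕ} (k : ℕ) (y : (Fin d → ℝ) → ℝ) : ℝ≥0∞ :=
  (dyadicIndex d (k + 1)).sup fun z =>
    ENNReal.ofReal |y (dyadicPoint (k + 1) z) - y (dyadicPoint k (fun i => z i / 2))|

lemma ofReal_abs_sub_dyadic_le {d : ℕ} {y : (Fin d → ℝ) → ℝ} (hy : ContinuousOn y (cube d))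
    {v : Fin d → ℝ} (hv : v ∈ cube d) (k : ℕ) :
    ENNReal.ofReal |y v - y (dyadicPoint k (dyadicFloor k v))| ≤ ∑' j, dyadicOsc (k + j) y := by
  set p : ℕ → Fin d → ℝ := fun j => dyadicPoint j (dyadicFloor j v) with hp
  have hstep : ∀ j, ENNReal.ofReal |y (p (k + j)) - y (p k)| ≤
      ∑ i ∈ Finset.range j, dyadicOsc (k + i) y := by
    intro j
    induction j with
    | zero => simp
    | succ j ih =>
      rw [Finset.sum_range_succ]
      have h1 : ENNReal.ofReal |y (p (k + (j + 1))) - y (p (k + j))| ≤ dyadicOsc (k + j) y := by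
        have hmem : dyadicFloor (k + j + 1) v ∈ dyadicIndex d (k + j + 1) :=
          dyadicFloor_mem_index hv
        refine le_trans (le_of_eq ?_) (Finset.le_sup hmem)
        rw [dyadicFloor_succ_div_two]
        rfl
      calc ENNReal.ofReal |y (p (k + (j + 1))) - y (p k)|
          ≤ ENNReal.ofReal (|y (p (k + j)) - y (p k)| + |y (p (k + (j + 1))) - y (p (k + j))|) := by
            apply ENNReal.ofReal_le_ofReal
            have := abs_add_le (y (p (k + j)) - y (p k)) (y (p (k + (j + 1))) - y (p (k + j)))
            rwa [show y (p (k + j)) - y (p k) + (y (p (k + (j + 1))) - y (p (k + j))) =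
              y (p (k + (j + 1))) - y (p k) by ring] at this
        _ ≤ _ := ENNReal.ofReal_add_le.trans (add_le_add ih h1)
  have hlim : Tendsto (fun j => y (p (k + j))) atTop (𝓝 (y v)) := by
    have hpv : Tendsto (fun j => p (k + j)) atTop (𝓝 v) := by
      have hpv' : Tendsto p atTop (𝓝 v) := by
        refine tendsto_iff_dist_tendsto_zero.2 (squeeze_zero (fun _ => dist_nonneg)
          (fun j => dist_dyadicPoint_floor_le j v) ?_)
        have := tendsto_pow_atTop_nhds_zero_of_lt_one (r := (1 / 2 : ℝ)) (by norm_num) (by norm_num)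
        simpa [one_div] using this
      exact hpv'.comp (tendsto_atTop_mono (fun j => Nat.le_add_left j k) tendsto_id)
    have := (hy v hv).tendsto.comp (tendsto_nhdsWithin_iff.2 ⟨hpv, Eventually.of_forall fun j =>
      dyadicPoint_mem_cube (dyadicFloor_mem_index hv)⟩)
    exact this
  have hlim' : Tendsto (fun j => ENNReal.ofReal |y (p (k + j)) - y (p k)|) atTop
      (𝓝 (ENNReal.ofReal |y v - y (p k)|)) :=
    ENNReal.tendsto_ofReal ((hlim.sub_const _).abs)
  exact le_of_tendsto' hlim' fun j => (hstep j).trans (ENNReal.sum_le_tsum _)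

/-- A maximum over `N ≤ exp L` variables with an exponential moment at scale `s` is of order
`s * L`, because `y ≤ L + exp (-L) * exp y`. -/
lemma lintegral_dyadicOsc_le {Ω : Type*} [MeasurableSpace Ω] {μ : Measure Ω}
    [IsProbabilityMeasure μ] {d : ℕ} {Y : (Fin d → ℝ) → Ω → ℝ} (hYm : ∀ v ∈ cube d, Measurable (Y v))
    {c K : ℝ} (hc : 0 < c) (hK : 0 ≤ K)
    (hY : ∀ v ∈ cube d, ∀ v' ∈ cube d, ∀ s > 0, ‖v - v'‖ ≤ s →
      ∫⁻ ω, ENNReal.ofReal (Real.exp (|Y v ω - Y v' ω| / (c * s))) ∂μ ≤ ENNReal.ofReal K) (k : ℕ) :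
    ∫⁻ ω, dyadicOsc k (fun v => Y v ω) ∂μ ≤
      ENNReal.ofReal (c * (1 / 2) ^ k * ((k + 3) * d + K)) := by
  set s : ℝ := 1 / 2 ^ k with hs
  set L : ℝ := (k + 3) * d with hL
  have hs0 : 0 < s := by positivity
  have hL0 : 0 ≤ L := by positivity
  let Δ : (Fin d → ℤ) → Ω → ℝ := fun z ω =>
    |Y (dyadicPoint (k + 1) z) ω - Y (dyadicPoint k (fun i => z i / 2)) ω|
  have hΔm : ∀ z ∈ dyadicIndex d (k + 1), Measurable (Δ z) := fun z hz =>
    ((hYm _ (dyadicPoint_mem_cube hz)).sub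
      (hYm _ (dyadicPoint_mem_cube (half_mem_dyadicIndex hz)))).abs
  have hpt : ∀ ω, dyadicOsc k (fun v => Y v ω) ≤ ENNReal.ofReal (c * s * L) +
      ENNReal.ofReal (c * s * Real.exp (-L)) *
        ∑ z ∈ dyadicIndex d (k + 1), ENNReal.ofReal (Real.exp (Δ z ω / (c * s))) := by
    intro ω
    refine Finset.sup_le fun z hz => ?_
    have h1 : Δ z ω ≤ c * s * L + c * s * Real.exp (-L) * Real.exp (Δ z ω / (c * s)) := by
      have h2 := Real.add_one_le_exp (Δ z ω / (c * s) - L)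
      have h3 : Δ z ω / (c * s) ≤ L + Real.exp (-L) * Real.exp (Δ z ω / (c * s)) := by
        rw [← Real.exp_add, show -L + Δ z ω / (c * s) = Δ z ω / (c * s) - L by ring]
        linarith
      rw [div_le_iff₀ (by positivity)] at h3
      linarith
    calc ENNReal.ofReal (Δ z ω)
        ≤ ENNReal.ofReal (c * s * L + c * s * Real.exp (-L) * Real.exp (Δ z ω / (c * s))) :=
          ENNReal.ofReal_le_ofReal h1
      _ = ENNReal.ofReal (c * s * L) + ENNReal.ofReal (c * s * Real.exp (-L)) *
            ENNReal.ofReal (Real.exp (Δ z ω / (c * s))) := by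
          rw [ENNReal.ofReal_add (by positivity) (by positivity),
            ENNReal.ofReal_mul (p := c * s * Real.exp (-L)) (by positivity)]
      _ ≤ _ := by
          gcongr
          exact Finset.single_le_sum
            (f := fun z => ENNReal.ofReal (Real.exp (Δ z ω / (c * s)))) (fun _ _ => zero_le) hz
  have hm : ∀ z ∈ dyadicIndex d (k + 1),
      Measurable fun ω => ENNReal.ofReal (Real.exp (Δ z ω / (c * s))) := fun z hz =>
    (Real.measurable_exp.comp ((hΔm z hz).div_const _)).ennreal_ofReal
  calc ∫⁻ ω, dyadicOsc k (fun v => Y v ω) ∂μ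
      ≤ ∫⁻ ω, (ENNReal.ofReal (c * s * L) + ENNReal.ofReal (c * s * Real.exp (-L)) *
        ∑ z ∈ dyadicIndex d (k + 1), ENNReal.ofReal (Real.exp (Δ z ω / (c * s)))) ∂μ :=
        lintegral_mono hpt
    _ = ENNReal.ofReal (c * s * L) + ENNReal.ofReal (c * s * Real.exp (-L)) *
        ∑ z ∈ dyadicIndex d (k + 1), ∫⁻ ω, ENNReal.ofReal (Real.exp (Δ z ω / (c * s))) ∂μ := by
        rw [lintegral_add_left measurable_const, lintegral_const, measure_univ, mul_one,
          lintegral_const_mul _ (Finset.measurable_fun_sum _ hm), lintegral_finsetSum _ hm]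
    _ ≤ ENNReal.ofReal (c * s * L) + ENNReal.ofReal (c * s * Real.exp (-L)) *
        ∑ z ∈ dyadicIndex d (k + 1), ENNReal.ofReal K := by
        gcongr with z hz
        exact hY _ (dyadicPoint_mem_cube hz) _ (dyadicPoint_mem_cube (half_mem_dyadicIndex hz)) s hs0
          (norm_dyadicPoint_sub_half_le k z)
    _ = ENNReal.ofReal (c * s * L + c * s * Real.exp (-L) * ((dyadicIndex d (k + 1)).card * K)) := by
        rw [Finset.sum_const, nsmul_eq_mul, ← ENNReal.ofReal_natCast, ← ENNReal.ofReal_mul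
          (by positivity), ← ENNReal.ofReal_mul (by positivity), ← ENNReal.ofReal_add
          (by positivity) (by positivity)]
    _ ≤ _ := by
        apply ENNReal.ofReal_le_ofReal
        have hcard := card_dyadicIndex_le d (k + 1)
        have hcard' : ((dyadicIndex d (k + 1)).card : ℝ) ≤ Real.exp L := by
          refine hcard.trans (le_of_eq ?_)
          rw [hL]; push_cast; ring_nf
        have h4 : Real.exp (-L) * ((dyadicIndex d (k + 1)).card * K) ≤ K := by
          calc Real.exp (-L) * ((dyadicIndex d (k + 1)).card * K)
              ≤ Real.exp (-L) * (Real.exp L * K) := by gcongr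
            _ = K := by rw [← mul_assoc, ← Real.exp_add]; simp
        have hs' : (1 / 2 : ℝ) ^ k = s := by rw [hs, one_div_pow]
        rw [hs']
        have : 0 < c * s := by positivity
        nlinarith

lemma summable_chaining (c K : ℝ) (d : ℕ) :
    Summable fun k : ℕ => c * (1 / 2 : ℝ) ^ k * ((k + 3) * d + K) := by
  have h1 : Summable fun k : ℕ => (k : ℝ) ^ 1 * (1 / 2 : ℝ) ^ k :=
    summable_pow_mul_geometric_of_norm_lt_one 1 (by norm_num)
  have h2 : Summable fun k : ℕ => (1 / 2 : ℝ) ^ k := summable_geometric_two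
  refine ((h1.mul_left (c * d)).add (h2.mul_left (c * (3 * d + K)))).congr fun k => ?_
  ring

/-- Chaining: if the increments of a process with continuous paths on the cube have exponential
moments, uniformly at all scales, then a finite set of points, which depends on the moment bound
only, controls the whole process up to an error of small mean. -/
lemma exists_finset_chaining (d : ℕ) {c K ε : ℝ} (hc : 0 < c) (hK : 0 ≤ K) (hε : 0 < ε) :
    ∃ F : Finset (Fin d → ℝ), ↑F ⊆ cube d ∧
      ∀ {Ω : Type*} [MeasurableSpace Ω] (μ : Measure Ω) [IsProbabilityMeasure μ]
        (Y : (Fin d → ℝ) → Ω → ℝ), (∀ v ∈ cube d, Measurable (Y v)) →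
        (∀ ω, ContinuousOn (fun v => Y v ω) (cube d)) →
        (∀ v ∈ cube d, ∀ v' ∈ cube d, ∀ s > 0, ‖v - v'‖ ≤ s →
          ∫⁻ ω, ENNReal.ofReal (Real.exp (|Y v ω - Y v' ω| / (c * s))) ∂μ ≤ ENNReal.ofReal K) →
        ∃ S : Ω → ℝ≥0∞, Measurable S ∧ ∫⁻ ω, S ω ∂μ ≤ ENNReal.ofReal ε ∧
          ∀ v ∈ cube d, ∃ a ∈ F, ∀ ω, ENNReal.ofReal |Y v ω - Y a ω| ≤ S ω := by
  set b : ℕ → ℝ := fun k => c * (1 / 2 : ℝ) ^ k * ((k + 3) * d + K) with hb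
  have hb0 : ∀ k, 0 ≤ b k := fun k => by positivity
  obtain ⟨k, hk⟩ : ∃ k, ∑' j, b (j + k) < ε :=
    ((tendsto_sum_nat_add b).eventually_lt_const hε).exists
  classical
  refine ⟨(dyadicIndex d k).image (dyadicPoint k), ?_, ?_⟩
  · intro a ha
    obtain ⟨z, hz, rfl⟩ := Finset.mem_image.1 (Finset.mem_coe.1 ha)
    exact dyadicPoint_mem_cube hz
  intro Ω _ μ _ Y hYm hYc hY
  have hosc : ∀ j, Measurable fun ω => dyadicOsc j (fun v => Y v ω) := fun j => by
    simp only [dyadicOsc, Finset.sup_eq_iSup]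
    refine Measurable.biSup _ (Finset.countable_toSet _) fun z hz => ?_
    exact ((hYm _ (dyadicPoint_mem_cube hz)).sub
      (hYm _ (dyadicPoint_mem_cube (half_mem_dyadicIndex hz)))).abs.ennreal_ofReal
  refine ⟨fun ω => ∑' j, dyadicOsc (k + j) (fun v => Y v ω),
    Measurable.tsum fun j => hosc _, ?_, ?_⟩
  · rw [lintegral_tsum fun j => (hosc _).aemeasurable]
    calc ∑' j, ∫⁻ ω, dyadicOsc (k + j) (fun v => Y v ω) ∂μ
        ≤ ∑' j, ENNReal.ofReal (b (j + k)) := by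
          refine ENNReal.tsum_le_tsum fun j => ?_
          rw [add_comm j k]
          exact lintegral_dyadicOsc_le hYm hc hK hY (k + j)
      _ = ENNReal.ofReal (∑' j, b (j + k)) := by
          rw [ENNReal.ofReal_tsum_of_nonneg (fun j => hb0 _)
            ((summable_nat_add_iff k).2 (summable_chaining c K d))]
      _ ≤ _ := ENNReal.ofReal_le_ofReal hk.le
  · intro v hv
    exact ⟨_, Finset.mem_image_of_mem _ (dyadicFloor_mem_index hv), fun ω =>
      ofReal_abs_sub_dyadic_le (hYc ω) hv k⟩

/-! ### Moments of the empirical process -/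

/-- The empirical process `n^{-1/2} ∑ᵢ (φ(wᵢ) - E φ)` of the sample `w`, where `E` is the
expectation under `ν`. -/
noncomputable def empProc {𝒲 : Type*} [MeasurableSpace 𝒲] (ν : Measure 𝒲) (n : ℕ) (φ : 𝒲 → ℝ)
    (w : Fin n → 𝒲) : ℝ :=
  (√(n : ℝ))⁻¹ * ∑ i, (φ (w i) - ∫ x, φ x ∂ν)

section Moments

variable {𝒲 : Type*} [MeasurableSpace 𝒲] {ν : Measure 𝒲} {n : ℕ}

lemma measurable_empProc {φ : 𝒲 → ℝ} (hφ : Measurable φ) : Measurable (empProc ν n φ) := by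
  unfold empProc
  fun_prop

lemma empProc_sub {φ ψ : 𝒲 → ℝ} (hφ : Integrable φ ν) (hψ : Integrable ψ ν) (w : Fin n → 𝒲) :
    empProc ν n (fun x => φ x - ψ x) w = empProc ν n φ w - empProc ν n ψ w := by
  simp only [empProc, integral_sub hφ hψ]
  rw [← mul_sub, ← Finset.sum_sub_distrib]
  congr 2
  funext i
  ring

lemma empProc_add {φ ψ : 𝒲 → ℝ} (hφ : Integrable φ ν) (hψ : Integrable ψ ν) (w : Fin n → 𝒲) :
    empProc ν n (fun x => φ x + ψ x) w = empProc ν n φ w + empProc ν n ψ w := by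
  simp only [empProc, integral_add hφ hψ]
  rw [← mul_add, ← Finset.sum_add_distrib]
  congr 2
  funext i
  ring

lemma empProc_const_mul (c : ℝ) (φ : 𝒲 → ℝ) (w : Fin n → 𝒲) :
    empProc ν n (fun x => c * φ x) w = c * empProc ν n φ w := by
  simp only [empProc, integral_const_mul]
  rw [mul_left_comm, Finset.mul_sum (a := c)]
  congr 2
  funext i
  ring

lemma integral_exp_centered_le [IsProbabilityMeasure ν] {φ : 𝒲 → ℝ} (hφ : MemLp φ 2 ν) {a : ℝ}
    (ha : ∀ x, |a * (φ x - ∫ x, φ x ∂ν)| ≤ 1) :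
    ∫ x, Real.exp (a * (φ x - ∫ x, φ x ∂ν)) ∂ν ≤ Real.exp (a ^ 2 * ∫ x, φ x ^ 2 ∂ν) := by
  set e := ∫ x, φ x ∂ν with he
  have hi : Integrable φ ν := hφ.integrable one_le_two
  have hi2 : Integrable (fun x => (φ x - e) ^ 2) ν := (hφ.sub (memLp_const e)).integrable_sq
  have hpt : ∀ x, Real.exp (a * (φ x - e)) ≤ 1 + a * (φ x - e) + a ^ 2 * (φ x - e) ^ 2 := by
    intro x
    have := (abs_le.1 (Real.abs_exp_sub_one_sub_id_le (ha x))).2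
    nlinarith
  have hvar : ∫ x, (φ x - e) ^ 2 ∂ν ≤ ∫ x, φ x ^ 2 ∂ν := by
    have := variance_le_expectation_sq (μ := ν) hφ.aestronglyMeasurable
    rw [variance_eq_integral hφ.aestronglyMeasurable.aemeasurable] at this
    exact this
  have hint : Integrable (fun x => 1 + a * (φ x - e) + a ^ 2 * (φ x - e) ^ 2) ν :=
    ((integrable_const 1).add ((hi.sub (integrable_const e)).const_mul a)).add (hi2.const_mul _)
  calc ∫ x, Real.exp (a * (φ x - e)) ∂ν
      ≤ ∫ x, (1 + a * (φ x - e) + a ^ 2 * (φ x - e) ^ 2) ∂ν :=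
        integral_mono_of_nonneg (Eventually.of_forall fun x => (Real.exp_pos _).le) hint
          (Eventually.of_forall hpt)
    _ = 1 + a ^ 2 * ∫ x, (φ x - e) ^ 2 ∂ν := by
        have hlin : Integrable (fun x => a * (φ x - e)) ν :=
          (hi.sub (integrable_const e)).const_mul a
        have hone : Integrable (fun x => 1 + a * (φ x - e)) ν := (integrable_const 1).add hlin
        rw [integral_add hone (hi2.const_mul _), integral_add (integrable_const 1) hlin,
          integral_const_mul, integral_const_mul, integral_sub hi (integrable_const e)]
        simp [he]
    _ ≤ 1 + a ^ 2 * ∫ x, φ x ^ 2 ∂ν := by gcongr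
    _ ≤ _ := by linarith [Real.add_one_le_exp (a ^ 2 * ∫ x, φ x ^ 2 ∂ν)]

/-- The empirical process of a function bounded by `A √n` and of `L²` norm at most `A σ` has
exponential moments at scale `A`, with a bound that does not depend on `n`. -/
lemma lintegral_exp_abs_empProc_le [IsProbabilityMeasure ν] {φ : 𝒲 → ℝ}
    (hφ : Measurable φ) {A σ : ℝ} (hA : 0 < A)
    (hb : ∀ x, |φ x| ≤ A * √(n : ℝ)) (h2 : ∫ x, φ x ^ 2 ∂ν ≤ A ^ 2 * σ ^ 2) :
    ∫⁻ w, ENNReal.ofReal (Real.exp (|empProc ν n φ w| / (2 * A))) ∂(Measure.pi fun _ : Fin n => ν)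
      ≤ ENNReal.ofReal (2 * Real.exp (σ ^ 2 / 4)) := by
  set μ := Measure.pi fun _ : Fin n => ν
  rcases Nat.eq_zero_or_pos n with rfl | hn
  · have : ∀ w, empProc ν 0 φ w = 0 := fun w => by simp [empProc]
    simp only [this, abs_zero, zero_div, Real.exp_zero, lintegral_const, measure_univ, mul_one]
    apply ENNReal.ofReal_le_ofReal
    have := Real.add_one_le_exp (σ ^ 2 / 4)
    nlinarith [sq_nonneg σ]
  have hn0 : (0 : ℝ) < n := by exact_mod_cast hn
  have hsn : (0 : ℝ) < √(n : ℝ) := Real.sqrt_pos.2 hn0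
  have hL : MemLp φ 2 ν := MemLp.of_bound hφ.aestronglyMeasurable (A * √(n : ℝ))
    (Eventually.of_forall fun x => (Real.norm_eq_abs _).trans_le (hb x))
  set e := ∫ x, φ x ∂ν with he
  have heb : |e| ≤ A * √(n : ℝ) := by
    have := norm_integral_le_of_norm_le_const (μ := ν)
      (Eventually.of_forall fun x => (Real.norm_eq_abs _).trans_le (hb x))
    simpa using this
  -- the moment generating function at `± 1 / (2 A)`
  have key : ∀ t : ℝ, |t| = 1 / (2 * A) →
      Integrable (fun w => Real.exp (t * empProc ν n φ w)) μ ∧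
      ∫ w, Real.exp (t * empProc ν n φ w) ∂μ ≤ Real.exp (σ ^ 2 / 4) := by
    intro t ht
    set a := t * (√(n : ℝ))⁻¹ with hadef
    have hrw : ∀ w, Real.exp (t * empProc ν n φ w) = ∏ i, Real.exp (a * (φ (w i) - e)) := by
      intro w
      rw [← Real.exp_sum, empProc, ← Finset.mul_sum, hadef, mul_assoc]
    have habs : |a| = 1 / (2 * A) * (√(n : ℝ))⁻¹ := by
      rw [hadef, abs_mul, ht, abs_of_pos (inv_pos.2 hsn)]
    have ha : ∀ x, |a * (φ x - e)| ≤ 1 := by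
      intro x
      rw [abs_mul, habs]
      have h1 : |φ x - e| ≤ 2 * (A * √(n : ℝ)) := by
        have := abs_sub (φ x) e
        linarith [hb x]
      calc 1 / (2 * A) * (√(n : ℝ))⁻¹ * |φ x - e|
          ≤ 1 / (2 * A) * (√(n : ℝ))⁻¹ * (2 * (A * √(n : ℝ))) := by gcongr
        _ = 1 := by field_simp
    have hint1 : Integrable (fun x => Real.exp (a * (φ x - e))) ν := by
      refine Integrable.of_bound (by fun_prop) (Real.exp 1) (Eventually.of_forall fun x => ?_)
      rw [Real.norm_eq_abs, Real.abs_exp]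
      exact Real.exp_le_exp.2 ((le_abs_self _).trans (ha x))
    refine ⟨?_, ?_⟩
    · simp_rw [hrw]
      exact Integrable.fintype_prod fun _ => hint1
    · simp_rw [hrw]
      rw [integral_fintype_prod_eq_pow (fun x => Real.exp (a * (φ x - e))), Fintype.card_fin]
      calc (∫ x, Real.exp (a * (φ x - e)) ∂ν) ^ n
          ≤ Real.exp (a ^ 2 * ∫ x, φ x ^ 2 ∂ν) ^ n := by
            exact pow_le_pow_left₀ (integral_nonneg fun x => (Real.exp_pos _).le)
              (integral_exp_centered_le hL ha) n
        _ = Real.exp (n * (a ^ 2 * ∫ x, φ x ^ 2 ∂ν)) := by rw [← Real.exp_nat_mul]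
        _ ≤ _ := by
            apply Real.exp_le_exp.2
            have ha2 : a ^ 2 = 1 / (4 * A ^ 2 * n) := by
              rw [← sq_abs, habs, mul_pow, inv_pow, Real.sq_sqrt hn0.le]
              field_simp
              norm_num
            rw [ha2]
            calc (n : ℝ) * (1 / (4 * A ^ 2 * n) * ∫ x, φ x ^ 2 ∂ν)
                ≤ n * (1 / (4 * A ^ 2 * n) * (A ^ 2 * σ ^ 2)) := by gcongr
              _ = σ ^ 2 / 4 := by field_simp
  have hp := key (1 / (2 * A)) (abs_of_pos (by positivity))
  have hm := key (-(1 / (2 * A))) (by rw [abs_neg]; exact abs_of_pos (by positivity))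
  calc ∫⁻ w, ENNReal.ofReal (Real.exp (|empProc ν n φ w| / (2 * A))) ∂μ
      ≤ ∫⁻ w, ENNReal.ofReal (Real.exp (1 / (2 * A) * empProc ν n φ w) +
          Real.exp (-(1 / (2 * A)) * empProc ν n φ w)) ∂μ := by
        refine lintegral_mono fun w => ENNReal.ofReal_le_ofReal ?_
        have h1 : ∀ y : ℝ, Real.exp |y| ≤ Real.exp y + Real.exp (-y) := fun y => by
          rcases abs_cases y with ⟨h, _⟩ | ⟨h, _⟩ <;> rw [h] <;>
            linarith [Real.exp_pos y, Real.exp_pos (-y)]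
        have h2 := h1 (1 / (2 * A) * empProc ν n φ w)
        rw [abs_mul, abs_of_pos (by positivity : 0 < 1 / (2 * A)), ← neg_mul] at h2
        rwa [div_eq_inv_mul, ← one_div]
    _ = ENNReal.ofReal (∫ w, (Real.exp (1 / (2 * A) * empProc ν n φ w) +
          Real.exp (-(1 / (2 * A)) * empProc ν n φ w)) ∂μ) :=
        (ofReal_integral_eq_lintegral_ofReal (hp.1.add hm.1)
          (Eventually.of_forall fun w => (add_pos (Real.exp_pos _) (Real.exp_pos _)).le)).symm
    _ ≤ _ := by
        rw [integral_add hp.1 hm.1]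
        exact ENNReal.ofReal_le_ofReal (by linarith [hp.2, hm.2])

lemma lintegral_abs_empProc_le_sqrt [IsProbabilityMeasure ν] {φ : 𝒲 → ℝ} (hφ : MemLp φ 2 ν) :
    ∫⁻ w, ENNReal.ofReal |empProc ν n φ w| ∂(Measure.pi fun _ : Fin n => ν) ≤
      ENNReal.ofReal √(∫ x, φ x ^ 2 ∂ν) := by
  set μ := Measure.pi fun _ : Fin n => ν
  set e := ∫ x, φ x ∂ν with he
  have hφe : MemLp (fun x => φ x - e) 2 ν := hφ.sub (memLp_const e)
  have hterm : ∀ i : Fin n, MemLp (fun w : Fin n → 𝒲 => φ (w i) - e) 2 μ := fun i =>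
    hφe.comp_measurePreserving (measurePreserving_eval (fun _ : Fin n => ν) i)
  have hsum : MemLp (fun w : Fin n → 𝒲 => ∑ i, (φ (w i) - e)) 2 μ :=
    memLp_finsetSum _ fun i _ => hterm i
  have hV : MemLp (empProc ν n φ) 2 μ := hsum.const_mul _
  have hmean : ∫ w, empProc ν n φ w ∂μ = 0 := by
    simp only [empProc]
    rw [integral_const_mul, integral_finsetSum _ fun i _ => (hterm i).integrable one_le_two]
    have : ∀ i : Fin n, ∫ w : Fin n → 𝒲, (φ (w i) - e) ∂μ = 0 := fun i => by
      rw [integral_comp_eval (μ := fun _ : Fin n => ν) (f := fun x => φ x - e)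
        hφe.aestronglyMeasurable, integral_sub (hφ.integrable one_le_two) (integrable_const e)]
      simp [he]
    simp [this]
  have hvar : ∫ w, empProc ν n φ w ^ 2 ∂μ ≤ ∫ x, φ x ^ 2 ∂ν := by
    have h1 : Var[empProc ν n φ; μ] = ∫ w, empProc ν n φ w ^ 2 ∂μ := by
      rw [variance_of_integral_eq_zero hV.aestronglyMeasurable.aemeasurable hmean]
      
    have h2 : Var[∑ i : Fin n, fun w : Fin n → 𝒲 => φ (w i) - e; μ] = n * Var[φ; ν] := by
      rw [variance_sum_pi (μ := fun _ : Fin n => ν) (X := fun _ x => φ x - e) fun _ => hφe]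
      simp [variance_sub_const hφ.aestronglyMeasurable]
    have h3 : empProc ν n φ = fun w => (√(n : ℝ))⁻¹ *
        (∑ i : Fin n, fun w : Fin n → 𝒲 => φ (w i) - e) w := by
      funext w; simp [empProc, he]
    have h4 : Var[φ; ν] ≤ ∫ x, φ x ^ 2 ∂ν := variance_le_expectation_sq hφ.aestronglyMeasurable
    rw [← h1, h3, variance_const_mul, h2, inv_pow, Real.sq_sqrt (Nat.cast_nonneg n)]
    rcases Nat.eq_zero_or_pos n with h0 | hn
    · simp only [h0, Nat.cast_zero, inv_zero, zero_mul]
      exact (variance_nonneg φ ν).trans h4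
    · have hn0 : (n : ℝ) ≠ 0 := by exact_mod_cast hn.ne'
      rwa [← mul_assoc, inv_mul_cancel₀ hn0, one_mul]
  have hVi : Integrable (fun w => |empProc ν n φ w|) μ := (hV.integrable one_le_two).abs
  rw [← ofReal_integral_eq_lintegral_ofReal hVi (Eventually.of_forall fun w => abs_nonneg _)]
  apply ENNReal.ofReal_le_ofReal
  apply Real.le_sqrt_of_sq_le
  have h5 := variance_nonneg (fun w => |empProc ν n φ w|) μ
  have hVa : MemLp (fun w => |empProc ν n φ w|) 2 μ := hV.abs
  rw [variance_eq_sub hVa] at h5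
  have h6 : μ[(fun w => |empProc ν n φ w|) ^ 2] = ∫ w, empProc ν n φ w ^ 2 ∂μ := by
    simp [Pi.pow_apply]
  rw [h6] at h5
  linarith

lemma lintegral_sum_abs_le [IsProbabilityMeasure ν] {φ : 𝒲 → ℝ} (hφ : Integrable φ ν) :
    ∫⁻ w, ENNReal.ofReal ((√(n : ℝ))⁻¹ * ∑ i, (|φ (w i)| + ∫ x, |φ x| ∂ν))
        ∂(Measure.pi fun _ : Fin n => ν) ≤
      ENNReal.ofReal (2 * √(n : ℝ) * ∫ x, |φ x| ∂ν) := by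
  have hterm : ∀ i : Fin n, Integrable (fun w : Fin n → 𝒲 => |φ (w i)| + ∫ x, |φ x| ∂ν)
      (Measure.pi fun _ : Fin n => ν) := fun i =>
    (integrable_comp_eval (μ := fun _ : Fin n => ν) (f := fun x => |φ x|) hφ.abs).add
      (integrable_const _)
  have h0 : 0 ≤ ∫ x, |φ x| ∂ν := integral_nonneg fun x => abs_nonneg _
  rw [← ofReal_integral_eq_lintegral_ofReal ((integrable_finsetSum _ fun i _ => hterm i).const_mul _)
    (Eventually.of_forall fun w => by positivity)]
  apply ENNReal.ofReal_le_ofReal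
  rw [integral_const_mul, integral_finsetSum _ fun i _ => hterm i]
  have : ∀ i : Fin n, ∫ w : Fin n → 𝒲, (|φ (w i)| + ∫ x, |φ x| ∂ν) ∂(Measure.pi fun _ : Fin n => ν)
      = 2 * ∫ x, |φ x| ∂ν := fun i => by
    rw [integral_add (integrable_comp_eval (μ := fun _ : Fin n => ν) (f := fun x => |φ x|) hφ.abs)
      (integrable_const _), integral_comp_eval (μ := fun _ : Fin n => ν) (f := fun x => |φ x|)
      hφ.abs.aestronglyMeasurable]
    simp
    ring
  simp only [this, Finset.sum_const, Finset.card_univ, Fintype.card_fin, nsmul_eq_mul]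
  rcases Nat.eq_zero_or_pos n with h | hn
  · simp [h]
  · have hs : (0 : ℝ) < √(n : ℝ) := Real.sqrt_pos.2 (by exact_mod_cast hn)
    have h1 : (n : ℝ) = √(n : ℝ) * √(n : ℝ) := (Real.mul_self_sqrt (Nat.cast_nonneg n)).symm
    rw [show (√(n : ℝ))⁻¹ * (n * (2 * ∫ x, |φ x| ∂ν)) =
      (√(n : ℝ))⁻¹ * (√(n : ℝ) * √(n : ℝ)) * (2 * ∫ x, |φ x| ∂ν) by rw [← h1]; ring]
    rw [← mul_assoc (√(n : ℝ))⁻¹, inv_mul_cancel₀ hs.ne']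
    linarith

lemma abs_empProc_le {φ ψ : 𝒲 → ℝ} (h : ∀ x, |φ x| ≤ ψ x) (hψ : Integrable ψ ν)
    (w : Fin n → 𝒲) :
    |empProc ν n φ w| ≤ (√(n : ℝ))⁻¹ * ∑ i, (ψ (w i) + ∫ x, ψ x ∂ν) := by
  rw [empProc, abs_mul, abs_of_nonneg (by positivity : (0 : ℝ) ≤ (√(n : ℝ))⁻¹)]
  gcongr
  refine (Finset.abs_sum_le_sum_abs _ _).trans (Finset.sum_le_sum fun i _ => ?_)
  refine (abs_sub _ _).trans (add_le_add (h _) ?_)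
  exact norm_integral_le_of_norm_le hψ
    (Eventually.of_forall fun x => (Real.norm_eq_abs _).trans_le (h x))

end Moments

/-! ### A maximal inequality for Lipschitz families -/

lemma norm_toLp_le {d : ℕ} (v : Fin d → ℝ) : ‖WithLp.toLp 2 v‖ ≤ (√(d : ℝ) + 1) * ‖v‖ := by
  have h : ‖WithLp.toLp 2 v‖ ≤ √(d : ℝ) * ‖v‖ := by
    rw [EuclideanSpace.norm_eq, ← Real.sqrt_sq (norm_nonneg v), ← Real.sqrt_mul (Nat.cast_nonneg d)]
    apply Real.sqrt_le_sqrt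
    calc ∑ i, ‖v i‖ ^ 2 ≤ ∑ _i : Fin d, ‖v‖ ^ 2 := by
          gcongr with i
          exact norm_le_pi_norm v i
      _ = d * ‖v‖ ^ 2 := by simp
  nlinarith [norm_nonneg v]

lemma tendsto_integral_sq_tail {𝒲 : Type*} [MeasurableSpace 𝒲] {ν : Measure 𝒲} {M : 𝒲 → ℝ}
    (hMm : Measurable M) (hM : MemLp M 2 ν) :
    Tendsto (fun n : ℕ => ∫ x, {x | √(n : ℝ) < M x}.indicator (fun x => M x ^ 2) x ∂ν) atTop
      (𝓝 0) := by
  have h0 : (0 : ℝ) = ∫ _x : 𝒲, (0 : ℝ) ∂ν := by simp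
  rw [h0]
  refine tendsto_integral_of_dominated_convergence (fun x => M x ^ 2) (fun n => ?_)
    hM.integrable_sq (fun n => Eventually.of_forall fun x => ?_) (Eventually.of_forall fun x => ?_)
  · exact ((hMm.pow_const 2).indicator (measurableSet_lt measurable_const hMm)).aestronglyMeasurable
  · rw [Real.norm_eq_abs]
    by_cases hx : x ∈ {x | √(n : ℝ) < M x}
    · simp [Set.indicator_of_mem hx]
    · simp only [Set.indicator_of_notMem hx, abs_zero]
      positivity
  · refine tendsto_const_nhds.congr' ?_
    have : Tendsto (fun n : ℕ => √(n : ℝ)) atTop atTop :=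
      Real.tendsto_sqrt_atTop.comp tendsto_natCast_atTop_atTop
    filter_upwards [this.eventually_ge_atTop (M x)] with n hn
    rw [Set.indicator_of_notMem]
    simpa using hn

/-- Maximal inequality: for a family `q h` that is Lipschitz in `h` with square-integrable constant,
vanishes at `0` and is `o(‖h‖)` in `L²`, the empirical process is uniformly small on small balls,
relative to their radius. Where the Lipschitz constant exceeds `√n` a first-moment bound suffices;
elsewhere the increments have exponential moments and chaining applies. -/
lemma exists_maximal_bound {d : ℕ} {𝒲 : Type*} [MeasurableSpace 𝒲] {ν : Measure 𝒲}
    [IsProbabilityMeasure ν] {q : EuclideanSpace ℝ (Fin d) → 𝒲 → ℝ} {M : 𝒲 → ℝ} {r : ℝ}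
    (hr : 0 < r) (hqm : ∀ h, ‖h‖ ≤ r → Measurable (q h)) (hq0 : ∀ w, q 0 w = 0)
    (hMm : Measurable M) (hM0 : ∀ w, 0 ≤ M w) (hM : MemLp M 2 ν)
    (hlip : ∀ w h h', ‖h‖ ≤ r → ‖h'‖ ≤ r → |q h w - q h' w| ≤ M w * ‖h - h'‖)
    (hsmall : (fun h => ∫ w, q h w ^ 2 ∂ν) =o[𝓝 0] fun h => ‖h‖ ^ 2) {κ : ℝ} (hκ : 0 < κ) :
    ∃ δ > 0, δ ≤ r ∧ ∃ N : ℕ, ∀ n ≥ N, ∀ t > 0, t ≤ δ → ∃ S : (Fin n → 𝒲) → ℝ≥0∞, Measurable S ∧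
      ∫⁻ w, S w ∂(Measure.pi fun _ : Fin n => ν) ≤ ENNReal.ofReal (κ * t) ∧
      ∀ h, ‖h‖ ≤ t → ∀ w, ENNReal.ofReal |empProc ν n (q h) w| ≤ S w := by
  set D : ℝ := √(d : ℝ) + 1 with hD
  have hD0 : 0 < D := by positivity
  have hD1 : 1 ≤ D := by rw [hD]; linarith [Real.sqrt_nonneg (d : ℝ)]
  set m2 : ℝ := ∫ x, M x ^ 2 ∂ν with hm2
  have hm20 : 0 ≤ m2 := integral_nonneg fun x => sq_nonneg _
  obtain ⟨F, hFc, hF⟩ := exists_finset_chaining d (c := 2 * D) (K := 2 * Real.exp (√m2 ^ 2 / 4))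
    (ε := κ / 3) (by positivity) (by positivity) (by positivity)
  set η : ℝ := κ / (3 * D * (F.card + 1)) with hη
  have hη0 : 0 < η := by positivity
  obtain ⟨δ', hδ'0, hδ'⟩ : ∃ δ' > 0, ∀ h : EuclideanSpace ℝ (Fin d), ‖h‖ ≤ δ' →
      ∫ w, q h w ^ 2 ∂ν ≤ η ^ 2 * ‖h‖ ^ 2 := by
    have := hsmall.def (c := η ^ 2) (by positivity)
    obtain ⟨ε, hε, hb⟩ := Metric.eventually_nhds_iff.1 this
    refine ⟨ε / 2, by positivity, fun h hh => ?_⟩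
    have h1 := hb (y := h) (by rw [dist_zero_right]; linarith)
    rw [Real.norm_eq_abs, Real.norm_eq_abs, abs_of_nonneg (sq_nonneg ‖h‖)] at h1
    exact (le_abs_self _).trans h1
  obtain ⟨N, hN⟩ := eventually_atTop.1
    ((tendsto_integral_sq_tail hMm hM).eventually_lt_const (show 0 < κ / (6 * D) by positivity))
  refine ⟨min r δ' / D, by positivity, (div_le_self (by positivity) hD1).trans (min_le_left _ _),
    N, fun n hn t ht htδ => ?_⟩
  have htD : t * D ≤ min r δ' := (le_div_iff₀ hD0).1 htδ
  have htr : t * D ≤ r := htD.trans (min_le_left _ _)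
  have htd' : t * D ≤ δ' := htD.trans (min_le_right _ _)
  set e : (Fin d → ℝ) → EuclideanSpace ℝ (Fin d) := fun v => WithLp.toLp 2 v with he
  have hcube : ∀ v ∈ cube d, ‖v‖ ≤ 1 := fun v hv => (pi_norm_le_iff_of_nonneg zero_le_one).2 hv
  have hte : ∀ v ∈ cube d, ‖t • e v‖ ≤ t * D := fun v hv => by
    rw [norm_smul, Real.norm_eq_abs, abs_of_pos ht]
    have := norm_toLp_le v
    have h1 := hcube v hv
    gcongr
    calc ‖e v‖ ≤ D * ‖v‖ := this
      _ ≤ D * 1 := by gcongr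
      _ = D := mul_one D
  have hinc : ∀ v ∈ cube d, ∀ v' ∈ cube d, ∀ w,
      |t⁻¹ * q (t • e v) w - t⁻¹ * q (t • e v') w| ≤ M w * (D * ‖v - v'‖) := by
    intro v hv v' hv' w
    have h1 := hlip w (t • e v) (t • e v') ((hte v hv).trans htr) ((hte v' hv').trans htr)
    have h2 : ‖t • e v - t • e v'‖ ≤ t * (D * ‖v - v'‖) := by
      rw [← smul_sub, norm_smul, Real.norm_eq_abs, abs_of_pos ht]
      gcongr
      exact norm_toLp_le (v - v')
    rw [← mul_sub, abs_mul, abs_of_pos (inv_pos.2 ht)]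
    calc t⁻¹ * |q (t • e v) w - q (t • e v') w| ≤ t⁻¹ * (M w * (t * (D * ‖v - v'‖))) := by
          gcongr
          exact h1.trans (mul_le_mul_of_nonneg_left h2 (hM0 w))
      _ = M w * (D * ‖v - v'‖) := by field_simp
  have hzero : (0 : Fin d → ℝ) ∈ cube d := fun i => by simp
  have hval : ∀ v ∈ cube d, ∀ w, |t⁻¹ * q (t • e v) w| ≤ M w * D := by
    intro v hv w
    have h1 := hinc v hv 0 hzero w
    have h2 : t • e 0 = 0 := by simp [he]
    rw [h2, hq0, mul_zero, sub_zero, sub_zero] at h1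
    refine h1.trans (mul_le_mul_of_nonneg_left ?_ (hM0 w))
    exact mul_le_of_le_one_right hD0.le (hcube v hv)
  have hqtm : ∀ v ∈ cube d, Measurable fun w => t⁻¹ * q (t • e v) w := fun v hv =>
    (hqm _ ((hte v hv).trans htr)).const_mul _
  -- Rescaled to the unit cube, the family splits at the level `M = √n`: below it (`φ`) the terms are
  -- bounded by a multiple of `√n`, as the exponential moment bound requires; above it (`ψ`) they are
  -- negligible in mean, since `√n E[M; M > √n] ≤ E[M²; M > √n] → 0`.
  set G : Set 𝒲 := {x | √(n : ℝ) < M x} with hG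
  have hGm : MeasurableSet G := measurableSet_lt measurable_const hMm
  let φ : (Fin d → ℝ) → 𝒲 → ℝ := fun v => Gᶜ.indicator fun w => t⁻¹ * q (t • e v) w
  let ψ : (Fin d → ℝ) → 𝒲 → ℝ := fun v => G.indicator fun w => t⁻¹ * q (t • e v) w
  have hMi : Integrable M ν := hM.integrable one_le_two
  have hφm : ∀ v ∈ cube d, Measurable (φ v) := fun v hv => (hqtm v hv).indicator hGm.compl
  have hψm : ∀ v ∈ cube d, Measurable (ψ v) := fun v hv => (hqtm v hv).indicator hGm
  have hφb : ∀ v ∈ cube d, ∀ w, |φ v w| ≤ M w * D := fun v hv w => by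
    by_cases hw : w ∈ Gᶜ
    · simp only [φ, Set.indicator_of_mem hw]; exact hval v hv w
    · simp only [φ, Set.indicator_of_notMem hw, abs_zero]; have := hM0 w; positivity
  have hψb : ∀ v ∈ cube d, ∀ w, |ψ v w| ≤ D * G.indicator M w := fun v hv w => by
    by_cases hw : w ∈ G
    · simp only [ψ, Set.indicator_of_mem hw]; rw [mul_comm D]; exact hval v hv w
    · simp [ψ, Set.indicator_of_notMem hw]
  have hφL : ∀ v ∈ cube d, MemLp (φ v) 2 ν := fun v hv =>
    (hM.mul_const D).mono' (hφm v hv).aestronglyMeasurable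
      (Eventually.of_forall fun w => (Real.norm_eq_abs _).trans_le (hφb v hv w))
  have hφi : ∀ v ∈ cube d, Integrable (φ v) ν := fun v hv => (hφL v hv).integrable one_le_two
  have hGMi : Integrable (fun w => D * G.indicator M w) ν := (hMi.indicator hGm).const_mul D
  have hψi : ∀ v ∈ cube d, Integrable (ψ v) ν := fun v hv =>
    hGMi.mono' (hψm v hv).aestronglyMeasurable
      (Eventually.of_forall fun w => (Real.norm_eq_abs _).trans_le (hψb v hv w))
  have hφinc : ∀ v ∈ cube d, ∀ v' ∈ cube d, ∀ w,
      |φ v w - φ v' w| ≤ Gᶜ.indicator M w * (D * ‖v - v'‖) := fun v hv v' hv' w => by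
    by_cases hw : w ∈ Gᶜ
    · simp only [φ, Set.indicator_of_mem hw]; exact hinc v hv v' hv' w
    · simp [φ, Set.indicator_of_notMem hw]
  have hGcM : ∀ w, Gᶜ.indicator M w ≤ M w := fun w =>
    Set.indicator_le_self' (fun _ _ => hM0 w) w
  have hGcM0 : ∀ w, 0 ≤ Gᶜ.indicator M w := fun w => Set.indicator_nonneg (fun w _ => hM0 w) w
  have hGcMn : ∀ w, Gᶜ.indicator M w ≤ √(n : ℝ) := fun w => by
    by_cases hw : w ∈ Gᶜ
    · rw [Set.indicator_of_mem hw]; simpa [hG] using hw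
    · rw [Set.indicator_of_notMem hw]; positivity
  -- `S₂` bounds the distance from `φ` on the whole cube to `φ` on the finite set `F`.
  obtain ⟨S₂, hS₂m, hS₂, hS₂b⟩ := hF (Measure.pi fun _ : Fin n => ν)
    (fun v w => empProc ν n (φ v) w) (fun v hv => measurable_empProc (hφm v hv))
    (by
      intro w
      set L : ℝ := (√(n : ℝ))⁻¹ * ∑ i, (M (w i) * D + ∫ x, M x * D ∂ν) with hL
      have hL0 : 0 ≤ L := by
        have : 0 ≤ ∫ x, M x * D ∂ν := integral_nonneg fun x => mul_nonneg (hM0 x) hD0.le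
        have h2 : ∀ i, 0 ≤ M (w i) := fun i => hM0 _
        refine mul_nonneg (by positivity) (Finset.sum_nonneg fun i _ => ?_)
        have := h2 i
        positivity
      refine LipschitzOnWith.continuousOn (K := L.toNNReal)
        (LipschitzOnWith.of_dist_le_mul fun v hv v' hv' => ?_)
      rw [Real.dist_eq, dist_eq_norm, Real.coe_toNNReal L hL0, ← empProc_sub (hφi v hv) (hφi v' hv')]
      have hψ' : Integrable (fun x => M x * D * ‖v - v'‖) ν := (hMi.mul_const D).mul_const _
      refine (abs_empProc_le (ψ := fun x => M x * D * ‖v - v'‖) (fun x => ?_) hψ' w).trans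
        (le_of_eq ?_)
      · rw [mul_assoc]
        exact (hφinc v hv v' hv' x).trans (mul_le_mul_of_nonneg_right (hGcM x) (by positivity))
      · rw [integral_mul_const, hL, mul_assoc, Finset.sum_mul]
        congr 2
        funext i
        ring)
    (by
      intro v hv v' hv' s hs hvs
      have hA : ∀ w, |φ v w - φ v' w| ≤ Gᶜ.indicator M w * (D * s) := fun w =>
        (hφinc v hv v' hv' w).trans (mul_le_mul_of_nonneg_left (by gcongr) (hGcM0 w))
      have := lintegral_exp_abs_empProc_le (ν := ν) (n := n) (φ := fun w => φ v w - φ v' w)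
        ((hφm v hv).sub (hφm v' hv')) (A := D * s) (σ := √m2) (by positivity)
        (fun w => by
          rw [mul_comm]
          exact (hA w).trans (mul_le_mul_of_nonneg_right (hGcMn w) (by positivity)))
        (by
          rw [Real.sq_sqrt hm20, ← integral_const_mul]
          refine integral_mono ((hφL v hv).sub (hφL v' hv')).integrable_sq
            (hM.integrable_sq.const_mul _) fun w => ?_
          have h1 : |φ v w - φ v' w| ≤ D * s * M w := by
            rw [mul_comm]
            exact (hA w).trans (mul_le_mul_of_nonneg_right (hGcM w) (by positivity))
          calc (φ v w - φ v' w) ^ 2 = |φ v w - φ v' w| ^ 2 := (sq_abs _).symm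
            _ ≤ (D * s * M w) ^ 2 := by gcongr
            _ = (D * s) ^ 2 * M w ^ 2 := by ring)
      simp_rw [empProc_sub (hφi v hv) (hφi v' hv')] at this
      rwa [show 2 * D * s = 2 * (D * s) by ring])
  -- `S₁` bounds the process on `F`, whose size is independent of `n` and `t`; only here does the
  -- smallness of `q` in `L²` enter.
  let S₁ : (Fin n → 𝒲) → ℝ≥0∞ := fun w => ∑ a ∈ F, ENNReal.ofReal |empProc ν n (φ a) w|
  have hS₁m : Measurable S₁ := Finset.measurable_fun_sum _ fun a ha =>
    (measurable_empProc (hφm a (hFc ha))).abs.ennreal_ofReal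
  have hS₁ : ∫⁻ w, S₁ w ∂(Measure.pi fun _ : Fin n => ν) ≤ ENNReal.ofReal (κ / 3) := by
    rw [lintegral_finsetSum _ fun a ha =>
      (measurable_empProc (hφm a (hFc ha))).abs.ennreal_ofReal]
    calc ∑ a ∈ F, ∫⁻ w, ENNReal.ofReal |empProc ν n (φ a) w| ∂(Measure.pi fun _ : Fin n => ν)
        ≤ ∑ a ∈ F, ENNReal.ofReal (η * D) := by
          refine Finset.sum_le_sum fun a ha => ?_
          have ha' := hFc (Finset.mem_coe.2 ha)
          refine (lintegral_abs_empProc_le_sqrt (hφL a ha')).trans (ENNReal.ofReal_le_ofReal ?_)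
          apply Real.sqrt_le_iff.2 ⟨by positivity, ?_⟩
          have hqL : Integrable (fun w => (t⁻¹ * q (t • e a) w) ^ 2) ν :=
            ((hM.mul_const D).mono' (hqtm a ha').aestronglyMeasurable
              (Eventually.of_forall fun w =>
                (Real.norm_eq_abs _).trans_le (hval a ha' w))).integrable_sq
          calc ∫ w, φ a w ^ 2 ∂ν ≤ ∫ w, (t⁻¹ * q (t • e a) w) ^ 2 ∂ν := by
                refine integral_mono (hφL a ha').integrable_sq hqL fun w => ?_
                by_cases hw : w ∈ Gᶜ
                · simp only [φ, Set.indicator_of_mem hw]; exact le_rfl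
                · simpa [φ, Set.indicator_of_notMem hw] using sq_nonneg (t⁻¹ * q (t • e a) w)
            _ = t⁻¹ ^ 2 * ∫ w, q (t • e a) w ^ 2 ∂ν := by
                simp_rw [mul_pow]
                rw [integral_const_mul]
            _ ≤ t⁻¹ ^ 2 * (η ^ 2 * (t * D) ^ 2) := by
                gcongr
                refine (hδ' _ ((hte a ha').trans htd')).trans ?_
                gcongr
                exact hte a ha'
            _ = (η * D) ^ 2 := by field_simp
      _ = ENNReal.ofReal (F.card * (η * D)) := by
          rw [Finset.sum_const, nsmul_eq_mul, ← ENNReal.ofReal_natCast,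
            ← ENNReal.ofReal_mul (by positivity)]
      _ ≤ _ := by
          apply ENNReal.ofReal_le_ofReal
          rw [hη]
          have hc : (0 : ℝ) ≤ F.card := Nat.cast_nonneg _
          rw [show (F.card : ℝ) * (κ / (3 * D * (F.card + 1)) * D) =
            κ / 3 * (F.card / (F.card + 1)) by field_simp]
          refine mul_le_of_le_one_right (by positivity) ?_
          rw [div_le_one (by positivity)]
          linarith
  -- `S₃` bounds the contribution of `ψ` by the triangle inequality, without centering.
  let S₃ : (Fin n → 𝒲) → ℝ≥0∞ := fun w => ENNReal.ofReal ((√(n : ℝ))⁻¹ *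
    ∑ i, (|D * G.indicator M (w i)| + ∫ x, |D * G.indicator M x| ∂ν))
  have hGM0 : ∀ w, 0 ≤ G.indicator M w := fun w => Set.indicator_nonneg (fun w _ => hM0 w) w
  have hGMm : Measurable (G.indicator M) := hMm.indicator hGm
  have hS₃m : Measurable S₃ := by
    refine Measurable.ennreal_ofReal (Measurable.const_mul (Finset.measurable_fun_sum _
      fun i _ => ?_) _)
    exact ((hGMm.const_mul D).abs.comp (measurable_pi_apply i)).add_const _
  have hS₃ : ∫⁻ w, S₃ w ∂(Measure.pi fun _ : Fin n => ν) ≤ ENNReal.ofReal (κ / 3) := by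
    refine (lintegral_sum_abs_le (n := n) hGMi).trans (ENNReal.ofReal_le_ofReal ?_)
    have h1 : √(n : ℝ) * ∫ x, |D * G.indicator M x| ∂ν ≤
        D * ∫ x, G.indicator (fun x => M x ^ 2) x ∂ν := by
      rw [← integral_const_mul, ← integral_const_mul]
      refine integral_mono (hGMi.abs.const_mul _)
        ((hM.integrable_sq.indicator hGm).const_mul D) fun x => ?_
      by_cases hx : x ∈ G
      · have hx' : √(n : ℝ) ≤ M x := le_of_lt hx
        simp only [Set.indicator_of_mem hx]
        rw [abs_of_nonneg (mul_nonneg hD0.le (hM0 x))]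
        calc √(n : ℝ) * (D * M x) ≤ M x * (D * M x) :=
              mul_le_mul_of_nonneg_right hx' (mul_nonneg hD0.le (hM0 x))
          _ = D * M x ^ 2 := by ring
      · simp [Set.indicator_of_notMem hx]
    have h2 := hN n hn
    rw [lt_div_iff₀ (by positivity)] at h2
    have h3 : (∫ x, G.indicator (fun x => M x ^ 2) x ∂ν) * (6 * D) < κ := h2
    nlinarith
  refine ⟨fun w => ENNReal.ofReal t * (S₁ w + S₂ w + S₃ w),
    ((hS₁m.add hS₂m).add hS₃m).const_mul _, ?_, ?_⟩
  · have hm : Measurable fun w => S₁ w + S₂ w + S₃ w := (hS₁m.add hS₂m).add hS₃m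
    rw [lintegral_const_mul _ hm, lintegral_add_right _ hS₃m, lintegral_add_right _ hS₂m]
    calc ENNReal.ofReal t * (∫⁻ w, S₁ w ∂(Measure.pi fun _ : Fin n => ν) +
          ∫⁻ w, S₂ w ∂(Measure.pi fun _ : Fin n => ν) +
          ∫⁻ w, S₃ w ∂(Measure.pi fun _ : Fin n => ν))
        ≤ ENNReal.ofReal t * (ENNReal.ofReal (κ / 3) + ENNReal.ofReal (κ / 3) +
          ENNReal.ofReal (κ / 3)) := by gcongr
      _ = ENNReal.ofReal (κ * t) := by
          rw [← ENNReal.ofReal_add (by positivity) (by positivity), ← ENNReal.ofReal_add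
            (by positivity) (by positivity), ← ENNReal.ofReal_mul ht.le]
          congr 1
          ring
  · intro h hh w
    set v : Fin d → ℝ := fun i => t⁻¹ * h i with hv
    have hvc : v ∈ cube d := fun i => by
      rw [hv, abs_mul, abs_of_pos (inv_pos.2 ht), inv_mul_le_iff₀ ht, mul_one]
      exact (PiLp.norm_apply_le h i).trans hh
    have hhv : t • e v = h := by
      ext i
      simp only [he, hv, PiLp.smul_apply, smul_eq_mul]
      field_simp
    obtain ⟨a, haF, ha⟩ := hS₂b v hvc
    have hsplit : empProc ν n (q h) w = t * (empProc ν n (φ v) w + empProc ν n (ψ v) w) := by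
      rw [← empProc_add (hφi v hvc) (hψi v hvc), ← empProc_const_mul]
      congr 1
      funext x
      have : φ v x + ψ v x = t⁻¹ * q (t • e v) x := by
        simp only [φ, ψ]
        exact Set.indicator_compl_add_self_apply G _ x
      rw [this, hhv]
      field_simp
    have hψS : ENNReal.ofReal |empProc ν n (ψ v) w| ≤ S₃ w := by
      apply ENNReal.ofReal_le_ofReal
      exact abs_empProc_le (fun x => (hψb v hvc x).trans (le_abs_self _)) hGMi.abs w
    have hφS : ENNReal.ofReal |empProc ν n (φ v) w| ≤ S₁ w + S₂ w := by
      calc ENNReal.ofReal |empProc ν n (φ v) w|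
          ≤ ENNReal.ofReal (|empProc ν n (φ a) w| + |empProc ν n (φ v) w - empProc ν n (φ a) w|) := by
            apply ENNReal.ofReal_le_ofReal
            have := abs_add_le (empProc ν n (φ a) w) (empProc ν n (φ v) w - empProc ν n (φ a) w)
            rwa [add_sub_cancel] at this
        _ ≤ ENNReal.ofReal |empProc ν n (φ a) w| +
            ENNReal.ofReal |empProc ν n (φ v) w - empProc ν n (φ a) w| := ENNReal.ofReal_add_le
        _ ≤ _ := add_le_add (Finset.single_le_sum
              (f := fun a => ENNReal.ofReal |empProc ν n (φ a) w|) (fun _ _ => zero_le) haF) (ha w)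
    rw [hsplit, abs_mul, abs_of_pos ht, ENNReal.ofReal_mul ht.le]
    refine mul_le_mul' le_rfl ?_
    calc ENNReal.ofReal |empProc ν n (φ v) w + empProc ν n (ψ v) w|
        ≤ ENNReal.ofReal (|empProc ν n (φ v) w| + |empProc ν n (ψ v) w|) :=
          ENNReal.ofReal_le_ofReal (abs_add_le _ _)
      _ ≤ _ := ENNReal.ofReal_add_le.trans (add_le_add hφS hψS)

/-! ### Stochastic differentiability -/

lemma measure_le_ofReal_div {Ω : Type*} [MeasurableSpace Ω] {μ : Measure Ω} {S : Ω → ℝ≥0∞}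
    (hS : Measurable S) {b a : ℝ} (hSb : ∫⁻ w, S w ∂μ ≤ ENNReal.ofReal b) (ha : 0 < a) :
    μ {w | ENNReal.ofReal a ≤ S w} ≤ ENNReal.ofReal (b / a) := by
  refine (meas_ge_le_lintegral_div hS.aemeasurable (ENNReal.ofReal_pos.2 ha).ne'
    ENNReal.ofReal_ne_top).trans ?_
  rw [ENNReal.ofReal_div_of_pos ha]
  gcongr

/-- Peeling into dyadic shells of radius `2ʲ / √n`: the maximal inequality on each shell costs
a probability of order `2⁻ʲ`, because the tolerance grows quadratically with the radius. -/
lemma exists_measure_empProc_gt_le_of_measurable {d : ℕ} {𝒲 : Type*} [MeasurableSpace 𝒲]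
    {ν : Measure 𝒲} [IsProbabilityMeasure ν] {q : EuclideanSpace ℝ (Fin d) → 𝒲 → ℝ} {M : 𝒲 → ℝ}
    {r : ℝ} (hr : 0 < r) (hqm : ∀ h, ‖h‖ ≤ r → Measurable (q h)) (hq0 : ∀ w, q 0 w = 0)
    (hMm : Measurable M) (hM0 : ∀ w, 0 ≤ M w) (hM : MemLp M 2 ν)
    (hlip : ∀ w h h', ‖h‖ ≤ r → ‖h'‖ ≤ r → |q h w - q h' w| ≤ M w * ‖h - h'‖)
    (hsmall : (fun h => ∫ w, q h w ^ 2 ∂ν) =o[𝓝 0] fun h => ‖h‖ ^ 2) {ε : ℝ} (hε : 0 < ε) :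
    ∃ δ > 0, δ ≤ r ∧ ∃ N : ℕ, ∀ n ≥ N, (Measure.pi fun _ : Fin n => ν)
      {w | ∃ h, ‖h‖ ≤ δ ∧ ε * (1 + n * ‖h‖ ^ 2) < √(n : ℝ) * |empProc ν n (q h) w|} ≤
        ENNReal.ofReal ε := by
  set κ : ℝ := ε ^ 2 / 8 with hκ
  have hκ0 : 0 < κ := by positivity
  obtain ⟨δ, hδ, hδr, N, hN⟩ := exists_maximal_bound hr hqm hq0 hMm hM0 hM hlip hsmall hκ0
  refine ⟨δ / 2, by positivity, by linarith, max (max N 1) ⌈(1 / δ) ^ 2⌉₊, fun n hn => ?_⟩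
  have hnN : N ≤ n := le_trans (le_trans (le_max_left _ _) (le_max_left _ _)) hn
  have hn1 : 1 ≤ n := le_trans (le_trans (le_max_right _ _) (le_max_left _ _)) hn
  have hn0 : (0 : ℝ) < n := by exact_mod_cast hn1
  have hsn : (0 : ℝ) < √(n : ℝ) := Real.sqrt_pos.2 hn0
  have hsq : √(n : ℝ) ^ 2 = n := Real.sq_sqrt hn0.le
  have hδn : 1 / √(n : ℝ) ≤ δ := by
    have h1 : (1 / δ) ^ 2 ≤ n := (Nat.le_ceil _).trans (by exact_mod_cast le_trans (le_max_right _ _) hn)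
    have h2 : 1 / δ ≤ √(n : ℝ) := Real.le_sqrt_of_sq_le h1
    rw [div_le_iff₀ hδ] at h2
    rw [div_le_iff₀ hsn]
    linarith
  set μ := Measure.pi fun _ : Fin n => ν with hμ
  have hB : ∀ j : ℕ, ∃ B : Set (Fin n → 𝒲), μ B ≤ ENNReal.ofReal (ε / 2 * (1 / 2) ^ j) ∧
      (2 ^ j / √(n : ℝ) ≤ δ → ∀ h : EuclideanSpace ℝ (Fin d), ‖h‖ ≤ 2 ^ j / √(n : ℝ) → ∀ w ∉ B,
        √(n : ℝ) * |empProc ν n (q h) w| ≤ ε * 4 ^ j / 4) := by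
    intro j
    by_cases hj : 2 ^ j / √(n : ℝ) ≤ δ
    · obtain ⟨S, hSm, hS, hSb⟩ := hN n hnN (2 ^ j / √(n : ℝ)) (by positivity) hj
      have ha : 0 < ε * 4 ^ j / 4 / √(n : ℝ) := by positivity
      refine ⟨{w | ENNReal.ofReal (ε * 4 ^ j / 4 / √(n : ℝ)) ≤ S w}, ?_, fun _ h hh w hw => ?_⟩
      · refine (measure_le_ofReal_div hSm hS ha).trans (ENNReal.ofReal_le_ofReal (le_of_eq ?_))
        rw [hκ, one_div_pow, show (4 : ℝ) ^ j = 2 ^ j * 2 ^ j by rw [← mul_pow]; norm_num]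
        field_simp
        norm_num
      · have h1 := (hSb h hh w).trans_lt (not_le.1 hw)
        have h2 := (ENNReal.ofReal_lt_ofReal_iff ha).1 h1
        rw [lt_div_iff₀ hsn] at h2
        linarith
    · exact ⟨∅, by simp, fun h => absurd h hj⟩
  choose B hBμ hBb using hB
  have hsub : {w | ∃ h : EuclideanSpace ℝ (Fin d), ‖h‖ ≤ δ / 2 ∧
      ε * (1 + n * ‖h‖ ^ 2) < √(n : ℝ) * |empProc ν n (q h) w|} ⊆ ⋃ j, B j := by
    rintro w ⟨h, hh, hlt⟩
    by_contra hw
    simp only [Set.mem_iUnion, not_exists] at hw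
    have hex : ∃ j : ℕ, √(n : ℝ) * ‖h‖ ≤ 2 ^ j := pow_unbounded_of_one_lt _ (by norm_num) |>.imp
      fun _ h => h.le
    classical
    -- the shell of `h`: `2ʲ⁻¹ < √n ‖h‖ ≤ 2ʲ`, or `j = 0`; as `‖h‖ ≤ δ / 2`, its outer radius is at
    -- most `δ`
    set j := Nat.find hex with hj
    have hjs : √(n : ℝ) * ‖h‖ ≤ 2 ^ j := Nat.find_spec hex
    have hhj : ‖h‖ ≤ 2 ^ j / √(n : ℝ) := by rw [le_div_iff₀ hsn]; linarith
    have hexp : (n : ℝ) * ‖h‖ ^ 2 = (√(n : ℝ) * ‖h‖) ^ 2 := by rw [mul_pow, hsq]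
    rcases Nat.eq_zero_or_pos j with h0 | hpos
    · have := hBb j (by rw [h0, pow_zero]; exact hδn) h hhj w (hw j)
      rw [h0, pow_zero] at this
      have h3 : 0 ≤ ε * (n * ‖h‖ ^ 2) := by positivity
      nlinarith
    · obtain ⟨i, hi⟩ : ∃ i, j = i + 1 := ⟨j - 1, by omega⟩
      have hmin : 2 ^ i < √(n : ℝ) * ‖h‖ := not_le.1 (Nat.find_min hex (by omega))
      have hjδ : 2 ^ j / √(n : ℝ) ≤ δ := by
        rw [div_le_iff₀ hsn, hi, pow_succ]
        nlinarith
      have := hBb j hjδ h hhj w (hw j)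
      have h4 : (4 : ℝ) ^ i ≤ (√(n : ℝ) * ‖h‖) ^ 2 := by
        rw [show (4 : ℝ) ^ i = (2 ^ i) ^ 2 by rw [← pow_mul, mul_comm, pow_mul]; norm_num]
        gcongr
      rw [hi, pow_succ] at this
      rw [hexp] at hlt
      nlinarith
  calc μ _ ≤ μ (⋃ j, B j) := measure_mono hsub
    _ ≤ ∑' j, μ (B j) := measure_iUnion_le _
    _ ≤ ∑' j : ℕ, ENNReal.ofReal (ε / 2 * (1 / 2) ^ j) := ENNReal.tsum_le_tsum hBμ
    _ = ENNReal.ofReal (∑' j : ℕ, ε / 2 * (1 / 2) ^ j) :=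
        (ENNReal.ofReal_tsum_of_nonneg (fun j => by positivity)
          (summable_geometric_two.mul_left _)).symm
    _ = ENNReal.ofReal ε := by rw [tsum_mul_left, tsum_geometric_two]; congr 1; ring

/-- Stochastic differentiability at `0` of the empirical process indexed by a Lipschitz family that
is `o(‖h‖)` in `L²`. -/
lemma exists_measure_empProc_gt_le {d : ℕ} {𝒲 : Type*} [MeasurableSpace 𝒲]
    {ν : Measure 𝒲} [IsProbabilityMeasure ν] {q : EuclideanSpace ℝ (Fin d) → 𝒲 → ℝ} {M : 𝒲 → ℝ}
    {r : ℝ} (hr : 0 < r) (hqm : ∀ h, ‖h‖ ≤ r → Measurable (q h)) (hq0 : ∀ w, q 0 w = 0)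
    (hM : MemLp M 2 ν)
    (hlip : ∀ᵐ w ∂ν, ∀ h h', ‖h‖ ≤ r → ‖h'‖ ≤ r → |q h w - q h' w| ≤ M w * ‖h - h'‖)
    (hsmall : (fun h => ∫ w, q h w ^ 2 ∂ν) =o[𝓝 0] fun h => ‖h‖ ^ 2) {ε : ℝ} (hε : 0 < ε) :
    ∃ δ > 0, δ ≤ r ∧ ∃ N : ℕ, ∀ n ≥ N, (Measure.pi fun _ : Fin n => ν)
      {w | ∃ h, ‖h‖ ≤ δ ∧ ε * (1 + n * ‖h‖ ^ 2) < √(n : ℝ) * |empProc ν n (q h) w|} ≤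
        ENNReal.ofReal ε := by
  have hMa := hM.aestronglyMeasurable.aemeasurable
  -- Discard a null set, outside of which `M` agrees with a measurable function and the Lipschitz
  -- bound holds.
  obtain ⟨G, hGsub, hGm, hG⟩ := (hlip.and hMa.ae_eq_mk).exists_measurable_mem
  have hGc : ∀ᵐ w ∂ν, w ∈ G := hGsub
  let q' : EuclideanSpace ℝ (Fin d) → 𝒲 → ℝ := fun h => G.indicator (q h)
  have hq' : ∀ h, q' h =ᵐ[ν] q h := fun h => by
    filter_upwards [hGc] with w hw
    exact Set.indicator_of_mem hw _
  have hMk : MemLp (fun w => |hMa.mk M w|) 2 ν := (hM.ae_eq hMa.ae_eq_mk).abs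
  obtain ⟨δ, hδ, hδr, N, hN⟩ := exists_measure_empProc_gt_le_of_measurable (ν := ν) (q := q')
    (M := fun w => |hMa.mk M w|) hr (fun h hh => (hqm h hh).indicator hGm)
    (fun w => by by_cases hw : w ∈ G <;> simp [q', hw, hq0])
    hMa.measurable_mk.abs (fun w => abs_nonneg _) hMk
    (fun w h h' hh hh' => by
      by_cases hw : w ∈ G
      · simp only [q', Set.indicator_of_mem hw]
        refine ((hG w hw).1 h h' hh hh').trans ?_
        rw [(hG w hw).2]
        exact mul_le_mul_of_nonneg_right (le_abs_self _) (norm_nonneg _)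
      · simp only [q', Set.indicator_of_notMem hw, sub_zero, abs_zero]
        positivity)
    (hsmall.congr_left fun h => integral_congr_ae <| by
      filter_upwards [hq' h] with w hw
      rw [hw]) hε
  refine ⟨δ, hδ, hδr, N, fun n hn => le_trans (measure_mono_ae ?_) (hN n hn)⟩
  have hall : ∀ᵐ w ∂(Measure.pi fun _ : Fin n => ν), ∀ i, w i ∈ G :=
    ae_all_iff.2 fun i => (Measure.tendsto_eval_ae_ae (μ := fun _ : Fin n => ν) (i := i)).eventually hGc
  filter_upwards [hall] with w hw
  rintro ⟨h, hh, hlt⟩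
  refine ⟨h, hh, ?_⟩
  have : empProc ν n (q' h) w = empProc ν n (q h) w := by
    simp only [empProc, integral_congr_ae (hq' h)]
    congr 1
    refine Finset.sum_congr rfl fun i _ => ?_
    simp [q', hw i]
  rwa [this]

/-! ### Asymptotic linearity of minimizers -/

section Deterministic

variable {E : Type*} [NormedAddCommGroup E] [InnerProductSpace ℝ E]

/-- Near-minimizers of a coercive quadratic form with linear perturbation are close to its
minimizer `x`, for which `G = -A x`. The errors may grow quadratically. -/
lemma norm_sub_sq_le_of_quadratic {A : E →L[ℝ] E} (hsym : ∀ x y, ⟪A x, y⟫ = ⟪x, A y⟫) {c τ : ℝ}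
    (hcoer : ∀ x, c * ‖x‖ ^ 2 ≤ ⟪A x, x⟫) (hτ0 : 0 ≤ τ) (hτ : τ ≤ c / 8) {x s : E}
    (h : -⟪A x, s⟫ + 1 / 2 * ⟪A s, s⟫ - τ * (1 + ‖s‖ ^ 2) ≤
      -⟪A x, x⟫ + 1 / 2 * ⟪A x, x⟫ + τ * (1 + ‖x‖ ^ 2)) :
    c / 4 * ‖s - x‖ ^ 2 ≤ τ * (2 + 3 * ‖x‖ ^ 2) := by
  have h1 := hcoer (s - x)
  have h2 : ⟪A (s - x), s - x⟫ = ⟪A s, s⟫ - 2 * ⟪A x, s⟫ + ⟪A x, x⟫ := by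
    rw [map_sub, inner_sub_left, inner_sub_right, inner_sub_right, hsym s x,
      real_inner_comm (A x) s]
    ring
  have h3 : ‖s‖ ^ 2 ≤ 2 * ‖s - x‖ ^ 2 + 2 * ‖x‖ ^ 2 := by
    have h4 : ‖s‖ ≤ ‖s - x‖ + ‖x‖ := by simpa using norm_add_le (s - x) x
    have h5 : ‖s‖ ^ 2 ≤ (‖s - x‖ + ‖x‖) ^ 2 := by gcongr
    nlinarith [sq_nonneg (‖s - x‖ - ‖x‖)]
  have h6 : τ * ‖s‖ ^ 2 ≤ τ * (2 * ‖s - x‖ ^ 2 + 2 * ‖x‖ ^ 2) := by gcongr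
  have h7 : τ * ‖s - x‖ ^ 2 ≤ c / 8 * ‖s - x‖ ^ 2 := by gcongr
  nlinarith

end Deterministic

section MEstimation

variable {d : ℕ} {𝒲 : Type*} [MeasurableSpace 𝒲] {ν : Measure 𝒲}
  {m : EuclideanSpace ℝ (Fin d) → 𝒲 → ℝ} {g : 𝒲 → EuclideanSpace ℝ (Fin d)} {M : 𝒲 → ℝ}
  {θs : EuclideanSpace ℝ (Fin d)} {r : ℝ}

/-- The remainder of the first-order expansion of `m` at `θs` with gradient `g`. -/
noncomputable def linRemainder (m : EuclideanSpace ℝ (Fin d) → 𝒲 → ℝ)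
    (g : 𝒲 → EuclideanSpace ℝ (Fin d)) (θs h : EuclideanSpace ℝ (Fin d)) (w : 𝒲) : ℝ :=
  m (θs + h) w - m θs w - ⟪g w, h⟫

lemma measurable_gradient_of_hasGradientAt (hr : 0 < r)
    (hm : ∀ θ ∈ Metric.closedBall θs r, Measurable (m θ))
    (hg : ∀ w, HasGradientAt (fun θ => m θ w) (g w) θs) : Measurable g := by
  have hcoord : ∀ i, Measurable fun w => g w i := by
    intro i
    set b : EuclideanSpace ℝ (Fin d) := EuclideanSpace.single i 1 with hb
    have hbn : ‖b‖ = 1 := by simp [hb]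
    let a : ℕ → ℝ := fun k => r / (k + 1)
    have ha0 : ∀ k, 0 < a k := fun k => by positivity
    have har : ∀ k, a k ≤ r := fun k => div_le_self hr.le (by
      have : (0 : ℝ) ≤ k := Nat.cast_nonneg k
      linarith)
    refine measurable_of_tendsto_metrizable
      (f := fun (k : ℕ) w => (a k)⁻¹ * (m (θs + a k • b) w - m θs w)) (fun k => ?_) ?_
    · refine Measurable.const_mul ((hm _ ?_).sub (hm _ ?_)) _
      · rw [mem_closedBall_iff_norm, add_sub_cancel_left, norm_smul, hbn, mul_one,
          Real.norm_eq_abs, abs_of_pos (ha0 k)]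
        exact har k
      · exact Metric.mem_closedBall_self hr.le
    · refine tendsto_pi_nhds.2 fun w => ?_
      have h1 := (hg w).hasFDerivAt.hasLineDerivAt b
      have h2 := h1.tendsto_slope_zero
      have ha : Tendsto a atTop (𝓝[≠] 0) := by
        refine tendsto_nhdsWithin_iff.2 ⟨?_, Eventually.of_forall fun k => (ha0 k).ne'⟩
        exact tendsto_const_div_atTop_nhds_zero_nat r |>.comp (tendsto_add_atTop_nat 1) |>.congr
          fun k => by simp [a]
      have h3 := h2.comp ha
      have h4 : (InnerProductSpace.toDual ℝ (EuclideanSpace ℝ (Fin d)) (g w)) b = g w i := by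
        rw [InnerProductSpace.toDual_apply_apply, hb, EuclideanSpace.inner_single_right]
        simp
      rw [h4] at h3
      refine h3.congr fun k => ?_
      simp
  exact (PiLp.continuous_toLp 2 _).measurable.comp (measurable_pi_iff.2 hcoord)

lemma ae_norm_gradient_le (hr : 0 < r)
    (hlip : ∀ᵐ w ∂ν, ∀ θ ∈ Metric.closedBall θs r, ∀ θ' ∈ Metric.closedBall θs r,
      |m θ w - m θ' w| ≤ M w * ‖θ - θ'‖)
    (hg : ∀ w, HasGradientAt (fun θ => m θ w) (g w) θs) : ∀ᵐ w ∂ν, ‖g w‖ ≤ |M w| := by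
  filter_upwards [hlip] with w hw
  have h := (hg w).hasFDerivAt.le_of_lip' (C := |M w|) (abs_nonneg _) (by
    filter_upwards [Metric.closedBall_mem_nhds θs hr] with θ hθ
    refine (hw θ hθ θs (Metric.mem_closedBall_self hr.le)).trans ?_
    exact mul_le_mul_of_nonneg_right (le_abs_self _) (norm_nonneg _))
  rwa [LinearIsometryEquiv.norm_map] at h

lemma memLp_gradient (hr : 0 < r) (hm : ∀ θ ∈ Metric.closedBall θs r, Measurable (m θ))
    (hM : MemLp M 2 ν)
    (hlip : ∀ᵐ w ∂ν, ∀ θ ∈ Metric.closedBall θs r, ∀ θ' ∈ Metric.closedBall θs r,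
      |m θ w - m θ' w| ≤ M w * ‖θ - θ'‖)
    (hg : ∀ w, HasGradientAt (fun θ => m θ w) (g w) θs) : MemLp g 2 ν :=
  hM.abs.mono' (measurable_gradient_of_hasGradientAt hr hm hg).aestronglyMeasurable
    (ae_norm_gradient_le hr hlip hg)

lemma ae_abs_linRemainder_sub_le (hr : 0 < r)
    (hlip : ∀ᵐ w ∂ν, ∀ θ ∈ Metric.closedBall θs r, ∀ θ' ∈ Metric.closedBall θs r,
      |m θ w - m θ' w| ≤ M w * ‖θ - θ'‖)
    (hg : ∀ w, HasGradientAt (fun θ => m θ w) (g w) θs) :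
    ∀ᵐ w ∂ν, ∀ h h', ‖h‖ ≤ r → ‖h'‖ ≤ r →
      |linRemainder m g θs h w - linRemainder m g θs h' w| ≤ 2 * |M w| * ‖h - h'‖ := by
  filter_upwards [hlip, ae_norm_gradient_le hr hlip hg] with w hw hgw h h' hh hh'
  have h1 := hw (θs + h) (by simpa using hh) (θs + h') (by simpa using hh')
  rw [add_sub_add_left_eq_sub] at h1
  have h2 : |⟪g w, h - h'⟫| ≤ |M w| * ‖h - h'‖ :=
    (abs_real_inner_le_norm _ _).trans (by gcongr)
  have h3 : M w * ‖h - h'‖ ≤ |M w| * ‖h - h'‖ := by gcongr; exact le_abs_self _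
  rw [show linRemainder m g θs h w - linRemainder m g θs h' w =
    (m (θs + h) w - m (θs + h') w) - ⟪g w, h - h'⟫ by
      simp only [linRemainder, inner_sub_right]; ring]
  refine (abs_sub _ _).trans ?_
  linarith

lemma measurable_linRemainder (hr : 0 < r)
    (hm : ∀ θ ∈ Metric.closedBall θs r, Measurable (m θ))
    (hg : ∀ w, HasGradientAt (fun θ => m θ w) (g w) θs) {h : EuclideanSpace ℝ (Fin d)}
    (hh : ‖h‖ ≤ r) : Measurable (linRemainder m g θs h) := by
  have h1 := measurable_gradient_of_hasGradientAt hr hm hg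
  exact ((hm _ (by simpa using hh)).sub (hm _ (Metric.mem_closedBall_self hr.le))).sub
    (h1.inner measurable_const)

lemma memLp_linRemainder (hr : 0 < r) (hm : ∀ θ ∈ Metric.closedBall θs r, Measurable (m θ))
    (hM : MemLp M 2 ν)
    (hlip : ∀ᵐ w ∂ν, ∀ θ ∈ Metric.closedBall θs r, ∀ θ' ∈ Metric.closedBall θs r,
      |m θ w - m θ' w| ≤ M w * ‖θ - θ'‖)
    (hg : ∀ w, HasGradientAt (fun θ => m θ w) (g w) θs) {h : EuclideanSpace ℝ (Fin d)}
    (hh : ‖h‖ ≤ r) : MemLp (linRemainder m g θs h) 2 ν := by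
  refine ((hM.abs.const_mul 2).mul_const ‖h‖).mono'
    (measurable_linRemainder hr hm hg hh).aestronglyMeasurable ?_
  filter_upwards [ae_abs_linRemainder_sub_le hr hlip hg] with w hw
  have := hw h 0 hh (by simpa using hr.le)
  simpa [linRemainder] using this

/-- By differentiability and dominated convergence, the remainder is `o(‖h‖)` in `L²`. -/
lemma isLittleO_integral_linRemainder_sq [IsProbabilityMeasure ν] (hr : 0 < r)
    (hm : ∀ θ ∈ Metric.closedBall θs r, Measurable (m θ)) (hM : MemLp M 2 ν)
    (hlip : ∀ᵐ w ∂ν, ∀ θ ∈ Metric.closedBall θs r, ∀ θ' ∈ Metric.closedBall θs r,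
      |m θ w - m θ' w| ≤ M w * ‖θ - θ'‖)
    (hg : ∀ w, HasGradientAt (fun θ => m θ w) (g w) θs) :
    (fun h => ∫ w, linRemainder m g θs h w ^ 2 ∂ν) =o[𝓝 0] fun h => ‖h‖ ^ 2 := by
  refine (Asymptotics.isLittleO_iff_tendsto fun h hh => ?_).2 ?_
  · have : h = 0 := by simpa using hh
    simp [this, linRemainder]
  have h0 : (0 : ℝ) = ∫ _w : 𝒲, (0 : ℝ) ∂ν := by simp
  simp_rw [← integral_div]
  rw [h0]
  have hball : ∀ᶠ h : EuclideanSpace ℝ (Fin d) in 𝓝 0, ‖h‖ ≤ r := by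
    filter_upwards [Metric.closedBall_mem_nhds (0 : EuclideanSpace ℝ (Fin d)) hr] with h hh
    simpa using hh
  refine tendsto_integral_filter_of_dominated_convergence (fun w => (2 * |M w|) ^ 2) ?_ ?_
    (hM.abs.const_mul 2).integrable_sq (Eventually.of_forall fun w => ?_)
  · filter_upwards [hball] with h hh
    exact (((measurable_linRemainder hr hm hg hh).pow_const 2).div_const _).aestronglyMeasurable
  · filter_upwards [hball] with h hh
    filter_upwards [ae_abs_linRemainder_sub_le hr hlip hg] with w hw
    have h1 := hw h 0 hh (by simpa using hr.le)
    have h2 : |linRemainder m g θs h w| ≤ 2 * |M w| * ‖h‖ := by simpa [linRemainder] using h1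
    rw [Real.norm_eq_abs, abs_of_nonneg (by positivity)]
    refine div_le_of_le_mul₀ (by positivity) (by positivity) ?_
    rw [← mul_pow, ← sq_abs]
    gcongr
  · have h1 : (fun h => linRemainder m g θs h w) =o[𝓝 0] fun h => h := by
      have := hasGradientAt_iff_isLittleO_nhds_zero.1 (hg w)
      refine this.congr_left fun h => ?_
      simp [linRemainder]
    have h2 := (h1.norm_right.pow (n := 2) two_pos).tendsto_div_nhds_zero
    exact h2

/-- If the population criterion has vanishing first-order term at `θs`, then the gradient is
centered. -/
lemma integral_gradient_eq_zero [IsProbabilityMeasure ν] (hr : 0 < r)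
    (hm : ∀ θ ∈ Metric.closedBall θs r, Measurable (m θ)) (hM : MemLp M 2 ν)
    (hlip : ∀ᵐ w ∂ν, ∀ θ ∈ Metric.closedBall θs r, ∀ θ' ∈ Metric.closedBall θs r,
      |m θ w - m θ' w| ≤ M w * ‖θ - θ'‖)
    (hg : ∀ w, HasGradientAt (fun θ => m θ w) (g w) θs)
    (hF : (fun h => ∫ w, (m (θs + h) w - m θs w) ∂ν) =o[𝓝 0] fun h => h) :
    ∫ w, g w ∂ν = 0 := by
  have hgi : Integrable g ν := (memLp_gradient hr hm hM hlip hg).integrable one_le_two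
  have hball : ∀ᶠ h : EuclideanSpace ℝ (Fin d) in 𝓝 0, ‖h‖ ≤ r := by
    filter_upwards [Metric.closedBall_mem_nhds (0 : EuclideanSpace ℝ (Fin d)) hr] with h hh
    simpa using hh
  have hq : (fun h => ∫ w, linRemainder m g θs h w ∂ν) =o[𝓝 0] fun h => h := by
    have h1 := isLittleO_integral_linRemainder_sq hr hm hM hlip hg
    have h2 : (fun h => (∫ w, linRemainder m g θs h w ∂ν) ^ 2) =o[𝓝 0] fun h => ‖h‖ ^ 2 := by
      refine Asymptotics.IsBigO.trans_isLittleO (Asymptotics.IsBigO.of_bound 1 ?_) h1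
      filter_upwards [hball] with h hh
      have h3 := memLp_linRemainder hr hm hM hlip hg hh
      have h4 := variance_nonneg (linRemainder m g θs h) ν
      rw [variance_eq_sub h3] at h4
      rw [one_mul, Real.norm_eq_abs, Real.norm_eq_abs, abs_of_nonneg (sq_nonneg _),
        abs_of_nonneg (integral_nonneg fun w => sq_nonneg _)]
      simpa using h4
    exact (Asymptotics.IsLittleO.of_pow h2 two_ne_zero).of_norm_right
  have hlin : (fun h => ⟪∫ w, g w ∂ν, h⟫) =o[𝓝 0] fun h => h := by
    refine (hF.sub hq).congr' ?_ EventuallyEq.rfl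
    filter_upwards [hball] with h hh
    have h3 := (memLp_linRemainder hr hm hM hlip hg hh).integrable one_le_two
    have h5 : Integrable (fun w => ⟪g w, h⟫) ν := hgi.inner_const h
    have h4 : Integrable (fun w => m (θs + h) w - m θs w) ν :=
      (h3.add h5).congr (Eventually.of_forall fun w => by simp [linRemainder])
    rw [← integral_sub h4 h3, real_inner_comm, ← integral_inner hgi]
    refine integral_congr_ae (Eventually.of_forall fun w => ?_)
    simp [linRemainder, real_inner_comm]
  have h1 : HasFDerivAt (innerSL ℝ (∫ w, g w ∂ν)) (0 : EuclideanSpace ℝ (Fin d) →L[ℝ] ℝ) 0 := by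
    rw [hasFDerivAt_iff_isLittleO_nhds_zero]
    simpa using hlin
  have h2 := h1.unique (innerSL ℝ (∫ w, g w ∂ν)).hasFDerivAt
  have h3 := congrArg norm h2
  rw [innerSL_apply_norm, norm_zero] at h3
  exact norm_eq_zero.1 h3.symm

lemma norm_le_sum_abs (x : EuclideanSpace ℝ (Fin d)) : ‖x‖ ≤ ∑ i, |x i| := by
  rw [EuclideanSpace.norm_eq]
  refine Real.sqrt_le_iff.2 ⟨Finset.sum_nonneg fun i _ => abs_nonneg _, ?_⟩
  simp only [Real.norm_eq_abs]
  exact Finset.sum_sq_le_sq_sum_of_nonneg fun i _ => abs_nonneg _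

/-- Normalized sums of centered square-integrable vectors are tight. -/
lemma exists_measure_norm_sum_ge_le [IsProbabilityMeasure ν] (hgm : Measurable g)
    (hg : MemLp g 2 ν) (hg0 : ∫ w, g w ∂ν = 0) : ∃ C : ℝ, 0 ≤ C ∧ ∀ n : ℕ, ∀ K > 0,
      (Measure.pi fun _ : Fin n => ν) {w | K ≤ ‖(√(n : ℝ))⁻¹ • ∑ i, g (w i)‖} ≤
        ENNReal.ofReal (C / K) := by
  have hgi : Integrable g ν := hg.integrable one_le_two
  have hcm : ∀ j, Measurable fun w => g w j := fun j =>
    (EuclideanSpace.proj (𝕜 := ℝ) j).continuous.measurable.comp hgm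
  have hcL : ∀ j, MemLp (fun w => g w j) 2 ν := fun j =>
    (EuclideanSpace.proj (𝕜 := ℝ) j).comp_memLp' hg
  have hc0 : ∀ j, ∫ w, g w j ∂ν = 0 := fun j => by
    have := (EuclideanSpace.proj (𝕜 := ℝ) j).integral_comp_comm hgi
    rw [hg0, map_zero] at this
    exact this
  refine ⟨∑ j, √(∫ w, g w j ^ 2 ∂ν), Finset.sum_nonneg fun j _ => Real.sqrt_nonneg _,
    fun n K hK => ?_⟩
  have hm : ∀ j ∈ Finset.univ, Measurable fun w : Fin n → 𝒲 =>
      ENNReal.ofReal |empProc ν n (fun w => g w j) w| := fun j _ =>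
    (measurable_empProc (hcm j)).abs.ennreal_ofReal
  have hS : ∫⁻ w, ∑ j, ENNReal.ofReal |empProc ν n (fun w => g w j) w|
      ∂(Measure.pi fun _ : Fin n => ν) ≤ ENNReal.ofReal (∑ j, √(∫ w, g w j ^ 2 ∂ν)) := by
    rw [lintegral_finsetSum _ hm, ENNReal.ofReal_sum_of_nonneg fun j _ => Real.sqrt_nonneg _]
    exact Finset.sum_le_sum fun j _ => lintegral_abs_empProc_le_sqrt (hcL j)
  refine (measure_mono fun w hw => ?_).trans
    (measure_le_ofReal_div (Finset.measurable_fun_sum _ hm) hS hK)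
  rw [Set.mem_ofPred_eq, ← ENNReal.ofReal_sum_of_nonneg fun j _ => abs_nonneg _]
  refine ENNReal.ofReal_le_ofReal (le_trans hw ((norm_le_sum_abs _).trans (le_of_eq ?_)))
  refine Finset.sum_congr rfl fun j _ => ?_
  simp [empProc, hc0]

lemma isLittleO_id_of_isLittleO_sub_quadratic {F : EuclideanSpace ℝ (Fin d) → ℝ}
    (A : EuclideanSpace ℝ (Fin d) →L[ℝ] EuclideanSpace ℝ (Fin d))
    (hexp : (fun h => F h - 1 / 2 * ⟪A h, h⟫) =o[𝓝 0] fun h => ‖h‖ ^ 2) :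
    F =o[𝓝 0] fun h => h := by
  have h1 : (fun h : EuclideanSpace ℝ (Fin d) => ‖h‖ ^ 2) =o[𝓝 0] fun h => h :=
    Asymptotics.isLittleO_norm_pow_id one_lt_two
  have h2 : (fun h => 1 / 2 * ⟪A h, h⟫) =O[𝓝 0] fun h => ‖h‖ ^ 2 := by
    refine Asymptotics.IsBigO.of_bound ‖A‖ (Eventually.of_forall fun h => ?_)
    rw [norm_mul, Real.norm_eq_abs, Real.norm_eq_abs, Real.norm_eq_abs,
      abs_of_nonneg (sq_nonneg ‖h‖)]
    have h3 : |⟪A h, h⟫| ≤ ‖A‖ * ‖h‖ * ‖h‖ :=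
      (abs_real_inner_le_norm _ _).trans (by gcongr; exact A.le_opNorm h)
    rw [abs_of_pos (by norm_num : (0 : ℝ) < 1 / 2)]
    nlinarith [abs_nonneg ⟪A h, h⟫]
  exact ((hexp.trans h1).add (h2.trans_isLittleO h1)).congr_left fun h => by ring

/-- Asymptotic linearity of M-estimators under a Lipschitz condition: no convexity is needed, since
the empirical criterion is a quadratic up to an error `o(1 + n ‖θ - θs‖²)`, uniformly near `θs`.
The samples form a triangular array, and `θh` need only be a minimizer near `θs` with probability
tending to one. -/
theorem tendstoInMeasure_argmin_linearization [IsProbabilityMeasure ν]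
    {Ω : Type*} [MeasurableSpace Ω] {P : Measure Ω}
    (hr : 0 < r) (hm : ∀ θ ∈ Metric.closedBall θs r, Measurable (m θ)) (hM : MemLp M 2 ν)
    (hlip : ∀ᵐ w ∂ν, ∀ θ ∈ Metric.closedBall θs r, ∀ θ' ∈ Metric.closedBall θs r,
      |m θ w - m θ' w| ≤ M w * ‖θ - θ'‖)
    (hg : ∀ w, HasGradientAt (fun θ => m θ w) (g w) θs)
    {A B : EuclideanSpace ℝ (Fin d) →L[ℝ] EuclideanSpace ℝ (Fin d)}
    (hAB : ∀ x, A (B x) = x) (hsym : ∀ x y, ⟪A x, y⟫ = ⟪x, A y⟫) {c : ℝ} (hc : 0 < c)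
    (hcoer : ∀ x, c * ‖x‖ ^ 2 ≤ ⟪A x, x⟫)
    (hexp : (fun h => ∫ w, (m (θs + h) w - m θs w) ∂ν - 1 / 2 * ⟪A h, h⟫) =o[𝓝 0]
      fun h => ‖h‖ ^ 2)
    {W : (n : ℕ) → Ω → Fin n → 𝒲} (hWm : ∀ n, Measurable (W n))
    (hW : ∀ n, P.map (W n) = Measure.pi fun _ => ν)
    {θh : ℕ → Ω → EuclideanSpace ℝ (Fin d)}
    (hcons : TendstoInMeasure P θh atTop fun _ => θs)
    (hmin : Tendsto (fun n : ℕ => P {ω | ¬ ∀ θ ∈ Metric.closedBall θs r,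
      ∑ i, m (θh n ω) (W n ω i) ≤ ∑ i, m θ (W n ω i)}) atTop (𝓝 0)) :
    TendstoInMeasure P
      (fun (n : ℕ) ω => √(n : ℝ) • (θh n ω - θs) + B ((√(n : ℝ))⁻¹ • ∑ i, g (W n ω i))) atTop
      fun _ => 0 := by
  have hg0 := integral_gradient_eq_zero hr hm hM hlip hg
    (isLittleO_id_of_isLittleO_sub_quadratic A hexp)
  have hgL := memLp_gradient hr hm hM hlip hg
  have hgm := measurable_gradient_of_hasGradientAt hr hm hg
  have hgi : Integrable g ν := hgL.integrable one_le_two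
  obtain ⟨C, hC0, hC⟩ := exists_measure_norm_sum_ge_le hgm hgL hg0
  rw [tendstoInMeasure_iff_dist]
  intro e he
  rw [ENNReal.tendsto_nhds_zero]
  intro η' hη'
  obtain ⟨η, hη0, hηη'⟩ : ∃ η : ℝ, 0 < η ∧ ENNReal.ofReal (4 * η) ≤ η' := by
    rcases eq_or_ne η' ⊤ with h | h
    · exact ⟨1, one_pos, by rw [h]; exact le_top⟩
    · refine ⟨η'.toReal / 4, by have := ENNReal.toReal_pos hη'.ne' h; positivity, ?_⟩
      rw [mul_div_cancel₀ _ (by norm_num), ENNReal.ofReal_toReal h]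
  -- By tightness, the normalized score exceeds `K` with probability at most `η`; `Kx` then bounds the
  -- minimizer `-B G` of the quadratic.
  set K : ℝ := C / η + 1 with hK
  have hK0 : 0 < K := by positivity
  have hCK : C / K ≤ η := by
    rw [div_le_iff₀ hK0, hK, mul_add, mul_div_cancel₀ _ hη0.ne']
    linarith
  set Kx : ℝ := ‖B‖ * K with hKx
  have hKx0 : 0 ≤ Kx := by positivity
  -- With an approximation error `τ (1 + ‖s‖²)` the comparison with the minimizer of the quadratic
  -- yields `c / 4 * ‖s + B G‖² ≤ τ (2 + 3 Kx²) ≤ c * e² / 8`.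
  set τ : ℝ := min (c / 8) (c * e ^ 2 / (8 * (2 + 3 * Kx ^ 2))) with hτ
  have hτ0 : 0 < τ := by positivity
  obtain ⟨δ₁, hδ₁, hδ₁r, N₁, hN₁⟩ := exists_measure_empProc_gt_le (ν := ν)
    (q := linRemainder m g θs) (M := fun w => 2 * |M w|) hr
    (fun h hh => measurable_linRemainder hr hm hg hh) (fun w => by simp [linRemainder])
    (hM.abs.const_mul 2) (ae_abs_linRemainder_sub_le hr hlip hg)
    (isLittleO_integral_linRemainder_sq hr hm hM hlip hg)
    (ε := min (τ / 2) η) (by positivity)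
  obtain ⟨δ₂, hδ₂, hb₂⟩ := Metric.eventually_nhds_iff.1 (hexp.def (c := τ / 2) (by positivity))
  set δ : ℝ := min δ₁ (δ₂ / 2) with hδ
  have hδ0 : 0 < δ := by positivity
  have hcons' := (tendstoInMeasure_iff_dist.1 hcons) δ hδ0
  have hsqrt : Tendsto (fun n : ℕ => δ * √(n : ℝ)) atTop atTop :=
    (Real.tendsto_sqrt_atTop.comp tendsto_natCast_atTop_atTop).const_mul_atTop hδ0
  have hηE : (0 : ℝ≥0∞) < ENNReal.ofReal η := ENNReal.ofReal_pos.2 hη0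
  filter_upwards [(ENNReal.tendsto_nhds_zero.1 hcons') _ hηE,
    (ENNReal.tendsto_nhds_zero.1 hmin) _ hηE, eventually_ge_atTop N₁, eventually_ge_atTop 1,
    hsqrt.eventually_ge_atTop Kx] with n hn1 hn2 hn3 hn4 hn5
  have hn0 : (0 : ℝ) < n := by exact_mod_cast hn4
  have hsn : (0 : ℝ) < √(n : ℝ) := Real.sqrt_pos.2 hn0
  have hsq : √(n : ℝ) ^ 2 = n := Real.sq_sqrt hn0.le
  have hss : √(n : ℝ) * (√(n : ℝ))⁻¹ = 1 := mul_inv_cancel₀ hsn.ne'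
  set ε' : ℝ := min (τ / 2) η with hε'
  let B₁ : Set (Fin n → 𝒲) := {w | ∃ h, ‖h‖ ≤ δ₁ ∧
    ε' * (1 + n * ‖h‖ ^ 2) < √(n : ℝ) * |empProc ν n (linRemainder m g θs h) w|}
  let B₂ : Set (Fin n → 𝒲) := {w | K ≤ ‖(√(n : ℝ))⁻¹ • ∑ i, g (w i)‖}
  let B₃ : Set Ω := {ω | δ ≤ dist (θh n ω) θs}
  let B₄ : Set Ω := {ω | ¬ ∀ θ ∈ Metric.closedBall θs r,
      ∑ i, m (θh n ω) (W n ω i) ≤ ∑ i, m θ (W n ω i)}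
  have hpull : ∀ S : Set (Fin n → 𝒲), P (W n ⁻¹' S) ≤ (Measure.pi fun _ : Fin n => ν) S :=
    fun S => by
      rw [← hW n]
      exact Measure.le_map_apply (hWm n).aemeasurable S
  have hsub : {ω | e ≤ dist (√(n : ℝ) • (θh n ω - θs) + B ((√(n : ℝ))⁻¹ • ∑ i, g (W n ω i))) 0} ⊆
      (W n ⁻¹' B₁ ∪ W n ⁻¹' B₂) ∪ (B₃ ∪ B₄) := by
    intro ω hω
    by_contra hbad
    simp only [Set.mem_union, not_or] at hbad
    obtain ⟨⟨hω1, hω2⟩, hω3, hω4⟩ := hbad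
    have hω3 : dist (θh n ω) θs < δ := not_le.1 hω3
    have hω4 := not_not.1 hω4
    have hω2 : ‖(√(n : ℝ))⁻¹ • ∑ i, g (W n ω i)‖ < K := not_le.1 hω2
    have hω1 : ∀ h : EuclideanSpace ℝ (Fin d), ‖h‖ ≤ δ₁ →
        √(n : ℝ) * |empProc ν n (linRemainder m g θs h) (W n ω)| ≤ ε' * (1 + n * ‖h‖ ^ 2) :=
      fun h hh => not_lt.1 fun hlt => hω1 ⟨h, hh, hlt⟩
    set G := (√(n : ℝ))⁻¹ • ∑ i, g (W n ω i) with hG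
    set x : EuclideanSpace ℝ (Fin d) := -B G with hx
    have hxK : ‖x‖ ≤ Kx := by
      rw [hx, norm_neg]
      exact (B.le_opNorm G).trans (mul_le_mul_of_nonneg_left hω2.le (norm_nonneg _))
    -- The error of the quadratic approximation has two sources: the empirical process of the
    -- remainder, and the Taylor remainder of the population criterion.
    have hquad : ∀ h : EuclideanSpace ℝ (Fin d), ‖h‖ ≤ δ →
        |∑ i, m (θs + h) (W n ω i) - ∑ i, m θs (W n ω i) -
          (⟪G, √(n : ℝ) • h⟫ + 1 / 2 * ⟪A (√(n : ℝ) • h), √(n : ℝ) • h⟫)| ≤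
          τ * (1 + ‖√(n : ℝ) • h‖ ^ 2) := by
      intro h hh
      have hhr : ‖h‖ ≤ r := hh.trans ((min_le_left _ _).trans hδ₁r)
      have hLi := (memLp_linRemainder hr hm hM hlip hg hhr).integrable one_le_two
      have hgh : Integrable (fun w => ⟪g w, h⟫) ν := hgi.inner_const h
      have hEq : ∫ w, linRemainder m g θs h w ∂ν = ∫ w, (m (θs + h) w - m θs w) ∂ν := by
        have h1 : ∫ w, ⟪g w, h⟫ ∂ν = 0 := by
          simp_rw [real_inner_comm h]
          rw [integral_inner hgi, hg0, inner_zero_right]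
        rw [← sub_zero (∫ w, (m (θs + h) w - m θs w) ∂ν), ← h1, ← integral_sub _ hgh]
        · rfl
        · exact (hLi.add hgh).congr (Eventually.of_forall fun w => by simp [linRemainder])
      have hemp : √(n : ℝ) * empProc ν n (linRemainder m g θs h) (W n ω) =
          ∑ i, m (θs + h) (W n ω i) - ∑ i, m θs (W n ω i) - ⟪G, √(n : ℝ) • h⟫ -
            n * ∫ w, (m (θs + h) w - m θs w) ∂ν := by
        rw [empProc, ← mul_assoc, hss, one_mul, hEq, hG, real_inner_smul_left,
          real_inner_smul_right, ← mul_assoc, inv_mul_cancel₀ hsn.ne', one_mul, sum_inner,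
          Finset.sum_sub_distrib]
        simp only [linRemainder, Finset.sum_sub_distrib, Finset.sum_const, Finset.card_univ,
          Fintype.card_fin, nsmul_eq_mul]
      have h1 := hω1 h (hh.trans (min_le_left _ _))
      have h2 := hb₂ (y := h) (by
        rw [dist_zero_right]
        have := hh.trans (min_le_right _ _)
        linarith)
      rw [Real.norm_eq_abs, Real.norm_eq_abs, abs_of_nonneg (sq_nonneg ‖h‖)] at h2
      have h3 : ‖√(n : ℝ) • h‖ ^ 2 = n * ‖h‖ ^ 2 := by
        rw [norm_smul, mul_pow, Real.norm_eq_abs, sq_abs, hsq]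
      have h4 : ⟪A (√(n : ℝ) • h), √(n : ℝ) • h⟫ = n * ⟪A h, h⟫ := by
        rw [map_smul, real_inner_smul_left, real_inner_smul_right, ← mul_assoc, ← sq, hsq]
      have h5 : √(n : ℝ) * |empProc ν n (linRemainder m g θs h) (W n ω)| =
          |√(n : ℝ) * empProc ν n (linRemainder m g θs h) (W n ω)| := by
        rw [abs_mul, abs_of_pos hsn]
      rw [h5, hemp] at h1
      rw [h3, h4]
      have h6 : |(n : ℝ) * (∫ w, (m (θs + h) w - m θs w) ∂ν - 1 / 2 * ⟪A h, h⟫)| ≤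
          n * (τ / 2 * ‖h‖ ^ 2) := by
        rw [abs_mul, abs_of_pos hn0]
        gcongr
      have h7 : ε' * (1 + n * ‖h‖ ^ 2) ≤ τ / 2 * (1 + n * ‖h‖ ^ 2) := by
        gcongr
        exact min_le_left _ _
      have h8 := abs_add_le (∑ i, m (θs + h) (W n ω i) - ∑ i, m θs (W n ω i) -
        ⟪G, √(n : ℝ) • h⟫ - n * ∫ w, (m (θs + h) w - m θs w) ∂ν)
        (n * (∫ w, (m (θs + h) w - m θs w) ∂ν - 1 / 2 * ⟪A h, h⟫))
      refine le_trans (le_of_eq ?_) (h8.trans ?_)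
      · congr 1
        ring
      · have : 0 ≤ (n : ℝ) * ‖h‖ ^ 2 := by positivity
        linarith
    -- The minimizer `x` of the quadratic is a competitor of the estimator, as `x / √n` lies in the ball.
    set s : EuclideanSpace ℝ (Fin d) := √(n : ℝ) • (θh n ω - θs) with hs
    have hsx : s + B G = s - x := by rw [hx, sub_neg_eq_add]
    have hqs := hquad (θh n ω - θs) (by rw [← dist_eq_norm]; exact hω3.le)
    have hxδ : ‖(√(n : ℝ))⁻¹ • x‖ ≤ δ := by
      rw [norm_smul, Real.norm_eq_abs, abs_of_pos (inv_pos.2 hsn), inv_mul_le_iff₀ hsn]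
      linarith
    have hqx := hquad ((√(n : ℝ))⁻¹ • x) hxδ
    rw [smul_smul, hss, one_smul] at hqx
    rw [← hs, add_sub_cancel] at hqs
    have hmn := hω4 (θs + (√(n : ℝ))⁻¹ • x) (by
      rw [mem_closedBall_iff_norm, add_sub_cancel_left]
      exact hxδ.trans ((min_le_left _ _).trans hδ₁r))
    have hGA : ∀ y, ⟪G, y⟫ = -⟪A x, y⟫ := fun y => by
      rw [hx, map_neg, hAB, inner_neg_left, neg_neg]
    rw [hGA] at hqs hqx
    have hfin := norm_sub_sq_le_of_quadratic hsym hcoer hτ0.le (min_le_left _ _)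
      (x := x) (s := s) (by
        have h1 := (abs_le.1 hqs).1
        have h2 := (abs_le.1 hqx).2
        linarith)
    have hω' : e ≤ ‖s - x‖ := by
      rw [← hsx]
      have : e ≤ dist (s + B G) 0 := hω
      rwa [dist_zero_right] at this
    have h1 : e ^ 2 ≤ ‖s - x‖ ^ 2 := by gcongr
    have h2 : τ * (2 + 3 * ‖x‖ ^ 2) ≤
        c * e ^ 2 / (8 * (2 + 3 * Kx ^ 2)) * (2 + 3 * Kx ^ 2) := by
      have : ‖x‖ ^ 2 ≤ Kx ^ 2 := by gcongr
      gcongr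
      exact min_le_right _ _
    have h3 : c * e ^ 2 / (8 * (2 + 3 * Kx ^ 2)) * (2 + 3 * Kx ^ 2) = c * e ^ 2 / 8 := by
      field_simp
    have h4 : 0 < c * e ^ 2 := by positivity
    have h5 : c / 4 * e ^ 2 ≤ c / 4 * ‖s - x‖ ^ 2 := by gcongr
    linarith
  calc P _ ≤ P ((W n ⁻¹' B₁ ∪ W n ⁻¹' B₂) ∪ (B₃ ∪ B₄)) := measure_mono hsub
    _ ≤ (P (W n ⁻¹' B₁) + P (W n ⁻¹' B₂)) + (P B₃ + P B₄) :=
        (measure_union_le _ _).trans (add_le_add (measure_union_le _ _) (measure_union_le _ _))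
    _ ≤ (ENNReal.ofReal η + ENNReal.ofReal η) + (ENNReal.ofReal η + ENNReal.ofReal η) := by
        gcongr
        · exact (hpull B₁).trans ((hN₁ n hn3).trans (ENNReal.ofReal_le_ofReal (min_le_right _ _)))
        · exact (hpull B₂).trans ((hC n K hK0).trans (ENNReal.ofReal_le_ofReal hCK))
    _ = ENNReal.ofReal (4 * η) := by
        rw [← ENNReal.ofReal_add hη0.le hη0.le, ← ENNReal.ofReal_add (by positivity)
          (by positivity)]
        congr 1
        ring
    _ ≤ η' := hηη'

end MEstimation

/-! ### The multivariate central limit theorem for triangular arrays -/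

section CLT

variable {d : ℕ} {𝒲 : Type*} [MeasurableSpace 𝒲] {ν : Measure 𝒲} [IsProbabilityMeasure ν]
  {g : 𝒲 → EuclideanSpace ℝ (Fin d)}

lemma charFun_map_normalized_sum (hgm : Measurable g) (n : ℕ) (t : EuclideanSpace ℝ (Fin d)) :
    charFun ((Measure.pi fun _ : Fin n => ν).map fun w => (√(n : ℝ))⁻¹ • ∑ i, g (w i)) t =
      charFun (ν.map fun x => ⟪g x, t⟫) (√(n : ℝ))⁻¹ ^ n := by
  have hm : Measurable fun w : Fin n → 𝒲 => (√(n : ℝ))⁻¹ • ∑ i, g (w i) := by fun_prop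
  have hm' : Measurable fun x => ⟪g x, t⟫ := hgm.inner_const
  rw [charFun_apply, integral_map hm.aemeasurable (by fun_prop), charFun_apply_real,
    integral_map hm'.aemeasurable (by fun_prop)]
  have h := integral_fintype_prod_eq_pow (ι := Fin n) (μ := ν)
    (fun x => Complex.exp ((√(n : ℝ))⁻¹ * (⟪g x, t⟫ : ℝ) * Complex.I))
  rw [Fintype.card_fin] at h
  rw [← h]
  refine integral_congr_ae (Eventually.of_forall fun w => ?_)
  simp only
  rw [← Complex.exp_sum, real_inner_smul_left, sum_inner]
  push_cast
  rw [Finset.mul_sum, Finset.sum_mul]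

lemma tendsto_charFun_normalized_sum (hgm : Measurable g) (hg : MemLp g 2 ν)
    (hg0 : ∫ w, g w ∂ν = 0) (t : EuclideanSpace ℝ (Fin d)) :
    Tendsto (fun n : ℕ => charFun (ν.map fun x => ⟪g x, t⟫) (√(n : ℝ))⁻¹ ^ n) atTop
      (𝓝 (Complex.exp (-(Var[fun x => ⟪g x, t⟫; ν] : ℂ) / 2))) := by
  set X : 𝒲 → ℝ := fun x => ⟪g x, t⟫ with hX
  have hXm : Measurable X := hgm.inner_const
  have hXL : MemLp X 2 ν := hg.inner_const t
  have hX0 : ∫ x, X x ∂ν = 0 := by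
    simp_rw [hX, real_inner_comm t]
    rw [integral_inner (hg.integrable one_le_two), hg0, inner_zero_right]
  set v := Var[X; ν] with hv
  have hXv : ∫ x, X x ^ 2 ∂ν = v := by
    rw [hv, variance_of_integral_eq_zero hXm.aemeasurable hX0]
  rcases (variance_nonneg X ν).eq_or_lt with h0 | hpos
  · have hae : X =ᵐ[ν] fun _ => 0 := by
      have := ae_eq_integral_of_variance_eq_zero hXL h0.symm
      rwa [hX0] at this
    have hcf : ∀ s : ℝ, charFun (ν.map X) s = 1 := fun s => by
      rw [Measure.map_congr hae]
      simp
    rw [hv, ← h0]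
    simp [hcf]
  · set σ := √v with hσ
    have hσ0 : 0 < σ := Real.sqrt_pos.2 hpos
    have hσ2 : σ ^ 2 = v := Real.sq_sqrt hpos.le
    have h1 := tendsto_charFun_inv_sqrt_mul_pow (P := ν) (X := fun x => σ⁻¹ * X x)
      (hXm.const_mul _).aemeasurable (by rw [integral_const_mul, hX0, mul_zero])
      (by
        simp only [Pi.pow_apply, mul_pow]
        rw [integral_const_mul, hXv, ← hσ2]
        field_simp) σ
    have h2 : ∀ s : ℝ, charFun (ν.map fun x => σ⁻¹ * X x) (s * σ) = charFun (ν.map X) s := by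
      intro s
      rw [charFun_map_mul_comp hXm.aemeasurable]
      congr 1
      field_simp
    simp_rw [h2] at h1
    have h3 : (v : ℂ) = (σ : ℂ) ^ 2 := by rw [← hσ2]; push_cast; rfl
    rwa [h3]

/-- Central limit theorem for the rows of a triangular array of i.i.d. centered vectors. -/
theorem tendstoInDistribution_normalized_sum (hgm : Measurable g) (hg : MemLp g 2 ν)
    (hg0 : ∫ w, g w ∂ν = 0) {S : Matrix (Fin d) (Fin d) ℝ} (hS : S.PosSemidef)
    (hSt : ∀ t : EuclideanSpace ℝ (Fin d), Var[fun x => ⟪g x, t⟫; ν] =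
      t.ofLp ⬝ᵥ S.mulVec t.ofLp)
    {Ω : Type*} [MeasurableSpace Ω] {P : Measure Ω} [IsProbabilityMeasure P]
    {W : (n : ℕ) → Ω → Fin n → 𝒲} (hWm : ∀ n, Measurable (W n))
    (hW : ∀ n, P.map (W n) = Measure.pi fun _ => ν) :
    TendstoInDistribution (fun (n : ℕ) ω => (√(n : ℝ))⁻¹ • ∑ i, g (W n ω i)) atTop id
      (fun _ => P) (multivariateGaussian 0 S) where
  forall_aemeasurable n := by
    have := hWm n
    have h : Measurable fun w : Fin n → 𝒲 => (√(n : ℝ))⁻¹ • ∑ i, g (w i) := by fun_prop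
    exact (h.comp this).aemeasurable
  tendsto := by
    refine ProbabilityMeasure.tendsto_iff_tendsto_charFun.2 fun t => ?_
    have h1 : ∀ n : ℕ, charFun (P.map fun ω => (√(n : ℝ))⁻¹ • ∑ i, g (W n ω i)) t =
        charFun (ν.map fun x => ⟪g x, t⟫) (√(n : ℝ))⁻¹ ^ n := fun n => by
      rw [← charFun_map_normalized_sum hgm, ← hW n, Measure.map_map (by fun_prop) (hWm n)]
      rfl
    simp only [ProbabilityMeasure.coe_mk, h1, Measure.map_id]
    rw [charFun_multivariateGaussian hS]
    have h2 := tendsto_charFun_normalized_sum hgm hg hg0 t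
    rw [hSt t] at h2
    convert h2 using 3
    simp
    ring

end CLT

/-! ### Transfer of weak limits -/

/-- Weak limits are stable under perturbations of the laws that vanish in total variation. -/
lemma tendstoInDistribution_of_measure_le_add {Ω Ω' E : Type*} [MeasurableSpace Ω]
    [MeasurableSpace Ω'] {P : Measure Ω} [IsProbabilityMeasure P] {μ : Measure Ω'}
    [IsProbabilityMeasure μ] [PseudoEMetricSpace E] [MeasurableSpace E] [BorelSpace E]
    {U V : ℕ → Ω → E} {Z : Ω' → E} (hU : TendstoInDistribution U atTop Z (fun _ => P) μ)
    (hV : ∀ n, Measurable (V n)) {ε : ℕ → ℝ≥0∞} (hε : Tendsto ε atTop (𝓝 0))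
    (h : ∀ n, ∀ G, MeasurableSet G → P (U n ⁻¹' G) ≤ P (V n ⁻¹' G) + ε n) :
    TendstoInDistribution V atTop Z (fun _ => P) μ where
  forall_aemeasurable n := (hV n).aemeasurable
  aemeasurable_limit := hU.aemeasurable_limit
  tendsto := by
    refine tendsto_of_forall_isOpen_le_liminf' fun G hG => ?_
    have h1 := ProbabilityMeasure.le_liminf_measure_open_of_tendsto hU.tendsto hG
    refine h1.trans ?_
    change liminf (fun n => (P.map (U n)) G) atTop ≤ liminf (fun n => (P.map (V n)) G) atTop
    refine le_of_le_of_eq ?_ (ENNReal.liminf_add_of_right_tendsto_zero hε _)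
    refine liminf_le_liminf (Eventually.of_forall fun n => ?_)
    rw [Pi.add_apply, Measure.map_apply_of_aemeasurable (hU.forall_aemeasurable n) hG.measurableSet,
      Measure.map_apply (hV n) hG.measurableSet]
    exact h n G hG.measurableSet

/-! ### The law of the labeled sample -/

section Labeling

variable {𝒳 𝒴 : Type*} [MeasurableSpace 𝒳] [MeasurableSpace 𝒴]

lemma labeledLaw_apply {Q : Measure (𝒳 × 𝒴)} {π : 𝒳 → ℝ}
    {S : Set ((𝒳 × 𝒴) × Bool)} (hS : MeasurableSet S) :
    labeledLaw Q π S = ∑ b : Bool, ∫⁻ z, {z | (z, b) ∈ S}.indicator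
      (fun z => ENNReal.ofReal (if b then π z.1 else 1 - π z.1)) z ∂Q := by
  have hb : ∀ b : Bool, Measurable fun z : 𝒳 × 𝒴 => (z, b) := fun b => by fun_prop
  have hSb : ∀ b : Bool, MeasurableSet {z : 𝒳 × 𝒴 | (z, b) ∈ S} := fun b => hb b hS
  rw [labeledLaw, Measure.add_apply, Measure.map_apply (hb _) hS, Measure.map_apply (hb _) hS,
    withDensity_apply _ (hb _ hS), withDensity_apply _ (hb _ hS), Fintype.sum_bool,
    lintegral_indicator (hSb _), lintegral_indicator (hSb _)]
  simp
  rfl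

lemma isProbabilityMeasure_labeledLaw {Q : Measure (𝒳 × 𝒴)} [IsProbabilityMeasure Q] {π : 𝒳 → ℝ}
    (hπm : Measurable π) (hπ0 : ∀ x, 0 ≤ π x) (hπ1 : ∀ x, π x ≤ 1) :
    IsProbabilityMeasure (labeledLaw Q π) := by
  refine ⟨?_⟩
  have hm : Measurable fun z : 𝒳 × 𝒴 => ENNReal.ofReal (π z.1) := by fun_prop
  rw [labeledLaw_apply MeasurableSet.univ, Fintype.sum_bool]
  simp only [Set.mem_univ, Set.ofPred_true, Set.indicator_univ, if_true, Bool.false_eq_true, if_false]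
  rw [← lintegral_add_left hm]
  have : ∀ z : 𝒳 × 𝒴, ENNReal.ofReal (π z.1) + ENNReal.ofReal (1 - π z.1) = 1 := fun z => by
    rw [← ENNReal.ofReal_add (hπ0 _) (by linarith [hπ1 z.1])]
    simp
  simp [this]

variable {Ω : Type*} [MeasurableSpace Ω] {P : Measure Ω}

lemma measure_labeled_eq_sum {𝒵 : Type*} [MeasurableSpace 𝒵] {n : ℕ} {Z : Ω → Fin n → 𝒵}
    (hZ : Measurable Z) {p : Ω → Fin n → ℝ} {ξ : Ω → Fin n → Bool}
    (hξ : IsBernoulliLabeling P Z p ξ) {A : Set (Fin n → 𝒵)} (hA : MeasurableSet A)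
    {S : Set (Fin n → 𝒵 × Bool)} (hS : MeasurableSet S) :
    P (Z ⁻¹' A ∩ {ω | (fun i => (Z ω i, ξ ω i)) ∈ S}) =
      ∑ b : Fin n → Bool, ∫⁻ ω in Z ⁻¹' (A ∩ {z | (fun i => (z i, b i)) ∈ S}),
        ∏ i, ENNReal.ofReal (if b i then p ω i else 1 - p ω i) ∂P := by
  have hSb : ∀ b : Fin n → Bool, MeasurableSet {z : Fin n → 𝒵 | (fun i => (z i, b i)) ∈ S} :=
    fun b => (by fun_prop : Measurable fun z : Fin n → 𝒵 => fun i => (z i, b i)) hS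
  have hset : Z ⁻¹' A ∩ {ω | (fun i => (Z ω i, ξ ω i)) ∈ S} =
      ⋃ b ∈ (Finset.univ : Finset (Fin n → Bool)),
        (Z ⁻¹' (A ∩ {z | (fun i => (z i, b i)) ∈ S}) ∩ ξ ⁻¹' {b}) := by
    ext ω
    simp only [Set.mem_inter_iff, Set.mem_preimage, Set.mem_iUnion, Finset.mem_univ,
      Set.mem_singleton_iff, exists_prop, true_and]
    constructor
    · rintro ⟨h1, h2⟩
      exact ⟨ξ ω, ⟨h1, h2⟩, rfl⟩
    · rintro ⟨b, ⟨h1, h2⟩, rfl⟩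
      exact ⟨h1, h2⟩
  rw [hset, measure_biUnion_finset]
  · exact Finset.sum_congr rfl fun b _ => hξ.2 _ (hA.inter (hSb b)) b
  · intro b _ b' _ hbb
    refine Set.disjoint_left.2 fun ω h1 h2 => hbb ?_
    exact h1.2.symm.trans h2.2
  · exact fun b _ => (hZ (hA.inter (hSb b))).inter (hξ.1 (measurableSet_singleton b))

/-- Labelings whose probabilities agree on an event of the data have the same law there. -/
lemma measure_labeled_congr {𝒵 : Type*} [MeasurableSpace 𝒵] {n : ℕ} {Z : Ω → Fin n → 𝒵}
    (hZ : Measurable Z) {p p' : Ω → Fin n → ℝ} {ξ ξ' : Ω → Fin n → Bool}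
    (hξ : IsBernoulliLabeling P Z p ξ) (hξ' : IsBernoulliLabeling P Z p' ξ')
    {A : Set (Fin n → 𝒵)} (hA : MeasurableSet A) (hp : ∀ ω, Z ω ∈ A → p ω = p' ω)
    {S : Set (Fin n → 𝒵 × Bool)} (hS : MeasurableSet S) :
    P (Z ⁻¹' A ∩ {ω | (fun i => (Z ω i, ξ ω i)) ∈ S}) =
      P (Z ⁻¹' A ∩ {ω | (fun i => (Z ω i, ξ' ω i)) ∈ S}) := by
  rw [measure_labeled_eq_sum hZ hξ hA hS, measure_labeled_eq_sum hZ hξ' hA hS]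
  refine Finset.sum_congr rfl fun b _ => ?_
  have hSb : MeasurableSet {z : Fin n → 𝒵 | (fun i => (z i, b i)) ∈ S} :=
    (by fun_prop : Measurable fun z : Fin n → 𝒵 => fun i => (z i, b i)) hS
  refine setLIntegral_congr_fun (hZ (hA.inter hSb)) fun ω hω => ?_
  simp only [hp ω hω.1]

/-- Under a fixed sampling rule the labeled sample is i.i.d. with law `labeledLaw Q π`. -/
lemma map_labeled_eq_pi {Q : Measure (𝒳 × 𝒴)} [IsProbabilityMeasure Q] {π : 𝒳 → ℝ}
    (hπm : Measurable π) (hπ0 : ∀ x, 0 ≤ π x) (hπ1 : ∀ x, π x ≤ 1) {n : ℕ}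
    {Z : Fin n → Ω → 𝒳 × 𝒴} (hZ : ∀ i, Measurable (Z i)) (hlaw : ∀ i, P.map (Z i) = Q)
    (hindep : iIndepFun Z P) {ξ : Ω → Fin n → Bool}
    (hξ : IsBernoulliLabeling P (fun ω i => Z i ω) (fun ω i => π (Z i ω).1) ξ) :
    P.map (fun ω i => (Z i ω, ξ ω i)) = Measure.pi fun _ => labeledLaw Q π := by
  have := isProbabilityMeasure_labeledLaw (Q := Q) hπm hπ0 hπ1
  have hZm : Measurable fun ω (i : Fin n) => Z i ω := measurable_pi_iff.2 hZ
  have hm : Measurable fun ω (i : Fin n) => (Z i ω, ξ ω i) :=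
    measurable_pi_iff.2 fun i => (hZ i).prodMk ((measurable_pi_apply i).comp hξ.1)
  refine (Measure.pi_eq fun s hs => ?_).symm
  have hS : MeasurableSet (Set.univ.pi s) := MeasurableSet.univ_pi hs
  rw [Measure.map_apply hm hS]
  have h1 := measure_labeled_eq_sum hZm hξ MeasurableSet.univ hS
  rw [Set.preimage_univ, Set.univ_inter] at h1
  change P {ω | (fun i => (Z i ω, ξ ω i)) ∈ Set.univ.pi s} = _
  rw [h1]
  simp_rw [labeledLaw_apply (hs _)]
  rw [Finset.prod_univ_sum, Fintype.piFinset_univ]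
  refine Finset.sum_congr rfl fun b _ => ?_
  let F : Fin n → 𝒳 × 𝒴 → ℝ≥0∞ := fun i => {z | (z, b i) ∈ s i}.indicator
    (fun z => ENNReal.ofReal (if b i then π z.1 else 1 - π z.1))
  have hsb : ∀ i, MeasurableSet {z | (z, b i) ∈ s i} := fun i =>
    (by fun_prop : Measurable fun z : 𝒳 × 𝒴 => (z, b i)) (hs i)
  have hFm : ∀ i, Measurable (F i) := fun i => by
    refine Measurable.indicator ?_ (hsb i)
    by_cases hb : b i <;> simp only [hb, if_true, Bool.false_eq_true, if_false] <;> fun_prop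
  have hSb : MeasurableSet {z : Fin n → 𝒳 × 𝒴 | (fun i => (z i, b i)) ∈ Set.univ.pi s} :=
    (by fun_prop : Measurable fun z : Fin n → 𝒳 × 𝒴 => fun i => (z i, b i)) hS
  rw [Set.univ_inter, ← lintegral_indicator (hZm hSb)]
  have hF : ∀ ω, ((fun ω i => Z i ω) ⁻¹' {z : Fin n → 𝒳 × 𝒴 |
      (fun i => (z i, b i)) ∈ Set.univ.pi s}).indicator
      (fun ω => ∏ i, ENNReal.ofReal (if b i then π (Z i ω).1 else 1 - π (Z i ω).1)) ω =
      ∏ i, F i (Z i ω) := by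
    intro ω
    by_cases h : ∀ i, (Z i ω, b i) ∈ s i
    · rw [Set.indicator_of_mem (by simpa using h)]
      refine Finset.prod_congr rfl fun i _ => ?_
      simp only [F]
      have hi : Z i ω ∈ {z | (z, b i) ∈ s i} := h i
      rw [Set.indicator_of_mem hi]
    · rw [Set.indicator_of_notMem (by simpa using h)]
      obtain ⟨i, hi⟩ := not_forall.1 h
      refine (Finset.prod_eq_zero (Finset.mem_univ i) ?_).symm
      exact Set.indicator_of_notMem (s := {z | (z, b i) ∈ s i}) hi _
  simp_rw [hF]
  rw [lintegral_prod_eq_prod_lintegral_of_indepFun Finset.univ (fun i ω => F i (Z i ω))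
    (hindep.comp F hFm) fun i => (hFm i).comp (hZ i)]
  refine Finset.prod_congr rfl fun i _ => ?_
  rw [← lintegral_map (hFm i) (hZ i), hlaw i]

end Labeling

/-! ### Second-order expansion of the population loss -/

section Expansion

variable {d : ℕ}

lemma exists_coercive_of_posDef {H : Matrix (Fin d) (Fin d) ℝ} (hH : H.PosDef) :
    ∃ c > 0, ∀ x : EuclideanSpace ℝ (Fin d),
      c * ‖x‖ ^ 2 ≤ ⟪Matrix.toEuclideanCLM (n := Fin d) (𝕜 := ℝ) H x, x⟫ := by
  set A := Matrix.toEuclideanCLM (n := Fin d) (𝕜 := ℝ) H with hA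
  have hpos : ∀ x : EuclideanSpace ℝ (Fin d), x ≠ 0 → 0 < ⟪A x, x⟫ := fun x hx => by
    rw [real_inner_comm, hA, Matrix.inner_toEuclideanCLM]
    have := hH.dotProduct_mulVec_pos (x := x.ofLp) (by simpa using hx)
    simpa using this
  have hcont : Continuous fun x : EuclideanSpace ℝ (Fin d) => ⟪A x, x⟫ := by fun_prop
  have hcpt : IsCompact (Metric.sphere (0 : EuclideanSpace ℝ (Fin d)) 1) := isCompact_sphere 0 1
  rcases (Metric.sphere (0 : EuclideanSpace ℝ (Fin d)) 1).eq_empty_or_nonempty with hem | hne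
  · refine ⟨1, one_pos, fun x => ?_⟩
    have hx : x = 0 := by
      by_contra hx
      have : (‖x‖⁻¹ • x) ∈ Metric.sphere (0 : EuclideanSpace ℝ (Fin d)) 1 := by
        simp [norm_smul, hx]
      rw [hem] at this
      exact this
    simp [hx]
  · obtain ⟨x₀, hx₀, hmin⟩ := hcpt.exists_isMinOn hne hcont.continuousOn
    have hx₀' : x₀ ≠ 0 := by
      rintro rfl
      simp at hx₀
    refine ⟨⟪A x₀, x₀⟫, hpos x₀ hx₀', fun x => ?_⟩
    rcases eq_or_ne x 0 with rfl | hx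
    · simp
    have hxn : 0 < ‖x‖ := norm_pos_iff.2 hx
    have hmem : (‖x‖⁻¹ • x) ∈ Metric.sphere (0 : EuclideanSpace ℝ (Fin d)) 1 := by
      simp [norm_smul, hx]
    have h1 : ⟪A x₀, x₀⟫ ≤ ⟪A (‖x‖⁻¹ • x), ‖x‖⁻¹ • x⟫ := hmin hmem
    rw [map_smul, real_inner_smul_left, real_inner_smul_right] at h1
    calc ⟪A x₀, x₀⟫ * ‖x‖ ^ 2 ≤ ‖x‖⁻¹ * (‖x‖⁻¹ * ⟪A x, x⟫) * ‖x‖ ^ 2 := by gcongr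
      _ = ⟪A x, x⟫ := by field_simp

lemma inner_toEuclideanCLM_symm {H : Matrix (Fin d) (Fin d) ℝ} (hH : H.IsHermitian)
    (x y : EuclideanSpace ℝ (Fin d)) :
    ⟪Matrix.toEuclideanCLM (n := Fin d) (𝕜 := ℝ) H x, y⟫ =
      ⟪x, Matrix.toEuclideanCLM (n := Fin d) (𝕜 := ℝ) H y⟫ := by
  have hT : H.transpose = H := by
    have h : H.conjTranspose = H := hH
    rwa [Matrix.conjTranspose_eq_transpose_of_trivial] at h
  rw [real_inner_comm, Matrix.inner_toEuclideanCLM, Matrix.inner_toEuclideanCLM,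
    Matrix.dotProduct_mulVec, ← Matrix.mulVec_transpose, hT, dotProduct_comm]

/-- Second-order Taylor expansion at a critical point, in Peano form. -/
lemma isLittleO_sub_quadratic_of_hasHessianAt {L : EuclideanSpace ℝ (Fin d) → ℝ}
    {H : Matrix (Fin d) (Fin d) ℝ} {θs : EuclideanSpace ℝ (Fin d)} (hL : HasHessianAt L H θs)
    (hH : H.IsHermitian) (hcrit : gradient L θs = 0) :
    (fun h => L (θs + h) - L θs -
      1 / 2 * ⟪Matrix.toEuclideanCLM (n := Fin d) (𝕜 := ℝ) H h, h⟫) =o[𝓝 0] fun h => ‖h‖ ^ 2 := by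
  obtain ⟨hdiff, hgrad⟩ := hL
  set A := Matrix.toEuclideanCLM (n := Fin d) (𝕜 := ℝ) H with hA
  rw [hasFDerivAt_iff_isLittleO_nhds_zero, hcrit] at hgrad
  simp only [sub_zero] at hgrad
  have hdiff0 : ∀ᶠ h in 𝓝 (0 : EuclideanSpace ℝ (Fin d)), DifferentiableAt ℝ L (θs + h) := by
    have ht : Tendsto (fun h : EuclideanSpace ℝ (Fin d) => θs + h) (𝓝 0) (𝓝 θs) := by
      have : Continuous fun h : EuclideanSpace ℝ (Fin d) => θs + h := by fun_prop
      simpa using this.tendsto 0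
    exact ht.eventually hdiff
  rw [Asymptotics.isLittleO_iff]
  intro ε hε
  obtain ⟨δ, hδ, hb⟩ := Metric.eventually_nhds_iff.1 (hdiff0.and (hgrad.def hε))
  refine Metric.eventually_nhds_iff.2 ⟨δ, hδ, fun {h} hh => ?_⟩
  set Φ : EuclideanSpace ℝ (Fin d) → ℝ := fun h => L (θs + h) - L θs - 1 / 2 * ⟪A h, h⟫ with hΦ
  have hball : ∀ y ∈ Metric.closedBall (0 : EuclideanSpace ℝ (Fin d)) ‖h‖, dist y 0 < δ :=
    fun y hy => lt_of_le_of_lt (Metric.mem_closedBall.1 hy) (by rwa [dist_zero_right] at hh)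
  have hder : ∀ y ∈ Metric.closedBall (0 : EuclideanSpace ℝ (Fin d)) ‖h‖,
      HasFDerivWithinAt Φ (innerSL ℝ (gradient L (θs + y) - A y))
        (Metric.closedBall 0 ‖h‖) y := by
    intro y hy
    have h1 : HasFDerivAt (fun h => L (θs + h)) (innerSL ℝ (gradient L (θs + y))) y := by
      have h2 := (hb (hball y hy)).1.hasGradientAt.hasFDerivAt
      have h3 : HasFDerivAt (fun h : EuclideanSpace ℝ (Fin d) => θs + h)
        (ContinuousLinearMap.id ℝ _) y := (hasFDerivAt_id y).const_add θs
      have h4 := h2.comp y h3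
      rw [ContinuousLinearMap.comp_id] at h4
      exact h4
    have h5 : HasFDerivAt (fun h => ⟪A h, h⟫) ((2 : ℝ) • innerSL ℝ (A y)) y := by
      have h6 := A.hasFDerivAt (x := y) |>.inner ℝ (hasFDerivAt_id y)
      refine h6.congr_fderiv ?_
      ext z
      have : ⟪A z, y⟫ = ⟪A y, z⟫ := by
        rw [inner_toEuclideanCLM_symm hH, real_inner_comm]
      simp [fderivInnerCLM_apply, this]
      ring
    refine (((h1.sub_const (L θs)).sub (h5.const_mul (1 / 2))).congr_fderiv ?_).hasFDerivWithinAt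
    rw [smul_smul, map_sub]
    norm_num
  have hbound : ∀ y ∈ Metric.closedBall (0 : EuclideanSpace ℝ (Fin d)) ‖h‖,
      ‖innerSL ℝ (gradient L (θs + y) - A y)‖ ≤ ε * ‖h‖ := by
    intro y hy
    rw [innerSL_apply_norm]
    refine (hb (hball y hy)).2.trans ?_
    gcongr
    simpa using hy
  have hmv := (convex_closedBall (0 : EuclideanSpace ℝ (Fin d))
    ‖h‖).norm_image_sub_le_of_norm_hasFDerivWithin_le hder hbound
    (Metric.mem_closedBall_self (norm_nonneg h)) (y := h) (by simp)
  have h0 : Φ 0 = 0 := by simp [hΦ]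
  rw [h0, sub_zero, sub_zero] at hmv
  refine hmv.trans (le_of_eq ?_)
  rw [Real.norm_eq_abs, abs_of_nonneg (sq_nonneg _)]
  ring

end Expansion

/-! ### Integration against the law of a labeled observation -/

section LabeledLaw

variable {𝒳 𝒴 : Type*} [MeasurableSpace 𝒳] [MeasurableSpace 𝒴] {Q : Measure (𝒳 × 𝒴)} {π : 𝒳 → ℝ}

lemma lintegral_labeledLaw (hπm : Measurable π) (F : (𝒳 × 𝒴) × Bool → ℝ≥0∞) :
    ∫⁻ w, F w ∂(labeledLaw Q π) = ∫⁻ z, ENNReal.ofReal (π z.1) * F (z, true) ∂Q +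
      ∫⁻ z, ENNReal.ofReal (1 - π z.1) * F (z, false) ∂Q := by
  rw [labeledLaw, lintegral_add_measure, (measurableEmbedding_prod_mk_right (_ : Bool)).lintegral_map,
    (measurableEmbedding_prod_mk_right (_ : Bool)).lintegral_map,
    lintegral_withDensity_eq_lintegral_mul_non_measurable _ (by fun_prop)
      (Eventually.of_forall fun _ => ENNReal.ofReal_lt_top),
    lintegral_withDensity_eq_lintegral_mul_non_measurable _ (by fun_prop)
      (Eventually.of_forall fun _ => ENNReal.ofReal_lt_top)]
  rfl

lemma integral_labeledLaw (hπm : Measurable π) (hπ0 : ∀ x, 0 ≤ π x) (hπ1 : ∀ x, π x ≤ 1)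
    {F : (𝒳 × 𝒴) × Bool → ℝ} (hF : Integrable F (labeledLaw Q π)) :
    ∫ w, F w ∂(labeledLaw Q π) =
      ∫ z, (π z.1 * F (z, true) + (1 - π z.1) * F (z, false)) ∂Q := by
  have hm1 : Measurable fun z : 𝒳 × 𝒴 => ENNReal.ofReal (π z.1) := by fun_prop
  have hm2 : Measurable fun z : 𝒳 × 𝒴 => ENNReal.ofReal (1 - π z.1) := by fun_prop
  have hlt : ∀ p : 𝒳 × 𝒴 → ℝ, ∀ᵐ z ∂Q, ENNReal.ofReal (p z) < ⊤ := fun p =>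
    Eventually.of_forall fun _ => ENNReal.ofReal_lt_top
  rw [labeledLaw, integrable_add_measure, (measurableEmbedding_prod_mk_right (_ : Bool)).integrable_map_iff,
    (measurableEmbedding_prod_mk_right (_ : Bool)).integrable_map_iff,
    integrable_withDensity_iff_integrable_smul' hm1 (hlt _),
    integrable_withDensity_iff_integrable_smul' hm2 (hlt _)] at hF
  have hF' := hF
  rw [← integrable_withDensity_iff_integrable_smul' hm1 (hlt _),
    ← integrable_withDensity_iff_integrable_smul' hm2 (hlt _),
    ← (measurableEmbedding_prod_mk_right (_ : Bool)).integrable_map_iff,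
    ← (measurableEmbedding_prod_mk_right (_ : Bool)).integrable_map_iff] at hF'
  have h1 : ∀ z : 𝒳 × 𝒴, 0 ≤ 1 - π z.1 := fun z => by linarith [hπ1 z.1]
  simp only [Function.comp_apply, ENNReal.toReal_ofReal (hπ0 _), ENNReal.toReal_ofReal (h1 _),
    smul_eq_mul] at hF
  rw [labeledLaw, integral_add_measure hF'.1 hF'.2, (measurableEmbedding_prod_mk_right (_ : Bool)).integral_map,
    (measurableEmbedding_prod_mk_right (_ : Bool)).integral_map,
    integral_withDensity_eq_integral_toReal_smul hm1 (hlt _),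
    integral_withDensity_eq_integral_toReal_smul hm2 (hlt _), integral_add hF.1 hF.2]
  simp only [ENNReal.toReal_ofReal (hπ0 _), ENNReal.toReal_ofReal (h1 _), smul_eq_mul]

lemma measurePreserving_fst_labeledLaw (hπm : Measurable π) (hπ0 : ∀ x, 0 ≤ π x)
    (hπ1 : ∀ x, π x ≤ 1) : MeasurePreserving Prod.fst (labeledLaw Q π) Q := by
  refine ⟨measurable_fst, Measure.ext fun s hs => ?_⟩
  have hm1 : Measurable fun z : 𝒳 × 𝒴 => ENNReal.ofReal (π z.1) := by fun_prop
  rw [Measure.map_apply measurable_fst hs, labeledLaw_apply (measurable_fst hs), Fintype.sum_bool]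
  have hset : ∀ b : Bool, {z : 𝒳 × 𝒴 | (z, b) ∈ Prod.fst ⁻¹' s} = s := fun b => rfl
  rw [hset, hset, lintegral_indicator hs, lintegral_indicator hs]
  simp only [if_true, Bool.false_eq_true, if_false]
  rw [← lintegral_add_left hm1]
  have : ∀ z : 𝒳 × 𝒴, ENNReal.ofReal (π z.1) + ENNReal.ofReal (1 - π z.1) = 1 := fun z => by
    rw [← ENNReal.ofReal_add (hπ0 _) (by linarith [hπ1 z.1])]
    simp
  simp [this]

end LabeledLaw

/-! ### The inverse-propensity weighted loss -/

section IPW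

variable {𝒳 𝒴 : Type*} {d : ℕ} {ℓ : EuclideanSpace ℝ (Fin d) → 𝒳 → 𝒴 → ℝ} {f : 𝒳 → 𝒴}
  {π : 𝒳 → ℝ} {θs : EuclideanSpace ℝ (Fin d)}

lemma hasGradientAt_ipwLoss (hd : ∀ x y, DifferentiableAt ℝ (fun θ => ℓ θ x y) θs)
    (w : (𝒳 × 𝒴) × Bool) :
    HasGradientAt (fun θ => ipwLoss ℓ f π θ w) (ipwGrad ℓ f π θs w) θs := by
  have h1 := (hd w.1.1 (f w.1.1)).hasGradientAt.hasFDerivAt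
  have h2 := (hd w.1.1 w.1.2).hasGradientAt.hasFDerivAt
  rw [hasGradientAt_iff_hasFDerivAt]
  refine (h1.add ((h2.sub h1).mul_const (labelInd w.2 / π w.1.1))).congr_fderiv ?_
  simp [ipwGrad]

/-- A Lipschitz constant in `θ` of the inverse-propensity weighted loss, if `Cf` is one of the loss
on predicted labels and `D` one of the loss difference. -/
noncomputable def ipwLip (π : 𝒳 → ℝ) (Cf : 𝒳 → ℝ) (D : 𝒳 → 𝒴 → ℝ) (w : (𝒳 × 𝒴) × Bool) : ℝ :=
  |Cf w.1.1| + |D w.1.1 w.1.2| * (labelInd w.2 / π w.1.1)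

lemma labelInd_nonneg (b : Bool) : 0 ≤ labelInd b := by cases b <;> simp [labelInd]

lemma abs_ipwLoss_sub_le (hπ0 : ∀ x, 0 ≤ π x) {Cf : 𝒳 → ℝ} {D : 𝒳 → 𝒴 → ℝ}
    {θ θ' : EuclideanSpace ℝ (Fin d)}
    (hCf : ∀ x, |ℓ θ x (f x) - ℓ θ' x (f x)| ≤ Cf x * ‖θ - θ'‖)
    (hD : ∀ x y, |(ℓ θ x y - ℓ θ x (f x)) - (ℓ θ' x y - ℓ θ' x (f x))| ≤ D x y * ‖θ - θ'‖)
    (w : (𝒳 × 𝒴) × Bool) :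
    |ipwLoss ℓ f π θ w - ipwLoss ℓ f π θ' w| ≤ ipwLip π Cf D w * ‖θ - θ'‖ := by
  have hc : 0 ≤ labelInd w.2 / π w.1.1 := div_nonneg (labelInd_nonneg _) (hπ0 _)
  have h1 := hCf w.1.1
  have h2 := hD w.1.1 w.1.2
  have h3 : Cf w.1.1 * ‖θ - θ'‖ ≤ |Cf w.1.1| * ‖θ - θ'‖ := by gcongr; exact le_abs_self _
  have h4 : D w.1.1 w.1.2 * ‖θ - θ'‖ ≤ |D w.1.1 w.1.2| * ‖θ - θ'‖ := by
    gcongr; exact le_abs_self _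
  rw [show ipwLoss ℓ f π θ w - ipwLoss ℓ f π θ' w =
    (ℓ θ w.1.1 (f w.1.1) - ℓ θ' w.1.1 (f w.1.1)) +
      ((ℓ θ w.1.1 w.1.2 - ℓ θ w.1.1 (f w.1.1)) - (ℓ θ' w.1.1 w.1.2 - ℓ θ' w.1.1 (f w.1.1))) *
        (labelInd w.2 / π w.1.1) by simp only [ipwLoss]; ring]
  refine (abs_add_le _ _).trans ?_
  rw [abs_mul, abs_of_nonneg hc, ipwLip, add_mul]
  refine add_le_add (h1.trans h3) ?_
  calc _ ≤ |D w.1.1 w.1.2| * ‖θ - θ'‖ * (labelInd w.2 / π w.1.1) := by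
        gcongr
        exact h2.trans h4
    _ = _ := by ring

variable [MeasurableSpace 𝒳] [MeasurableSpace 𝒴] {Q : Measure (𝒳 × 𝒴)}

lemma measurable_labelInd : Measurable labelInd := measurable_from_top

lemma measurable_ipwLoss (hf : Measurable f) (hπm : Measurable π)
    {θ : EuclideanSpace ℝ (Fin d)} (hm : Measurable fun z : 𝒳 × 𝒴 => ℓ θ z.1 z.2) :
    Measurable (ipwLoss ℓ f π θ) := by
  have h1 : Measurable fun w : (𝒳 × 𝒴) × Bool => ℓ θ w.1.1 w.1.2 := hm.comp measurable_fst
  have h2 : Measurable fun w : (𝒳 × 𝒴) × Bool => ℓ θ w.1.1 (f w.1.1) :=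
    hm.comp (g := fun z : 𝒳 × 𝒴 => ℓ θ z.1 z.2)
      (f := fun w : (𝒳 × 𝒴) × Bool => (w.1.1, f w.1.1)) (by fun_prop)
  have h3 := measurable_labelInd
  unfold ipwLoss
  fun_prop

/-- The label indicator contributes a factor `π / π²`, so that `E[(D ξ / π)²] ≤ E[D² / π]`. -/
lemma memLp_ipwLip (hπm : Measurable π) (hπ0 : ∀ x, 0 ≤ π x) (hπ1 : ∀ x, π x ≤ 1)
    {Cf : 𝒳 → ℝ} {D : 𝒳 → 𝒴 → ℝ} (hCf : MemLp (fun z : 𝒳 × 𝒴 => Cf z.1) 2 Q)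
    (hDm : AEMeasurable (fun z : 𝒳 × 𝒴 => D z.1 z.2) Q)
    (hD : ∫⁻ z, ENNReal.ofReal (D z.1 z.2 ^ 2) / ENNReal.ofReal (π z.1) ∂Q < ⊤) :
    MemLp (ipwLip π Cf D) 2 (labeledLaw Q π) := by
  have hfst := measurePreserving_fst_labeledLaw (Q := Q) hπm hπ0 hπ1
  have h1 : MemLp (fun w : (𝒳 × 𝒴) × Bool => |Cf w.1.1|) 2 (labeledLaw Q π) :=
    (hCf.comp_measurePreserving hfst).abs
  have hDm' : AEMeasurable (fun w : (𝒳 × 𝒴) × Bool => D w.1.1 w.1.2) (labeledLaw Q π) :=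
    hDm.comp_quasiMeasurePreserving hfst.quasiMeasurePreserving
  have h3 : Measurable fun w : (𝒳 × 𝒴) × Bool => labelInd w.2 / π w.1.1 := by
    have := measurable_labelInd
    fun_prop
  refine h1.add (g := fun w : (𝒳 × 𝒴) × Bool => |D w.1.1 w.1.2| * (labelInd w.2 / π w.1.1)) ?_
  have hm : AEStronglyMeasurable
      (fun w : (𝒳 × 𝒴) × Bool => |D w.1.1 w.1.2| * (labelInd w.2 / π w.1.1)) (labeledLaw Q π) := by
    have hDa : AEMeasurable (fun w : (𝒳 × 𝒴) × Bool => |D w.1.1 w.1.2|) (labeledLaw Q π) :=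
      measurable_abs.comp_aemeasurable hDm'
    exact (hDa.mul h3.aemeasurable).aestronglyMeasurable
  rw [memLp_two_iff_integrable_sq hm]
  refine ⟨hm.pow 2, ?_⟩
  rw [hasFiniteIntegral_iff_ofReal (Eventually.of_forall fun w => sq_nonneg _),
    lintegral_labeledLaw hπm]
  have hz : ∀ z : 𝒳 × 𝒴, ENNReal.ofReal (1 - π z.1) *
      ENNReal.ofReal ((|D z.1 z.2| * (labelInd false / π z.1)) ^ 2) = 0 := fun z => by
    simp [labelInd]
  simp only [hz, lintegral_zero, add_zero]
  refine lt_of_le_of_lt (lintegral_mono fun z => ?_) hD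
  rcases (hπ0 z.1).eq_or_lt with h0 | hpos
  · rw [← h0]
    simp
  · rw [← ENNReal.ofReal_mul (hπ0 _), ← ENNReal.ofReal_div_of_pos hpos]
    refine ENNReal.ofReal_le_ofReal (le_of_eq ?_)
    rw [mul_pow, sq_abs, labelInd, if_pos rfl]
    field_simp

/-- Inverse-propensity weighting is unbiased for the loss increments: where `π` vanishes, so does
almost surely the Lipschitz constant `D` of the loss difference. -/
lemma integral_ipwLoss_sub (hπm : Measurable π) (hπ0 : ∀ x, 0 ≤ π x) (hπ1 : ∀ x, π x ≤ 1)
    {D : 𝒳 → 𝒴 → ℝ} (hDm : AEMeasurable (fun z : 𝒳 × 𝒴 => D z.1 z.2) Q)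
    (hD : ∫⁻ z, ENNReal.ofReal (D z.1 z.2 ^ 2) / ENNReal.ofReal (π z.1) ∂Q < ⊤)
    {θ θ' : EuclideanSpace ℝ (Fin d)}
    (hDl : ∀ x y, |(ℓ θ x y - ℓ θ x (f x)) - (ℓ θ' x y - ℓ θ' x (f x))| ≤ D x y * ‖θ - θ'‖)
    (hi : Integrable (fun z : 𝒳 × 𝒴 => ℓ θ z.1 z.2) Q)
    (hi' : Integrable (fun z : 𝒳 × 𝒴 => ℓ θ' z.1 z.2) Q)
    (hint : Integrable (fun w => ipwLoss ℓ f π θ w - ipwLoss ℓ f π θ' w) (labeledLaw Q π)) :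
    ∫ w, (ipwLoss ℓ f π θ w - ipwLoss ℓ f π θ' w) ∂(labeledLaw Q π) =
      popLoss ℓ Q θ - popLoss ℓ Q θ' := by
  rw [integral_labeledLaw hπm hπ0 hπ1 hint, popLoss, popLoss, ← integral_sub hi hi']
  have hfin := ae_lt_top' (by fun_prop : AEMeasurable (fun z : 𝒳 × 𝒴 =>
    ENNReal.ofReal (D z.1 z.2 ^ 2) / ENNReal.ofReal (π z.1)) Q) hD.ne
  refine integral_congr_ae ?_
  filter_upwards [hfin] with z hz
  simp only [ipwLoss, labelInd, if_true, Bool.false_eq_true, if_false]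
  rcases eq_or_ne (π z.1) 0 with h0 | hne
  · have hD0 : D z.1 z.2 = 0 := by
      by_contra hne
      rw [h0, ENNReal.ofReal_zero, ENNReal.div_zero] at hz
      · exact lt_irrefl _ hz
      · exact (ENNReal.ofReal_pos.2 (by positivity)).ne'
    have h1 := hDl z.1 z.2
    rw [hD0, zero_mul] at h1
    have h2 := abs_nonpos_iff.1 h1
    rw [h0]
    simp only [div_zero, mul_zero, add_zero, zero_mul, sub_zero, one_mul, zero_add]
    linarith
  · field_simp
    ring

end IPW

/-! ### Covariance of the gradient increment -/

section Covariance

variable {d : ℕ} {𝒲 : Type*} [MeasurableSpace 𝒲] {ν : Measure 𝒲} [IsProbabilityMeasure ν]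
  {g : 𝒲 → EuclideanSpace ℝ (Fin d)}

lemma variance_inner_eq (hg : MemLp g 2 ν) (t : EuclideanSpace ℝ (Fin d)) :
    Var[fun w => ⟪g w, t⟫; ν] = t.ofLp ⬝ᵥ
      (Matrix.of fun i j => cov[fun w => g w i, fun w => g w j; ν]).mulVec t.ofLp := by
  have hcL : ∀ j, MemLp (fun w => g w j) 2 ν := fun j =>
    (EuclideanSpace.proj (𝕜 := ℝ) j).comp_memLp' hg
  have h1 : (fun w => ⟪g w, t⟫) = fun w => ∑ i, t i * g w i := by
    funext w
    simp [PiLp.inner_apply]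
  rw [h1, variance_fun_sum (X := fun i w => t i * g w i) fun i => (hcL i).const_mul (t i)]
  simp only [dotProduct, Matrix.mulVec, Matrix.of_apply, Finset.mul_sum]
  refine Finset.sum_congr rfl fun i _ => Finset.sum_congr rfl fun j _ => ?_
  rw [covariance_const_mul_left, covariance_const_mul_right]
  ring

lemma posSemidef_covariance (hg : MemLp g 2 ν) :
    (Matrix.of fun i j => cov[fun w => g w i, fun w => g w j; ν]).PosSemidef := by
  refine Matrix.PosSemidef.of_dotProduct_mulVec_nonneg ?_ fun x => ?_
  · ext i j
    simp [covariance_comm]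
  · have := variance_inner_eq hg (WithLp.toLp 2 x)
    simp only [star_trivial]
    rw [← this]
    exact variance_nonneg _ _

lemma posSemidef_sandwich {H Γ : Matrix (Fin d) (Fin d) ℝ} (hH : H.PosDef) (hΓ : Γ.PosSemidef) :
    (H⁻¹ * Γ * H⁻¹).PosSemidef := by
  have h := hΓ.mul_mul_conjTranspose_same H⁻¹
  rwa [hH.inv.isHermitian.eq] at h

/-- The covariance of `-H⁻¹ g` is the sandwich matrix. -/
lemma variance_inner_neg_inv (hg : MemLp g 2 ν) {H : Matrix (Fin d) (Fin d) ℝ} (hH : H.PosDef)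
    (t : EuclideanSpace ℝ (Fin d)) :
    Var[fun w => ⟪-Matrix.toEuclideanCLM (n := Fin d) (𝕜 := ℝ) H⁻¹ (g w), t⟫; ν] =
      t.ofLp ⬝ᵥ (H⁻¹ * (Matrix.of fun i j => cov[fun w => g w i, fun w => g w j; ν]) *
        H⁻¹).mulVec t.ofLp := by
  have hHi := hH.inv.isHermitian
  have hT : H⁻¹.transpose = H⁻¹ := by
    have h : H⁻¹.conjTranspose = H⁻¹ := hHi
    rwa [Matrix.conjTranspose_eq_transpose_of_trivial] at h
  simp_rw [inner_neg_left, inner_toEuclideanCLM_symm hHi]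
  rw [variance_fun_neg, variance_inner_eq hg, Matrix.ofLp_toEuclideanCLM, ← Matrix.mulVec_mulVec,
    ← Matrix.mulVec_mulVec, Matrix.dotProduct_mulVec t.ofLp H⁻¹, ← Matrix.mulVec_transpose, hT]

end Covariance

/-! ### Quantiles and central intervals of the standard normal law -/

lemma continuous_cdf_stdNormal : Continuous (cdf (gaussianReal 0 1)) := by
  refine continuous_iff_continuousAt.2 fun x => ?_
  rw [(cdf (gaussianReal 0 1)).mono.continuousAt_iff_leftLim_eq_rightLim,
    StieltjesFunction.rightLim_eq, ← sub_eq_zero, ← neg_sub, neg_eq_zero]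
  refine le_antisymm ?_ (sub_nonneg.2 ((cdf (gaussianReal 0 1)).mono.leftLim_le le_rfl))
  have h := (cdf (gaussianReal 0 1)).measure_singleton x
  have := nullSingletonClass_gaussianReal (μ := 0) (v := 1) one_ne_zero
  rw [measure_cdf, measure_singleton] at h
  exact ENNReal.ofReal_eq_zero.1 h.symm

lemma cdf_stdNormal_neg (x : ℝ) :
    cdf (gaussianReal 0 1) (-x) = 1 - cdf (gaussianReal 0 1) x := by
  have := nullSingletonClass_gaussianReal (μ := 0) (v := 1) one_ne_zero
  have h : (gaussianReal 0 1).real (Set.Iic (-x)) = (gaussianReal 0 1).real (Set.Ici x) := by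
    have hm : (gaussianReal 0 1).map (fun y => -y) = gaussianReal 0 1 := by
      rw [gaussianReal_map_neg, neg_zero]
    conv_lhs => rw [← hm]
    rw [map_measureReal_apply (by fun_prop) measurableSet_Iic]
    congr 1
    ext y
    simp
  rw [cdf_eq_real, cdf_eq_real, h, ← probReal_compl_eq_one_sub measurableSet_Iic, Set.compl_Iic]
  exact measureReal_congr Ioi_ae_eq_Ici.symm

lemma stdNormal_real_abs_le {x : ℝ} (hx : 0 ≤ x) :
    (gaussianReal 0 1).real {y | |y| ≤ x} = 2 * cdf (gaussianReal 0 1) x - 1 := by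
  have := nullSingletonClass_gaussianReal (μ := 0) (v := 1) one_ne_zero
  have h1 : {y : ℝ | |y| ≤ x} = Set.Icc (-x) x := by
    ext y
    simp [abs_le]
  have h2 : Set.Iic x \ Set.Iic (-x) = Set.Ioc (-x) x := by
    ext y
    simp [and_comm]
  have h3 := measureReal_sdiff (μ := gaussianReal 0 1)
    (Set.Iic_subset_Iic.2 (by linarith : -x ≤ x)) measurableSet_Iic
  rw [h1, ← measureReal_congr Ioc_ae_eq_Icc, ← h2, h3, ← cdf_eq_real, ← cdf_eq_real,
    cdf_stdNormal_neg]
  ring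

lemma cdf_stdNormalQuantile {q : ℝ} (hq : q ∈ Set.Ioo (0 : ℝ) 1) :
    cdf (gaussianReal 0 1) (stdNormalQuantile q) = q := by
  set F := cdf (gaussianReal 0 1) with hF
  have hne : {x | q ≤ F x}.Nonempty :=
    ((tendsto_cdf_atTop (gaussianReal 0 1)).eventually (eventually_ge_nhds hq.2)).exists
  obtain ⟨b, hb⟩ :=
    ((tendsto_cdf_atBot (gaussianReal 0 1)).eventually (eventually_lt_nhds hq.1)).exists
  have hbdd : BddBelow {x | q ≤ F x} := ⟨b, fun x hx => by
    by_contra hlt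
    exact absurd (hx.trans (F.mono (not_le.1 hlt).le)) (not_le.2 hb)⟩
  have hcl : IsClosed {x | q ≤ F x} := isClosed_le continuous_const continuous_cdf_stdNormal
  refine le_antisymm ?_ (hcl.csInf_mem hne hbdd)
  by_contra! hlt
  have h1 : ∀ᶠ y in 𝓝[<] stdNormalQuantile q, q < F y :=
    (continuous_cdf_stdNormal.continuousAt.eventually (lt_mem_nhds hlt)).filter_mono
      nhdsWithin_le_nhds
  obtain ⟨y, hy, hyz⟩ := (h1.and self_mem_nhdsWithin).exists
  exact absurd (csInf_le hbdd hy.le) (not_le.2 hyz)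

lemma stdNormalQuantile_pos {α : ℝ} (hα : α ∈ Set.Ioo (0 : ℝ) 1) :
    0 < stdNormalQuantile (1 - α / 2) := by
  have h := cdf_stdNormalQuantile (q := 1 - α / 2) ⟨by linarith [hα.2], by linarith [hα.1]⟩
  have h0 := cdf_stdNormal_neg 0
  rw [neg_zero] at h0
  by_contra! hle
  have := (cdf (gaussianReal 0 1)).mono hle
  linarith [hα.2]

lemma stdNormal_real_abs_le_quantile {α : ℝ} (hα : α ∈ Set.Ioo (0 : ℝ) 1) :
    (gaussianReal 0 1).real {y | |y| ≤ stdNormalQuantile (1 - α / 2)} = 1 - α := by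
  rw [stdNormal_real_abs_le (stdNormalQuantile_pos hα).le,
    cdf_stdNormalQuantile ⟨by linarith [hα.2], by linarith [hα.1]⟩]
  ring

/-! ### Confidence intervals -/

section Interval

variable {Ω Ω' : Type*} [MeasurableSpace Ω] [MeasurableSpace Ω'] {P : Measure Ω}
  [IsProbabilityMeasure P] {μ : Measure Ω'} [IsProbabilityMeasure μ]

lemma tendsto_measureReal_abs_le {U : ℕ → Ω → ℝ} {Z : Ω' → ℝ}
    (hU : TendstoInDistribution U atTop Z (fun _ => P) μ)
    (hZ : μ.map Z = gaussianReal 0 1) (c : ℝ) :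
    Tendsto (fun n => P.real {ω | |U n ω| ≤ c}) atTop
      (𝓝 ((gaussianReal 0 1).real {y | |y| ≤ c})) := by
  have := nullSingletonClass_gaussianReal (μ := 0) (v := 1) one_ne_zero
  have h1 : {y : ℝ | |y| ≤ c} = Set.Icc (-c) c := by
    ext y
    simp [abs_le]
  have hfr : (μ.map Z) (frontier {y : ℝ | |y| ≤ c}) = 0 := by
    rw [hZ, h1]
    rcases le_total (-c) c with hc | hc
    · rw [frontier_Icc hc]
      exact (Set.toFinite _).measure_zero _
    · refine measure_mono_null frontier_subset_closure ?_
      rw [closure_Icc]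
      exact measure_mono_null (fun y hy => le_antisymm (hy.2.trans hc) hy.1)
        (measure_singleton (-c))
  have h2 := ProbabilityMeasure.tendsto_measure_of_null_frontier_of_tendsto' hU.tendsto hfr
  simp only [ProbabilityMeasure.coe_mk, hZ] at h2
  have h3 := (ENNReal.tendsto_toReal (measure_ne_top _ _)).comp h2
  refine h3.congr fun n => ?_
  have hm : MeasurableSet {y : ℝ | |y| ≤ c} := by rw [h1]; exact measurableSet_Icc
  simp only [Function.comp_apply]
  rw [Measure.map_apply_of_aemeasurable (hU.forall_aemeasurable n) hm]
  rfl

/-- A threshold `ρ n` that converges in probability may replace its limit; it need not be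
measurable, the events being sandwiched up to outer measure. -/
lemma tendsto_measureReal_abs_le_of_tendstoInMeasure {U : ℕ → Ω → ℝ} {Z : Ω' → ℝ}
    (hU : TendstoInDistribution U atTop Z (fun _ => P) μ)
    (hZ : μ.map Z = gaussianReal 0 1) {ρ : ℕ → Ω → ℝ} {c : ℝ} (hc : 0 < c)
    (hρ : ∀ δ > 0, Tendsto (fun n => P.real {ω | δ ≤ |ρ n ω - c|}) atTop (𝓝 0)) :
    Tendsto (fun n => P.real {ω | |U n ω| ≤ ρ n ω}) atTop
      (𝓝 ((gaussianReal 0 1).real {y | |y| ≤ c})) := by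
  set G : ℝ → ℝ := fun x => (gaussianReal 0 1).real {y | |y| ≤ x} with hG
  have hGc : ContinuousAt G c := by
    have h : G =ᶠ[𝓝 c] fun x => 2 * cdf (gaussianReal 0 1) x - 1 := by
      filter_upwards [lt_mem_nhds hc] with x hx using stdNormal_real_abs_le hx.le
    have h' := continuous_cdf_stdNormal
    exact ContinuousAt.congr (by fun_prop) h.symm
  rw [Metric.tendsto_nhds]
  intro ε hε
  obtain ⟨δ, hδ, hGδ⟩ := Metric.continuousAt_iff.1 hGc (ε / 3) (by linarith)
  have hp := hGδ (x := c + δ / 2) (by rw [Real.dist_eq, add_sub_cancel_left, abs_of_pos] <;> linarith)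
  have hm := hGδ (x := c - δ / 2) (by
    rw [Real.dist_eq, sub_sub_cancel_left, abs_neg, abs_of_pos] <;> linarith)
  have h1 := Metric.tendsto_nhds.1 (tendsto_measureReal_abs_le hU hZ (c + δ / 2)) (ε / 3)
    (by linarith)
  have h2 := Metric.tendsto_nhds.1 (tendsto_measureReal_abs_le hU hZ (c - δ / 2)) (ε / 3)
    (by linarith)
  have h3 := Metric.tendsto_nhds.1 (hρ (δ / 2) (by linarith)) (ε / 3) (by linarith)
  filter_upwards [h1, h2, h3] with n h1 h2 h3
  have hup : P.real {ω | |U n ω| ≤ ρ n ω} ≤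
      P.real {ω | |U n ω| ≤ c + δ / 2} + P.real {ω | δ / 2 ≤ |ρ n ω - c|} := by
    refine (measureReal_mono fun ω hω => ?_).trans (measureReal_union_le _ _)
    by_cases h : δ / 2 ≤ |ρ n ω - c|
    · exact Or.inr h
    · refine Or.inl (show |U n ω| ≤ c + δ / 2 from ?_)
      have hω' : |U n ω| ≤ ρ n ω := hω
      linarith [(abs_lt.1 (not_le.1 h)).2]
  have hlow : P.real {ω | |U n ω| ≤ c - δ / 2} ≤
      P.real {ω | |U n ω| ≤ ρ n ω} + P.real {ω | δ / 2 ≤ |ρ n ω - c|} := by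
    refine (measureReal_mono fun ω hω => ?_).trans (measureReal_union_le _ _)
    by_cases h : δ / 2 ≤ |ρ n ω - c|
    · exact Or.inr h
    · refine Or.inl (show |U n ω| ≤ ρ n ω from ?_)
      have hω' : |U n ω| ≤ c - δ / 2 := hω
      linarith [(abs_lt.1 (not_le.1 h)).1]
  rw [Real.dist_eq, abs_lt] at h1 h2 h3 hp hm ⊢
  simp only [hG] at hp hm
  constructor <;> linarith [h1.1, h1.2, h2.1, h2.2, h3.1, h3.2, hp.1, hp.2, hm.1, hm.2]

/-- Asymptotic coverage of the Wald interval for a coordinate of an asymptotically normal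
estimator. -/
theorem tendsto_measureReal_mem_interval {d : ℕ} {S : Matrix (Fin d) (Fin d) ℝ}
    (hS : S.PosSemidef) {T : ℕ → Ω → EuclideanSpace ℝ (Fin d)} {θs : EuclideanSpace ℝ (Fin d)}
    (hT : TendstoInDistribution (fun (n : ℕ) ω => √(n : ℝ) • (T n ω - θs)) atTop id (fun _ => P)
      (multivariateGaussian 0 S)) {j : Fin d} (hj : 0 < S j j) {s : ℕ → Ω → ℝ}
    (hs : TendstoInMeasure P s atTop fun _ => S j j) {α : ℝ} (hα : α ∈ Set.Ioo (0 : ℝ) 1) :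
    Tendsto (fun n : ℕ => P.real {ω | θs j ∈ Set.Icc
      (T n ω j - stdNormalQuantile (1 - α / 2) * √(s n ω / n))
      (T n ω j + stdNormalQuantile (1 - α / 2) * √(s n ω / n))}) atTop (𝓝 (1 - α)) := by
  set z := stdNormalQuantile (1 - α / 2) with hz
  have hz0 : 0 < z := stdNormalQuantile_pos hα
  set σ := √(S j j) with hσ
  have hσ0 : 0 < σ := Real.sqrt_pos.2 hj
  have hU := hT.continuous_comp (g := fun x : EuclideanSpace ℝ (Fin d) => x j / σ) (by fun_prop)
  have hZ : (multivariateGaussian 0 S).map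
      ((fun x : EuclideanSpace ℝ (Fin d) => x j / σ) ∘ id) = gaussianReal 0 1 := by
    have h := measurePreserving_eval_multivariateGaussian (μ := 0) hS (i := j)
    have h2 : (fun x : EuclideanSpace ℝ (Fin d) => x j / σ) ∘ id = (fun y : ℝ => y / σ) ∘
      fun x : EuclideanSpace ℝ (Fin d) => x j := rfl
    rw [h2, ← Measure.map_map (by fun_prop) h.measurable, h.map_eq, gaussianReal_map_div_const]
    congr 1
    · simp
    · ext
      simp [hσ, Real.sq_sqrt hj.le, hj.le, hj.ne']
  have hρ : ∀ δ > 0, Tendsto (fun n => P.real {ω | δ ≤ |z * (√(s n ω) / σ) - z|}) atTop (𝓝 0) := by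
    intro δ hδ
    have hcont : ContinuousAt (fun x : ℝ => z * (√x / σ)) (S j j) := by fun_prop
    obtain ⟨κ, hκ, hκδ⟩ := Metric.continuousAt_iff.1 hcont δ hδ
    refine squeeze_zero (fun n => measureReal_nonneg) (fun n => measureReal_mono fun ω hω => ?_)
      (tendstoInMeasure_iff_measureReal_dist.1 hs κ hκ)
    by_contra hlt
    have h := hκδ (not_le.1 hlt)
    rw [Real.dist_eq, ← hσ, div_self hσ0.ne', mul_one] at h
    exact absurd hω (not_le.2 h)
  have h := tendsto_measureReal_abs_le_of_tendstoInMeasure hU hZ hz0 hρ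
  rw [hz, stdNormal_real_abs_le_quantile hα] at h
  refine h.congr' ?_
  filter_upwards [eventually_gt_atTop 0] with n hn
  have hn0 : 0 < √(n : ℝ) := Real.sqrt_pos.2 (by exact_mod_cast hn)
  congr 1
  ext ω
  simp only [Set.mem_ofPred_eq, Function.comp_apply, PiLp.smul_apply, PiLp.sub_apply, smul_eq_mul,
    ← hz]
  rw [abs_div, abs_of_pos hσ0, abs_mul, abs_of_pos hn0, Real.sqrt_div' _ (Nat.cast_nonneg n),
    ← mul_div_assoc, div_le_div_iff_of_pos_right hσ0, ← le_div_iff₀' hn0, mul_div_assoc, abs_le,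
    Set.mem_Icc]
  constructor <;> rintro ⟨h1, h2⟩ <;> constructor <;> linarith

end Interval

/-! ### Asymptotic normality of M-estimators -/

/-- Asymptotic normality of M-estimators under a Lipschitz condition, for triangular arrays. The
sandwich matrix is positive semidefinite, so that the Gaussian law is not a junk value. -/
theorem tendstoInDistribution_argmin {d : ℕ} {𝒲 : Type*} [MeasurableSpace 𝒲] {ν : Measure 𝒲}
    [IsProbabilityMeasure ν] {m : EuclideanSpace ℝ (Fin d) → 𝒲 → ℝ} {M : 𝒲 → ℝ}
    {g : 𝒲 → EuclideanSpace ℝ (Fin d)} {θs : EuclideanSpace ℝ (Fin d)} {r : ℝ}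
    {Ω : Type*} [MeasurableSpace Ω] {P : Measure Ω} [IsProbabilityMeasure P]
    (hr : 0 < r) (hm : ∀ θ ∈ Metric.closedBall θs r, Measurable (m θ)) (hM : MemLp M 2 ν)
    (hlip : ∀ᵐ w ∂ν, ∀ θ ∈ Metric.closedBall θs r, ∀ θ' ∈ Metric.closedBall θs r,
      |m θ w - m θ' w| ≤ M w * ‖θ - θ'‖)
    (hg : ∀ w, HasGradientAt (fun θ => m θ w) (g w) θs)
    {H : Matrix (Fin d) (Fin d) ℝ} (hH : H.PosDef)
    (hexp : (fun h => ∫ w, (m (θs + h) w - m θs w) ∂ν -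
      1 / 2 * ⟪Matrix.toEuclideanCLM (n := Fin d) (𝕜 := ℝ) H h, h⟫) =o[𝓝 0] fun h => ‖h‖ ^ 2)
    {W : (n : ℕ) → Ω → Fin n → 𝒲} (hWm : ∀ n, Measurable (W n))
    (hW : ∀ n, P.map (W n) = Measure.pi fun _ => ν)
    {θh : ℕ → Ω → EuclideanSpace ℝ (Fin d)} (hθm : ∀ n, Measurable (θh n))
    (hcons : TendstoInMeasure P θh atTop fun _ => θs)
    (hmin : Tendsto (fun n : ℕ => P {ω | ¬ ∀ θ ∈ Metric.closedBall θs r,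
      ∑ i, m (θh n ω) (W n ω i) ≤ ∑ i, m θ (W n ω i)}) atTop (𝓝 0)) :
    (H⁻¹ * (Matrix.of fun i j => cov[fun w => g w i, fun w => g w j; ν]) * H⁻¹).PosSemidef ∧
      TendstoInDistribution (fun (n : ℕ) ω => √(n : ℝ) • (θh n ω - θs)) atTop id (fun _ => P)
        (multivariateGaussian 0
          (H⁻¹ * (Matrix.of fun i j => cov[fun w => g w i, fun w => g w j; ν]) * H⁻¹)) := by
  set A := Matrix.toEuclideanCLM (n := Fin d) (𝕜 := ℝ) H with hA
  set B := Matrix.toEuclideanCLM (n := Fin d) (𝕜 := ℝ) H⁻¹ with hB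
  have hAB : ∀ x, A (B x) = x := fun x => by
    have h1 : A * B = 1 := by
      rw [hA, hB, ← map_mul, Matrix.mul_nonsing_inv _
        ((Matrix.isUnit_iff_isUnit_det _).1 hH.isUnit), map_one]
    exact congrArg (fun L => L x) h1
  obtain ⟨c, hc, hcoer⟩ := exists_coercive_of_posDef hH
  have hlin := tendstoInMeasure_argmin_linearization hr hm hM hlip hg hAB
    (inner_toEuclideanCLM_symm hH.isHermitian) hc hcoer hexp hWm hW hcons hmin
  have hg0 := integral_gradient_eq_zero hr hm hM hlip hg
    (isLittleO_id_of_isLittleO_sub_quadratic A hexp)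
  have hgL := memLp_gradient hr hm hM hlip hg
  have hgm := measurable_gradient_of_hasGradientAt hr hm hg
  have hBL : MemLp (fun w => -B (g w)) 2 ν := (B.comp_memLp' hgL).neg
  have hB0 : ∫ w, -B (g w) ∂ν = 0 := by
    rw [integral_neg, B.integral_comp_comm (hgL.integrable one_le_two), hg0, map_zero, neg_zero]
  have hS := posSemidef_sandwich hH (posSemidef_covariance hgL)
  have hclt := tendstoInDistribution_normalized_sum (g := fun w => -B (g w)) (by fun_prop) hBL hB0
    hS (variance_inner_neg_inv hgL hH) hWm hW
  refine ⟨hS, tendstoInDistribution_of_tendstoInMeasure_sub _ _ hclt ?_ fun n => ?_⟩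
  · refine hlin.congr_left fun n => Eventually.of_forall fun ω => ?_
    simp only [Pi.sub_apply, Finset.sum_neg_distrib, smul_neg, sub_neg_eq_add, map_smul, map_sum]
  · have := hθm n
    fun_prop

/-! ### The active inference estimator -/

section Estimator

variable {𝒳 𝒴 Ω : Type*} [MeasurableSpace Ω] [MeasurableSpace 𝒳] [MeasurableSpace 𝒴]
  {P : Measure Ω} [IsProbabilityMeasure P] {Q : Measure (𝒳 × 𝒴)} [IsProbabilityMeasure Q]
  {X : ℕ → Ω → 𝒳} {Y : ℕ → Ω → 𝒴} {f : 𝒳 → 𝒴} {d : ℕ} {Θ : Set (EuclideanSpace ℝ (Fin d))}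
  {ℓ : EuclideanSpace ℝ (Fin d) → 𝒳 → 𝒴 → ℝ} {θs : EuclideanSpace ℝ (Fin d)}
  {H : Matrix (Fin d) (Fin d) ℝ}

lemma measurable_sample (hX : ∀ i, Measurable (X i)) (hY : ∀ i, Measurable (Y i)) {n : ℕ}
    {ξ : Ω → Fin n → Bool} (hξ : Measurable ξ) : Measurable (sample X Y ξ) :=
  measurable_pi_iff.2 fun i =>
    ((hX i).prodMk (hY i)).prodMk ((measurable_pi_apply i).comp hξ)

lemma gradient_eq_zero_of_isArgmin {L : EuclideanSpace ℝ (Fin d) → ℝ} (hθs : θs ∈ interior Θ)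
    (hmin : IsArgmin L Θ θs) : gradient L θs = 0 := by
  have h : IsLocalMin L θs := hmin.2.isLocalMin (mem_interior_iff_mem_nhds.1 hθs)
  rw [gradient, h.fderiv_eq_zero, map_zero]

/-- With a fixed sampling rule `π`, the active inference estimator is an M-estimator for the
inverse-propensity weighted loss under the law `labeledLaw Q π`. -/
theorem tendstoInDistribution_fixedRule (hX : ∀ i, Measurable (X i)) (hY : ∀ i, Measurable (Y i))
    (hlaw : ∀ i, P.map (fun ω => (X i ω, Y i ω)) = Q)
    (hindep : iIndepFun (fun i ω => (X i ω, Y i ω)) P) (hf : Measurable f)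
    (hℓm : ∀ θ ∈ Θ, Measurable (fun z : 𝒳 × 𝒴 => ℓ θ z.1 z.2))
    (hℓi : ∀ θ ∈ Θ, Integrable (fun z : 𝒳 × 𝒴 => ℓ θ z.1 z.2) Q)
    (hθs : θs ∈ interior Θ) (hθmin : IsArgmin (popLoss ℓ Q) Θ θs)
    (hsmooth : SmoothLoss ℓ f Q θs H) {π : 𝒳 → ℝ} (hπm : Measurable π) (hπ0 : ∀ x, 0 ≤ π x)
    (hπ1 : ∀ x, π x ≤ 1) (hipw : IPWSquareIntegrable ℓ f Q π θs) {ξ : (n : ℕ) → Ω → Fin n → Bool}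
    (hξ : ∀ n : ℕ, IsBernoulliLabeling P (fun ω (i : Fin n) => (X i ω, Y i ω))
      (fun ω (i : Fin n) => π (X i ω)) (ξ n))
    {T : (n : ℕ) → (Fin n → (𝒳 × 𝒴) × Bool) → EuclideanSpace ℝ (Fin d)}
    (hTm : ∀ n, Measurable (T n))
    (hT : ∀ (n : ℕ) (w : Fin n → (𝒳 × 𝒴) × Bool), (∃ θ, IsArgmin (activeLoss ℓ f π w) Θ θ) →
      IsArgmin (activeLoss ℓ f π w) Θ (T n w))
    (hTex : Tendsto (fun n : ℕ => P {ω | ¬ ∃ θ, IsArgmin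
      (activeLoss ℓ f π (sample X Y (ξ n) ω)) Θ θ}) atTop (𝓝 0))
    (hcons : TendstoInMeasure P (fun n ω => T n (sample X Y (ξ n) ω)) atTop fun _ => θs) :
    (sandwichCov ℓ f Q π θs H).PosSemidef ∧
      TendstoInDistribution (fun (n : ℕ) ω => √(n : ℝ) • (T n (sample X Y (ξ n) ω) - θs)) atTop id
        (fun _ => P) (multivariateGaussian 0 (sandwichCov ℓ f Q π θs H)) := by
  obtain ⟨U, hU, C, Cf, -, hCf, -, hCfL⟩ := hsmooth.lipschitz
  obtain ⟨U', hU', D, hD, hDm, hDi⟩ := hipw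
  obtain ⟨r, hr, hball⟩ := Metric.nhds_basis_closedBall.mem_iff.1
    (inter_mem (mem_interior_iff_mem_nhds.1 hθs) (inter_mem hU hU'))
  have := isProbabilityMeasure_labeledLaw (Q := Q) hπm hπ0 hπ1
  have hm : ∀ θ ∈ Metric.closedBall θs r, Measurable (ipwLoss ℓ f π θ) := fun θ hθ =>
    measurable_ipwLoss hf hπm (hℓm θ (hball hθ).1)
  have hM := memLp_ipwLip hπm hπ0 hπ1 hCfL hDm hDi
  have hlip : ∀ w, ∀ θ ∈ Metric.closedBall θs r, ∀ θ' ∈ Metric.closedBall θs r,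
      |ipwLoss ℓ f π θ w - ipwLoss ℓ f π θ' w| ≤ ipwLip π Cf D w * ‖θ - θ'‖ :=
    fun w θ hθ θ' hθ' => abs_ipwLoss_sub_le hπ0
      (fun x => hCf x θ (hball hθ).2.1 θ' (hball hθ').2.1)
      (fun x y => hD x y θ (hball hθ).2.2 θ' (hball hθ').2.2) w
  have hcenter : θs ∈ Metric.closedBall θs r := Metric.mem_closedBall_self hr.le
  have hexp := isLittleO_sub_quadratic_of_hasHessianAt hsmooth.hessian hsmooth.posDef.isHermitian
    (gradient_eq_zero_of_isArgmin hθs hθmin)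
  refine tendstoInDistribution_argmin (P := P) (W := fun n => sample X Y (ξ n))
    (θh := fun n ω => T n (sample X Y (ξ n) ω)) hr hm hM (Eventually.of_forall hlip)
    (hasGradientAt_ipwLoss hsmooth.differentiable) hsmooth.posDef ?_
    (fun n => measurable_sample hX hY (hξ n).1) (fun n => ?_)
    (fun n => (hTm n).comp (measurable_sample hX hY (hξ n).1)) hcons ?_
  · refine hexp.congr' ?_ EventuallyEq.rfl
    filter_upwards [Metric.closedBall_mem_nhds (0 : EuclideanSpace ℝ (Fin d)) hr] with h hh
    have hmem : θs + h ∈ Metric.closedBall θs r := by simpa using hh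
    rw [integral_ipwLoss_sub hπm hπ0 hπ1 hDm hDi
      (fun x y => hD x y _ (hball hmem).2.2 _ (hball hcenter).2.2)
      (hℓi _ (hball hmem).1) (hℓi _ (hball hcenter).1)]
    refine ((hM.integrable one_le_two).mul_const ‖θs + h - θs‖).mono'
      ((hm _ hmem).sub (hm _ hcenter)).aestronglyMeasurable (Eventually.of_forall fun w => ?_)
    exact hlip w _ hmem _ hcenter
  · exact map_labeled_eq_pi (Z := fun (i : Fin n) ω => (X i ω, Y i ω)) hπm hπ0 hπ1
      (fun i => (hX i).prodMk (hY i)) (fun i => hlaw i)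
      (hindep.precomp (g := fun i : Fin n => (i : ℕ)) Fin.val_injective) (hξ n)
  · refine tendsto_of_tendsto_of_tendsto_of_le_of_le tendsto_const_nhds hTex
      (fun _ => zero_le) fun n => measure_mono fun ω hω hex => hω fun θ hθ => ?_
    rcases n.eq_zero_or_pos with rfl | hn
    · simp
    · have h := (hT n _ hex).2 (hball hθ).1
      have hn' : (0 : ℝ) < 1 / (n : ℝ) := by positivity
      exact le_of_mul_le_mul_left h hn'

/-- The data-driven scaling has the same limit law as `ηs`: on the event that both agree, so do the
label probabilities and hence the laws of the labeled samples. -/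
theorem tendstoInDistribution_of_fixedRule (hX : ∀ i, Measurable (X i))
    (hY : ∀ i, Measurable (Y i)) {u : 𝒳 → ℝ} {ηhat : (n : ℕ) → (Fin n → 𝒳) → ℝ}
    (hηm : ∀ n, Measurable (ηhat n)) {ηs : ℝ}
    (hηlim : Tendsto (fun n : ℕ => P {ω | ηhat n (fun i => X i ω) ≠ ηs}) atTop (𝓝 0))
    {ξ ξs : (n : ℕ) → Ω → Fin n → Bool}
    (hξ : ∀ n : ℕ, IsBernoulliLabeling P (fun ω (i : Fin n) => (X i ω, Y i ω))
      (fun ω (i : Fin n) => samplingRule u (ηhat n (fun k => X k ω)) (X i ω)) (ξ n))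
    (hξs : ∀ n : ℕ, IsBernoulliLabeling P (fun ω (i : Fin n) => (X i ω, Y i ω))
      (fun ω (i : Fin n) => samplingRule u ηs (X i ω)) (ξs n))
    {T : (n : ℕ) → ℝ → (Fin n → (𝒳 × 𝒴) × Bool) → EuclideanSpace ℝ (Fin d)}
    (hTm : ∀ n, Measurable (fun p : ℝ × (Fin n → (𝒳 × 𝒴) × Bool) => T n p.1 p.2))
    {Ω' : Type*} [MeasurableSpace Ω'] {μ : Measure Ω'} [IsProbabilityMeasure μ]
    {Z : Ω' → EuclideanSpace ℝ (Fin d)}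
    (h : TendstoInDistribution
      (fun (n : ℕ) ω => √(n : ℝ) • (T n ηs (sample X Y (ξs n) ω) - θs)) atTop Z (fun _ => P) μ) :
    TendstoInDistribution (fun (n : ℕ) ω => √(n : ℝ) •
      (T n (ηhat n (fun i => X i ω)) (sample X Y (ξ n) ω) - θs)) atTop Z (fun _ => P) μ := by
  refine tendstoInDistribution_of_measure_le_add h (fun n => ?_) hηlim fun n G hG => ?_
  · have hη : Measurable fun ω => ηhat n (fun i => X i ω) :=
      (hηm n).comp (measurable_pi_iff.2 fun i => hX i)
    have := (hTm n).comp (hη.prodMk (measurable_sample hX hY (hξ n).1))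
    exact (this.sub_const θs).const_smul (√(n : ℝ))
  · have hTs : Measurable (T n ηs) := (hTm n).comp measurable_prodMk_left
    have hS : MeasurableSet {w | √(n : ℝ) • (T n ηs w - θs) ∈ G} :=
      ((hTs.sub_const θs).const_smul (√(n : ℝ))) hG
    have hA : MeasurableSet {z : Fin n → 𝒳 × 𝒴 | ηhat n (fun i => (z i).1) = ηs} :=
      ((hηm n).comp (by fun_prop : Measurable fun (z : Fin n → 𝒳 × 𝒴) i => (z i).1))
        (measurableSet_singleton ηs)
    have hZ : Measurable fun ω (i : Fin n) => (X i ω, Y i ω) :=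
      measurable_pi_iff.2 fun i => (hX i).prodMk (hY i)
    have hcongr := measure_labeled_congr hZ (hξ n) (hξs n) hA
      (fun ω (hω : ηhat n (fun i => X i ω) = ηs) => by simp only [hω]) hS
    calc P ((fun ω => √(n : ℝ) • (T n ηs (sample X Y (ξs n) ω) - θs)) ⁻¹' G)
        ≤ P ((fun ω (i : Fin n) => (X i ω, Y i ω)) ⁻¹'
            {z | ηhat n (fun i => (z i).1) = ηs} ∩
            {ω | (fun i : Fin n => ((X i ω, Y i ω), ξs n ω i)) ∈
              {w | √(n : ℝ) • (T n ηs w - θs) ∈ G}}) +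
            P {ω | ηhat n (fun i => X i ω) ≠ ηs} := by
          refine (measure_mono fun ω hω => ?_).trans (measure_union_le _ _)
          by_cases hη : ηhat n (fun i => X i ω) = ηs
          · exact Or.inl ⟨hη, hω⟩
          · exact Or.inr hη
      _ ≤ _ := by
          rw [← hcongr]
          gcongr
          rintro ω ⟨hη, hω⟩
          have hη' : ηhat n (fun i => X i ω) = ηs := hη
          change √(n : ℝ) • (T n (ηhat n (fun i => X i ω)) (sample X Y (ξ n) ω) - θs) ∈ G
          rw [hη']
          exact hω

end Estimator

end ActiveInference

theorem theorem1
    {Ω 𝒳 𝒴 : Type*} [MeasurableSpace Ω] [MeasurableSpace 𝒳] [MeasurableSpace 𝒴]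
    (P : Measure Ω) [IsProbabilityMeasure P]
    -- i.i.d. data with law `Q`
    (Q : Measure (𝒳 × 𝒴)) [IsProbabilityMeasure Q]
    (X : ℕ → Ω → 𝒳) (Y : ℕ → Ω → 𝒴)
    (hX : ∀ i, Measurable (X i)) (hY : ∀ i, Measurable (Y i))
    (hlaw : ∀ i, P.map (fun ω => (X i ω, Y i ω)) = Q)
    (hindep : iIndepFun (fun i ω => (X i ω, Y i ω)) P)
    -- predictive model, uncertainty measure, family of sampling rules, budget
    (f : 𝒳 → 𝒴) (hf : Measurable f)
    (u : 𝒳 → ℝ) (hu : Measurable u) (hu0 : ∀ x, 0 ≤ u x)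
    (𝓗 : Set ℝ) (h𝓗0 : ∀ η ∈ 𝓗, 0 ≤ η)
    (h𝓗1 : ∀ η ∈ 𝓗, ∀ x, ActiveInference.samplingRule u η x ≤ 1)
    (nb : ℕ → ℝ)
    -- convex M-estimation
    {d : ℕ} (Θ : Set (EuclideanSpace ℝ (Fin d)))
    (ℓ : EuclideanSpace ℝ (Fin d) → 𝒳 → 𝒴 → ℝ)
    (hℓm : ∀ θ ∈ Θ, Measurable (fun z : 𝒳 × 𝒴 => ℓ θ z.1 z.2))
    (hℓi : ∀ θ ∈ Θ, Integrable (fun z : 𝒳 × 𝒴 => ℓ θ z.1 z.2) Q)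
    (hℓc : ∀ x y, ConvexOn ℝ Θ (fun θ => ℓ θ x y))
    (θs : EuclideanSpace ℝ (Fin d)) (hθs : θs ∈ interior Θ)
    (hθmin : ActiveInference.IsArgmin (ActiveInference.popLoss ℓ Q) Θ θs)
    -- smoothness, with Hessian `H`
    (H : Matrix (Fin d) (Fin d) ℝ)
    (hsmooth : ActiveInference.SmoothLoss ℓ f Q θs H)
    -- data-driven scaling: the largest scaling in `𝓗` that meets the budget
    (ηhat : (n : ℕ) → (Fin n → 𝒳) → ℝ) (hηm : ∀ n, Measurable (ηhat n))
    (hη𝓗 : ∀ n x, ηhat n x ∈ 𝓗)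
    (hηmax : ∀ n x, (∃ η, IsGreatest (ActiveInference.feasibleScalings u 𝓗 (nb n) x) η) →
      IsGreatest (ActiveInference.feasibleScalings u 𝓗 (nb n) x) (ηhat n x))
    -- limiting scaling
    (ηs : ℝ) (hηs : ηs ∈ 𝓗)
    (hηlim : Tendsto (fun n : ℕ => P {ω | ηhat n (fun i => X i ω) ≠ ηs}) atTop (𝓝 0))
    (hipw : ActiveInference.IPWSquareIntegrable ℓ f Q (ActiveInference.samplingRule u ηs) θs)
    -- label decisions under `π_{η̂}` and under `π_{η*}`
    (ξ ξs : (n : ℕ) → Ω → Fin n → Bool)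
    (hξ : ∀ n : ℕ, ActiveInference.IsBernoulliLabeling P
      (fun ω (i : Fin n) => (X i ω, Y i ω))
      (fun ω (i : Fin n) => ActiveInference.samplingRule u (ηhat n (fun k => X k ω)) (X i ω))
      (ξ n))
    (hξs : ∀ n : ℕ, ActiveInference.IsBernoulliLabeling P
      (fun ω (i : Fin n) => (X i ω, Y i ω))
      (fun ω (i : Fin n) => ActiveInference.samplingRule u ηs (X i ω))
      (ξs n))
    -- `T n η w` is the estimator `argmin_θ L^{π_η}(θ)` computed from the sample `w`
    (T : (n : ℕ) → ℝ → (Fin n → (𝒳 × 𝒴) × Bool) → EuclideanSpace ℝ (Fin d))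
    (hTm : ∀ n, Measurable
      (fun p : ℝ × (Fin n → (𝒳 × 𝒴) × Bool) => T n p.1 p.2))
    (hT : ∀ n, ∀ η ∈ 𝓗, ∀ w : Fin n → (𝒳 × 𝒴) × Bool,
      (∃ θ, ActiveInference.IsArgmin
        (ActiveInference.activeLoss ℓ f (ActiveInference.samplingRule u η) w) Θ θ) →
      ActiveInference.IsArgmin
        (ActiveInference.activeLoss ℓ f (ActiveInference.samplingRule u η) w) Θ (T n η w))
    (hTex : Tendsto (fun n : ℕ => P {ω | ¬ ∃ θ, ActiveInference.IsArgmin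
        (ActiveInference.activeLoss ℓ f (ActiveInference.samplingRule u ηs)
          (ActiveInference.sample X Y (ξs n) ω)) Θ θ}) atTop (𝓝 0))
    -- consistency of the estimator at `η*`
    (hcons : TendstoInMeasure P
      (fun n ω => T n ηs (ActiveInference.sample X Y (ξs n) ω)) atTop (fun _ => θs)) :
    TendstoInDistribution
      (fun (n : ℕ) ω => √(n : ℝ) •
        (T n (ηhat n (fun i => X i ω)) (ActiveInference.sample X Y (ξ n) ω) - θs))
      atTop id (fun _ => P)
      (multivariateGaussian 0
        (ActiveInference.sandwichCov ℓ f Q (ActiveInference.samplingRule u ηs) θs H)) ∧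
    ∀ (Shat : ℕ → Ω → Matrix (Fin d) (Fin d) ℝ),
      (∀ i j, TendstoInMeasure P (fun n ω => Shat n ω i j) atTop
        (fun _ => ActiveInference.sandwichCov ℓ f Q (ActiveInference.samplingRule u ηs) θs H i j)) →
      ∀ j, 0 < ActiveInference.sandwichCov ℓ f Q (ActiveInference.samplingRule u ηs) θs H j j →
      ∀ α ∈ Set.Ioo (0 : ℝ) 1,
        Tendsto
          (fun n : ℕ => P.real {ω | θs j ∈ Set.Icc
            (T n (ηhat n (fun i => X i ω)) (ActiveInference.sample X Y (ξ n) ω) j -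
              ActiveInference.stdNormalQuantile (1 - α / 2) * √(Shat n ω j j / n))
            (T n (ηhat n (fun i => X i ω)) (ActiveInference.sample X Y (ξ n) ω) j +
              ActiveInference.stdNormalQuantile (1 - α / 2) * √(Shat n ω j j / n))})
          atTop (𝓝 (1 - α)) := by
  have hπm : Measurable (ActiveInference.samplingRule u ηs) := hu.const_mul ηs
  have hπ0 : ∀ x, 0 ≤ ActiveInference.samplingRule u ηs x := fun x =>
    mul_nonneg (h𝓗0 ηs hηs) (hu0 x)
  obtain ⟨hS, hfixed⟩ := ActiveInference.tendstoInDistribution_fixedRule hX hY hlaw hindep hf hℓm hℓi hθs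
    hθmin hsmooth hπm hπ0 (h𝓗1 ηs hηs) hipw hξs (T := fun n => T n ηs)
    (fun n => (hTm n).comp measurable_prodMk_left) (fun n w => hT n ηs hηs w) hTex hcons
  have hlim := ActiveInference.tendstoInDistribution_of_fixedRule hX hY hηm hηlim hξ hξs hTm hfixed
  exact ⟨hlim, fun Shat hShat j hj α hα => ActiveInference.tendsto_measureReal_mem_interval
    hS hlim hj (hShat j j) hα⟩
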